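/- For $n\ge 0$ let $g_n=\sum_{\mu} s_\mu$ be the sum of the Schur functions $s_\mu$ over all partitions $\mu$ of $n$, where for $n\ge 3$ the partition $(n-1,1)$ and its transpose $(2,1^{n-2})$ are left out (so $g_0=1$, $g_1=s_{(1)}$, $g_2=s_{(2)}+s_{(1^2)}$, $g_3=s_{(3)}+s_{(1^3)}$). Let $\lambda=(\lambda_1,\lambda_2,\dots)$ be a partition of $n$ with at least two parts. The product $\prod_i g_{\lambda_i}$ is the Frobenius characteristic of a finite-dimensional complex $S_n$-module $W_\lambda$; here the Frobenius characteristic of an $S_n$-module $W$ with character $\chi_W$ is $\frac1{n!}\sum_{w\in S_n}\chi_W(w)\,p_{\mathrm{cyc}(w)}$, where $\mathrm{cyc}(w)$ is the cycle type of $w$ and $p_\nu=\prod_i p_{\nu_i}$ is the power-sum symmetric function. For any such module $W_\lambda$, every irreducible complex $S_n$-module occurs in $W_\lambda$ if and only if $\lambda$ is not one of the six partitions $$(3,1),\ (4,1),\ (3,3),\ (4,4),\ (5,3),\ (4,4,1).$$ -/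

import Mathlib

universe u v

noncomputable section

namespace FrobChar

/-- The ambient ring of symmetric functions with complex coefficients: formal power series in
the countably many variables `x₀, x₁, x₂, …`. -/
abbrev SymFun : Type := MvPowerSeries ℕ ℂ

/-- The power sum `p_k = ∑ᵢ xᵢ ^ k` (for `k ≥ 1`). -/
def powerSum (k : ℕ) : SymFun := by
  classical exact fun d => if ∃ i : ℕ, d = Finsupp.single i k then 1 else 0

/-- The content of a semistandard tableau `T`: the exponent of the monomial `x^T`, in which the
exponent of `xᵢ` is the number of cells of `T` with entry `i`. -/
def content {μ : YoungDiagram} (T : SemistandardYoungTableau μ) : ℕ →₀ ℕ :=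
  ∑ c ∈ μ.cells, Finsupp.single (T c.1 c.2) 1

/-- The Schur function `s_μ = ∑_T x^T`, the sum over all semistandard tableaux `T` of shape `μ`:
the coefficient of `x^d` is the (finite) number of such tableaux of content `d`. -/
def schur (μ : YoungDiagram) : SymFun :=
  fun d => (Nat.card {T : SemistandardYoungTableau μ // content T = d} : ℂ)

/-- The Ferrers diagram of a partition, whose row lengths are the parts in decreasing order. -/
def diagram {n : ℕ} (μ : n.Partition) : YoungDiagram :=
  YoungDiagram.ofRowLens (μ.parts.sort (· ≥ ·)) (Multiset.pairwise_sort μ.parts (· ≥ ·)).sortedGE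

/-- For `n ≥ 3`, the partitions `(n-1, 1)` and its transpose `(2, 1^{n-2})` are left out of `g_n`;
for `n ≤ 2` nothing is left out. -/
def Omitted {n : ℕ} (μ : n.Partition) : Prop :=
  3 ≤ n ∧ (μ.parts = {n - 1, 1} ∨ μ.parts = 2 ::ₘ Multiset.replicate (n - 2) 1)

/-- `g_n`, the sum of the Schur functions `s_μ` over the partitions `μ` of `n` that are not
omitted. -/
def g (n : ℕ) : SymFun := by
  classical exact ∑ μ : n.Partition with ¬ Omitted μ, schur (diagram μ)

/-- The Frobenius characteristic
`ch W = (1 / n!) ∑_{w ∈ S_n} χ_W(w) p_{cycle type of w}` of a representation of `S_n`; the cycle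
type `w.partition` includes the fixed points as parts `1`. -/
def frobeniusCharacteristic {n : ℕ} {W : Type u} [AddCommGroup W] [Module ℂ W]
    (ρ : Representation ℂ (Equiv.Perm (Fin n)) W) : SymFun :=
  ((n.factorial : ℂ)⁻¹) •
    ∑ w : Equiv.Perm (Fin n), ρ.character w • (w.partition.parts.map powerSum).prod

/-- Every irreducible complex representation of `G` is isomorphic to a subrepresentation
of `ρ`. -/
def ContainsEveryIrreducible {G : Type} [Group G] {W : Type u} [AddCommGroup W] [Module ℂ W]
    (ρ : Representation ℂ G W) : Prop :=
  ∀ (V : Type v) [AddCommGroup V] [Module ℂ V] (σ : Representation ℂ G V),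
    σ.IsIrreducible → ∃ f : σ.IntertwiningMap ρ, Function.Injective f

end FrobChar

end

/-!
Write `χ^μ(w)` for the coefficient of the Schur function `s_μ` in the power sum of the cycle type
of `w`. The proof has a representation-theoretic half, which shows that an irreducible
`S_n`-module is missing from `W_λ` exactly if some `s_μ` does not occur in `∏ g_{λ_i}`, and a
combinatorial half, which decides when this happens.

**Characters.** Schur functions are defined by semistandard tableaux. Stripping the largest
entries of a tableau and exchanging horizontal strips by a local rule gives Pieri's rule
`schur_rowDiagram_mul_schur`, and by iteration the expansion of complete functions with Kostka
numbers as coefficients. The Kostka matrix is unitriangular, so its inverse reads off the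
coefficient of `s_μ` (`schurCoeff`) and makes `χ^μ` an integral combination of permutation
characters on words. Burnside's lemma for pairs of words (`sum_permChar_mul_permChar`) then yields
`charMap_schurChar`, that the Frobenius characteristic of `χ^μ` is `s_μ`, and hence
orthonormality. A character of norm one is a combination of the `χ^μ` with integral coefficients
whose squares sum to one, so it is some `χ^μ`, the sign being fixed by the value at the identity
(`IsCharacter.eq_schurChar`); conversely every `χ^μ` is the character of an irreducible
constituent of a permutation representation. This gives `containsEveryIrreducible_iff` and
`SchurPositive.exists_representation`.

**Products.** Littlewood–Richardson coefficients are multiplicities for Young subgroups, hence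
nonnegative (`exists_schurCoeff_mul_eq`), so occurrence in a product can be traced through its
factors and through associativity (`LR.assoc`). Two consequences carry the combinatorial half.
Whenever `s_μ` occurs in `s_α s_β` and `μ` grows, `α` and `β` can be enlarged to diagrams of any
sizes with the right sum (`LR.exists_enlarge`). And occurrence is invariant under transposition of
all diagrams (`LR.transpose`): multiplication of characters by the sign permutes the diagrams
compatibly with inclusion, and transposition is the only such permutation that exchanges the two
diagrams with two cells.

**Combinatorics.** A diagram with at least two cells more than `k` contains a diagram with `k`
cells that is not left out of `g_k` (`exists_good_le`). Therefore a product with a full subproduct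
of degree at least two is full (`Full.mono`), and it suffices to know which small products are
full. For two factors (`full_pair`), hooks and diagrams with two rows are treated directly with
Pieri's rule, and any other wide diagram contains one of a few small diagrams that occur in a
product of two diagrams, such as `(2, 2)` and `(3, 1, 1)`, whose enlargements are never left out;
products with `s_{22}` are computed from the Jacobi–Trudi formula `s_{22} = h_2 h_2 - h_3 h_1`.
The pairs that are not full leave only the triples `331`, `333`, `533`, `444` and `441` as the
largest parts of a partition; the first four are full by a finite check. In the products for `31`,
`41`, `33`, `44`, `53` and `441` the diagrams `22`, `311`, `321`, `332`, `44` and `333`,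
respectively, are missing.
-/

/-! ### Horizontal strips -/

namespace YoungDiagram

instance : DecidableEq YoungDiagram := fun μ ν =>
  decidable_of_iff (μ.cells = ν.cells) ⟨YoungDiagram.ext, congrArg _⟩

theorem rowLen_eq_zero_of_colLen_le (μ : YoungDiagram) {i : ℕ} (h : μ.colLen 0 ≤ i) :
    μ.rowLen i = 0 := by
  by_contra hne
  have : (i, 0) ∈ μ := mem_iff_lt_rowLen.2 (Nat.pos_of_ne_zero hne)
  exact absurd (mem_iff_lt_colLen.1 this) (by omega)

theorem ext_rowLen {μ ν : YoungDiagram} (h : ∀ i, μ.rowLen i = ν.rowLen i) : μ = ν := by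
  ext ⟨i, j⟩
  simp only [mem_cells, mem_iff_lt_rowLen, h]

theorem le_iff_rowLen {μ ν : YoungDiagram} : μ ≤ ν ↔ ∀ i, μ.rowLen i ≤ ν.rowLen i := by
  constructor
  · intro h i
    by_contra hlt
    have h1 : (i, ν.rowLen i) ∈ μ := mem_iff_lt_rowLen.2 (by omega)
    exact absurd (mem_iff_lt_rowLen.1 (h h1)) (by omega)
  · rintro h ⟨i, j⟩ hc
    exact mem_iff_lt_rowLen.2 ((mem_iff_lt_rowLen.1 hc).trans_le (h i))

theorem card_mono {μ ν : YoungDiagram} (h : μ ≤ ν) : μ.card ≤ ν.card :=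
  Finset.card_le_card (cells_subset_iff.2 h)

theorem eq_of_le_of_card_le {μ ν : YoungDiagram} (h : μ ≤ ν) (hc : ν.card ≤ μ.card) : μ = ν :=
  YoungDiagram.ext (Finset.eq_of_subset_of_card_le (cells_subset_iff.2 h) hc)

theorem card_eq_sum_rowLen (μ : YoungDiagram) {N : ℕ} (h : μ.rowLen N = 0) :
    μ.card = ∑ i ∈ Finset.range N, μ.rowLen i := by
  have hmaps : ∀ c ∈ μ.cells, c.1 ∈ Finset.range N := by
    rintro ⟨i, j⟩ hc
    rw [Finset.mem_range]
    by_contra hi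
    have h1 := mem_iff_lt_rowLen.1 hc
    have h2 := μ.rowLen_anti N i (by simpa using hi)
    omega
  rw [YoungDiagram.card, Finset.card_eq_sum_card_fiberwise hmaps]
  refine Finset.sum_congr rfl fun i _ => ?_
  rw [rowLen_eq_card]
  rfl

/-- The Young diagram with prescribed row lengths. -/
def ofRowLenFun (f : ℕ → ℕ) (hf : Antitone f) (N : ℕ) : YoungDiagram where
  cells := (Finset.range N ×ˢ Finset.range (f 0)).filter fun c => c.2 < f c.1
  isLowerSet := by
    rintro ⟨i, j⟩ ⟨i', j'⟩ hle hc
    obtain ⟨h1, h2⟩ := Prod.mk_le_mk.1 hle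
    simp only [Finset.coe_filter, Finset.mem_product, Finset.mem_range, Set.mem_ofPred_eq] at hc ⊢
    have h3 := hf h1
    omega

theorem rowLen_ofRowLenFun {f : ℕ → ℕ} (hf : Antitone f) {N : ℕ} (hN : f N = 0) (i : ℕ) :
    (ofRowLenFun f hf N).rowLen i = f i := by
  have key : ∀ j, j < (ofRowLenFun f hf N).rowLen i ↔ j < f i := by
    intro j
    rw [← mem_iff_lt_rowLen, ← mem_cells]
    simp only [ofRowLenFun, Finset.mem_filter, Finset.mem_product, Finset.mem_range]
    constructor
    · exact fun h => h.2
    · intro h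
      refine ⟨⟨?_, h.trans_le (hf (Nat.zero_le _))⟩, h⟩
      by_contra hi
      have := hf (not_lt.1 hi)
      omega
  have h1 := key (f i)
  have h2 := key ((ofRowLenFun f hf N).rowLen i)
  omega

theorem exists_rowLen_eq {f : ℕ → ℕ} (hf : Antitone f) {N : ℕ} (hN : f N = 0) :
    ∃ μ : YoungDiagram, ∀ i, μ.rowLen i = f i :=
  ⟨ofRowLenFun f hf N, rowLen_ofRowLenFun hf hN⟩

theorem rowLen_bot (i : ℕ) : (⊥ : YoungDiagram).rowLen i = 0 := by
  by_contra h
  exact notMem_bot (i, 0) (mem_iff_lt_rowLen.2 (Nat.pos_of_ne_zero h))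

theorem card_bot : (⊥ : YoungDiagram).card = 0 := rfl

theorem card_eq_zero_iff {μ : YoungDiagram} : μ.card = 0 ↔ μ = ⊥ :=
  ⟨fun h => (eq_of_le_of_card_le bot_le h.le).symm, fun h => by rw [h, card_bot]⟩

theorem lt_card_of_mem {μ : YoungDiagram} {i j : ℕ} (h : (i, j) ∈ μ) : i < μ.card ∧ j < μ.card := by
  constructor
  · have h1 : (Finset.range (i + 1)).image (fun a => (a, j)) ⊆ μ.cells := by
      intro c hc
      obtain ⟨a, ha, rfl⟩ := Finset.mem_image.1 hc
      exact μ.up_left_mem (Nat.lt_succ_iff.1 (Finset.mem_range.1 ha)) le_rfl h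
    have h2 := Finset.card_le_card h1
    rw [Finset.card_image_of_injective _ (fun a b h => (Prod.mk.inj h).1), Finset.card_range] at h2
    exact h2
  · have h1 : (Finset.range (j + 1)).image (fun a => (i, a)) ⊆ μ.cells := by
      intro c hc
      obtain ⟨a, ha, rfl⟩ := Finset.mem_image.1 hc
      exact μ.up_left_mem le_rfl (Nat.lt_succ_iff.1 (Finset.mem_range.1 ha)) h
    have h2 := Finset.card_le_card h1
    rw [Finset.card_image_of_injective _ (fun a b h => (Prod.mk.inj h).2), Finset.card_range] at h2
    exact h2

theorem finite_setOf_card_eq (n : ℕ) : {μ : YoungDiagram | μ.card = n}.Finite := by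
  refine Set.Finite.of_finite_image (f := YoungDiagram.cells)
    (((Finset.range n ×ˢ Finset.range n).powerset).finite_toSet.subset ?_)
    (fun _ _ _ _ h => YoungDiagram.ext h)
  rintro _ ⟨μ, hμ, rfl⟩
  simp only [Finset.coe_powerset, Set.mem_preimage, Set.mem_powerset_iff, Finset.coe_subset]
  rintro ⟨i, j⟩ hc
  have hμ' : μ.card = n := hμ
  simpa [hμ'] using lt_card_of_mem hc

/-- The Young diagrams with `n` cells. -/
noncomputable def sized (n : ℕ) : Finset YoungDiagram := (finite_setOf_card_eq n).toFinset

@[simp] theorem mem_sized {n : ℕ} {μ : YoungDiagram} : μ ∈ sized n ↔ μ.card = n := by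
  simp [sized]

/-- `HorizontalStrip κ μ` says that `κ ⊆ μ` and that the skew shape `μ / κ` has at most one cell
in each column, in the form of the interlacing `μ₀ ≥ κ₀ ≥ μ₁ ≥ κ₁ ≥ ⋯` of row lengths. -/
def HorizontalStrip (κ μ : YoungDiagram) : Prop :=
  ∀ i, κ.rowLen i ≤ μ.rowLen i ∧ μ.rowLen (i + 1) ≤ κ.rowLen i

theorem HorizontalStrip.le {κ μ : YoungDiagram} (h : HorizontalStrip κ μ) : κ ≤ μ :=
  le_iff_rowLen.2 fun i => (h i).1

theorem HorizontalStrip.card_le {κ μ : YoungDiagram} (h : HorizontalStrip κ μ) :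
    κ.card ≤ μ.card :=
  card_mono h.le

theorem finite_setOf_horizontalStrip (μ : YoungDiagram) : {κ | HorizontalStrip κ μ}.Finite := by
  refine ((Finset.range (μ.card + 1)).finite_toSet.biUnion
    fun n _ => finite_setOf_card_eq n).subset ?_
  intro κ hκ
  simpa using Nat.lt_succ_of_le (HorizontalStrip.card_le hκ)

/-- The diagrams `κ` for which `μ / κ` is a horizontal strip. -/
noncomputable def strips (μ : YoungDiagram) : Finset YoungDiagram :=
  (finite_setOf_horizontalStrip μ).toFinset

@[simp] theorem mem_strips {κ μ : YoungDiagram} : κ ∈ strips μ ↔ HorizontalStrip κ μ := by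
  simp [strips]

/-! The local rule behind the commutation of adding and removing horizontal strips: for fixed
`κ` and `ν`, it exchanges the diagrams `μ` containing both by horizontal strips with the
diagrams `τ` contained in both, together with a number `t`. -/

/-- The local rule downwards: from two horizontal strips with the same outer diagram `μ`, the
diagram `τ` inside both inner diagrams with row lengths `min κᵢ νᵢ + max κᵢ₊₁ νᵢ₊₁ - μᵢ₊₁`. The
first row of `μ` is not used. -/
theorem exists_below_of_above {κ ν μ : YoungDiagram} (hκ : HorizontalStrip κ μ)
    (hν : HorizontalStrip ν μ) :
    ∃ τ : YoungDiagram, (∀ i, τ.rowLen i = min (κ.rowLen i) (ν.rowLen i) +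
      max (κ.rowLen (i + 1)) (ν.rowLen (i + 1)) - μ.rowLen (i + 1)) := by
  refine exists_rowLen_eq (N := κ.colLen 0) (antitone_nat_of_succ_le fun i => ?_) ?_
  · have h1 := hκ i; have h2 := hκ (i + 1); have h3 := hν i; have h4 := hν (i + 1)
    have h5 := hκ (i + 1 + 1); have h6 := hν (i + 1 + 1)
    omega
  · have h1 := κ.rowLen_eq_zero_of_colLen_le le_rfl
    have h2 := hκ (κ.colLen 0); have h3 := hν (κ.colLen 0); have h4 := hν (κ.colLen 0 + 1)
    have h5 := hκ (κ.colLen 0 + 1)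
    omega

/-- The local rule upwards, inverse to `exists_below_of_above`; the number `t` carries the length
of the first row. -/
theorem exists_above_of_below {κ ν τ : YoungDiagram} (hκ : HorizontalStrip τ κ)
    (hν : HorizontalStrip τ ν) (t : ℕ) :
    ∃ μ : YoungDiagram, μ.rowLen 0 = max (κ.rowLen 0) (ν.rowLen 0) + t ∧
      ∀ i, μ.rowLen (i + 1) = min (κ.rowLen i) (ν.rowLen i) +
        max (κ.rowLen (i + 1)) (ν.rowLen (i + 1)) - τ.rowLen i := by
  let f : ℕ → ℕ
    | 0 => max (κ.rowLen 0) (ν.rowLen 0) + t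
    | i + 1 => min (κ.rowLen i) (ν.rowLen i) + max (κ.rowLen (i + 1)) (ν.rowLen (i + 1)) - τ.rowLen i
  have hf : Antitone f := antitone_nat_of_succ_le fun i => by
    cases i with
    | zero =>
      have h1 := hκ 0; have h2 := hν 0
      simp only [f]; omega
    | succ i =>
      have h1 := hκ i; have h2 := hκ (i + 1); have h3 := hν i; have h4 := hν (i + 1)
      simp only [f]; omega
  obtain ⟨μ, hμ⟩ := exists_rowLen_eq hf (N := max (κ.colLen 0) (ν.colLen 0) + 1) (by
    have h1 := κ.rowLen_eq_zero_of_colLen_le (le_max_left (κ.colLen 0) (ν.colLen 0))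
    have h2 := ν.rowLen_eq_zero_of_colLen_le (le_max_right (κ.colLen 0) (ν.colLen 0))
    have h3 := hκ (max (κ.colLen 0) (ν.colLen 0)); have h4 := hν (max (κ.colLen 0) (ν.colLen 0))
    simp only [f]; omega)
  exact ⟨μ, hμ 0, fun i => hμ (i + 1)⟩

theorem card_add_card_of_exchange {κ ν μ τ : YoungDiagram} {t : ℕ}
    (h0 : μ.rowLen 0 = max (κ.rowLen 0) (ν.rowLen 0) + t)
    (h : ∀ i, τ.rowLen i + μ.rowLen (i + 1) = min (κ.rowLen i) (ν.rowLen i) +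
      max (κ.rowLen (i + 1)) (ν.rowLen (i + 1))) :
    τ.card + μ.card = κ.card + ν.card + t := by
  have hN : ∃ N, κ.rowLen N = 0 ∧ ν.rowLen N = 0 ∧ τ.rowLen N = 0 ∧ μ.rowLen N = 0 := by
    refine ⟨κ.colLen 0 + ν.colLen 0 + τ.colLen 0 + μ.colLen 0, ?_, ?_, ?_, ?_⟩ <;>
    · apply rowLen_eq_zero_of_colLen_le; omega
  obtain ⟨N, h1, h2, h3, h4⟩ := hN
  have h5 : ∀ {α : YoungDiagram}, α.rowLen N = 0 → α.rowLen (N + 1) = 0 := fun {α} h => by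
    have := α.rowLen_anti N (N + 1) (by omega); omega
  rw [card_eq_sum_rowLen μ (h5 h4), card_eq_sum_rowLen τ h3, Finset.sum_range_succ',
    card_eq_sum_rowLen κ h1, card_eq_sum_rowLen ν h2, ← add_assoc, ← Finset.sum_add_distrib,
    ← Finset.sum_add_distrib, Finset.sum_congr rfl fun i _ => h i, h0]
  have h6 : ∑ i ∈ Finset.range N, (κ.rowLen i + ν.rowLen i) =
      ∑ i ∈ Finset.range N, min (κ.rowLen i) (ν.rowLen i) +
      ∑ i ∈ Finset.range N, max (κ.rowLen i) (ν.rowLen i) := by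
    rw [← Finset.sum_add_distrib]
    exact Finset.sum_congr rfl fun i _ => (min_add_max _ _).symm
  have h7 := Finset.sum_range_succ' (fun i => max (κ.rowLen i) (ν.rowLen i)) N
  rw [Finset.sum_range_succ, h1, h2, max_self, add_zero] at h7
  rw [Finset.sum_add_distrib, h6, h7]
  ring

open scoped Classical in
/-- Adding a horizontal strip of size `k` and then removing one, weighted by `x` to the size of
the latter, is removing a strip first and adding a smaller one afterwards. The local rule is a
bijection between the two kinds of pairs of strips. -/
theorem sum_strips_exchange {R : Type*} [CommSemiring R] (x : R) (F : YoungDiagram → R)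
    (ν : YoungDiagram) (k : ℕ) :
    (∑ μ ∈ sized (ν.card + k) with HorizontalStrip ν μ,
        ∑ κ ∈ strips μ, x ^ (μ.card - κ.card) * F κ) =
    (∑ t ∈ Finset.range (k + 1), x ^ t * ∑ τ ∈ strips ν, x ^ (ν.card - τ.card) *
        ∑ κ ∈ sized (τ.card + (k - t)) with HorizontalStrip τ κ, F κ) := by
  simp only [Finset.mul_sum]
  simp only [Finset.sum_sigma']
  refine Finset.sum_bij'
    (i := fun p hp => ⟨p.1.rowLen 0 - max (p.2.rowLen 0) (ν.rowLen 0),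
      ⟨(exists_below_of_above (κ := p.2) (ν := ν) (μ := p.1) (by simp at hp; exact hp.2)
        (by simp at hp; exact hp.1.2)).choose, p.2⟩⟩)
    (j := fun q hq => ⟨(exists_above_of_below (κ := q.2.2) (ν := ν) (τ := q.2.1)
      (by simp at hq; exact hq.2.2.2) (by simp at hq; exact hq.2.1) q.1).choose, q.2.2⟩)
    ?_ ?_ ?_ ?_ ?_
  · rintro ⟨μ, κ⟩ hp
    obtain ⟨⟨h1, h2⟩, h3⟩ : (μ.card = ν.card + k ∧ HorizontalStrip ν μ) ∧ HorizontalStrip κ μ := by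
      simpa using hp
    have hτ := (exists_below_of_above h3 h2).choose_spec
    set τ := (exists_below_of_above h3 h2).choose
    have hc := card_add_card_of_exchange (κ := κ) (ν := ν) (μ := μ) (τ := τ)
      (t := μ.rowLen 0 - max (κ.rowLen 0) (ν.rowLen 0))
      (by have := h2 0; have := h3 0; omega)
      (fun i => by have := h2 i; have := h3 i; have := h2 (i + 1); have := h3 (i + 1)
                   rw [hτ i]; omega)
    have hτκ : HorizontalStrip τ κ := fun i => by
      have := h2 i; have := h3 i; have := h2 (i + 1); have := h3 (i + 1)
      rw [hτ i]; omega
    have hτν : HorizontalStrip τ ν := fun i => by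
      have := h2 i; have := h3 i; have := h2 (i + 1); have := h3 (i + 1)
      rw [hτ i]; omega
    have := hτκ.card_le
    simp only [Finset.mem_sigma, Finset.mem_range, mem_strips, Finset.mem_filter, mem_sized]
    have := h3.card_le
    have := hτν.card_le
    refine ⟨?_, hτν, ?_, hτκ⟩ <;> omega
  · rintro ⟨t, τ, κ⟩ hq
    obtain ⟨h1, h2, h3, h4⟩ : t < k + 1 ∧ HorizontalStrip τ ν ∧
        κ.card = τ.card + (k - t) ∧ HorizontalStrip τ κ := by simpa using hq
    obtain ⟨hμ0, hμ⟩ := (exists_above_of_below h4 h2 t).choose_spec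
    set μ := (exists_above_of_below h4 h2 t).choose
    have hc := card_add_card_of_exchange (κ := κ) (ν := ν) (μ := μ) (τ := τ) hμ0
      (fun i => by have := h2 i; have := h4 i; rw [hμ i]; omega)
    have hκμ : HorizontalStrip κ μ := fun i => by
      have := h2 i; have := h4 i; rw [hμ i]
      cases i with
      | zero => omega
      | succ i => have := h2 i; have := h4 i; rw [hμ i]; omega
    have hνμ : HorizontalStrip ν μ := fun i => by
      have := h2 i; have := h4 i; rw [hμ i]
      cases i with
      | zero => omega
      | succ i => have := h2 i; have := h4 i; rw [hμ i]; omega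
    simp only [Finset.mem_sigma, mem_strips, Finset.mem_filter, mem_sized]
    exact ⟨⟨by omega, hνμ⟩, hκμ⟩
  · rintro ⟨μ, κ⟩ hp
    obtain ⟨⟨h1, h2⟩, h3⟩ : (μ.card = ν.card + k ∧ HorizontalStrip ν μ) ∧ HorizontalStrip κ μ := by
      simpa using hp
    have hτ := (exists_below_of_above h3 h2).choose_spec
    simp only [Sigma.mk.injEq, heq_eq_eq, and_true]
    generalize_proofs _ h5
    obtain ⟨hμ0, hμ⟩ := h5.choose_spec
    refine ext_rowLen fun i => ?_
    cases i with
    | zero => rw [hμ0]; have := h2 0; have := h3 0; omega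
    | succ i =>
      rw [hμ, hτ]; have := h2 i; have := h3 i; have := h2 (i + 1); have := h3 (i + 1); omega
  · rintro ⟨t, τ, κ⟩ hq
    obtain ⟨h1, h2, h3, h4⟩ : t < k + 1 ∧ HorizontalStrip τ ν ∧
        κ.card = τ.card + (k - t) ∧ HorizontalStrip τ κ := by simpa using hq
    obtain ⟨hμ0, hμ⟩ := (exists_above_of_below h4 h2 t).choose_spec
    simp only [Sigma.mk.injEq, heq_eq_eq, and_true]
    generalize_proofs _ h5
    have hτ := h5.choose_spec
    refine ⟨by rw [hμ0]; omega, ext_rowLen fun i => ?_⟩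
    rw [hτ, hμ]; have := h2 i; have := h4 i; omega
  · rintro ⟨μ, κ⟩ hp
    obtain ⟨⟨h1, h2⟩, h3⟩ : (μ.card = ν.card + k ∧ HorizontalStrip ν μ) ∧ HorizontalStrip κ μ := by
      simpa using hp
    have hτ := (exists_below_of_above h3 h2).choose_spec
    set τ := (exists_below_of_above h3 h2).choose
    have hc := card_add_card_of_exchange (κ := κ) (ν := ν) (μ := μ) (τ := τ)
      (t := μ.rowLen 0 - max (κ.rowLen 0) (ν.rowLen 0))
      (by have := h2 0; have := h3 0; omega)
      (fun i => by have := h2 i; have := h3 i; have := h2 (i + 1); have := h3 (i + 1)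
                   rw [hτ i]; omega)
    have hτν : HorizontalStrip τ ν := fun i => by
      have := h2 i; have := h3 i; have := h2 (i + 1); have := h3 (i + 1)
      rw [hτ i]; omega
    have := hτν.card_le
    have := h3.card_le
    simp only [← mul_assoc, ← pow_add]
    congr 2
    omega

end YoungDiagram

noncomputable section

/-! ### Semistandard tableaux and the partial Schur functions -/

namespace FrobChar

open YoungDiagram

/-- The Kostka number: the number of semistandard tableaux of shape `μ` and content `d`. -/
def kostka (μ : YoungDiagram) (d : ℕ →₀ ℕ) : ℕ :=
  Nat.card {T : SemistandardYoungTableau μ // content T = d}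

theorem coeff_schur (μ : YoungDiagram) (d : ℕ →₀ ℕ) :
    MvPowerSeries.coeff d (schur μ) = kostka μ d := rfl

theorem content_apply {μ : YoungDiagram} (T : SemistandardYoungTableau μ) (k : ℕ) :
    content T k = (μ.cells.filter fun c => T c.1 c.2 = k).card := by
  rw [content, Finsupp.finsetSum_apply, Finset.card_filter]
  exact Finset.sum_congr rfl fun c _ => by rw [Finsupp.single_apply]

theorem mem_support_of_mem {μ : YoungDiagram} {d : ℕ →₀ ℕ} {T : SemistandardYoungTableau μ}
    (hT : content T = d) {i j : ℕ} (h : (i, j) ∈ μ) : T i j ∈ d.support := by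
  rw [← hT, Finsupp.mem_support_iff, content_apply]
  exact Finset.card_ne_zero_of_mem (a := (i, j)) (by simp [h])

theorem entry_le {μ : YoungDiagram} {d : ℕ →₀ ℕ} {N : ℕ} (hd : d.support ⊆ Finset.range (N + 1))
    {T : SemistandardYoungTableau μ} (hT : content T = d) (i j : ℕ) : T i j ≤ N := by
  by_cases h : (i, j) ∈ μ
  · exact Nat.lt_succ_iff.1 (Finset.mem_range.1 (hd (mem_support_of_mem hT h)))
  · rw [T.zeros h]; exact Nat.zero_le _

instance finite_tableaux (μ : YoungDiagram) (d : ℕ →₀ ℕ) :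
    Finite {T : SemistandardYoungTableau μ // content T = d} := by
  refine Finite.of_injective
    (β := μ.cells → d.support)
    (fun T c => ⟨T.1 c.1.1 c.1.2, mem_support_of_mem T.2 (by simp)⟩) ?_
  intro T T' h
  refine Subtype.ext (SemistandardYoungTableau.ext fun i j => ?_)
  by_cases hc : (i, j) ∈ μ
  · exact congrArg Subtype.val (congrFun h ⟨(i, j), by simpa using hc⟩)
  · rw [T.1.zeros hc, T'.1.zeros hc]

/-- The cells of a tableau holding an entry smaller than `N`. -/
def shapeBelow {μ : YoungDiagram} (T : SemistandardYoungTableau μ) (N : ℕ) : YoungDiagram where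
  cells := μ.cells.filter fun c => T c.1 c.2 < N
  isLowerSet := by
    rintro ⟨i, j⟩ ⟨i', j'⟩ hle hc
    obtain ⟨h1, h2⟩ := Prod.mk_le_mk.1 hle
    simp only [Finset.coe_filter, mem_cells, Set.mem_ofPred_eq] at hc ⊢
    refine ⟨μ.up_left_mem h1 h2 hc.1, ?_⟩
    exact (((T.row_weak_of_le h2 (μ.up_left_mem h1 le_rfl hc.1))).trans
      (T.col_weak h1 hc.1)).trans_lt hc.2

theorem mem_shapeBelow {μ : YoungDiagram} {T : SemistandardYoungTableau μ} {N : ℕ} {c : ℕ × ℕ} :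
    c ∈ shapeBelow T N ↔ c ∈ μ ∧ T c.1 c.2 < N := by
  rw [← mem_cells, shapeBelow, Finset.mem_filter, mem_cells]

theorem horizontalStrip_shapeBelow {μ : YoungDiagram} {T : SemistandardYoungTableau μ} {N : ℕ}
    (h : ∀ i j, T i j ≤ N) : HorizontalStrip (shapeBelow T N) μ := by
  have hle : shapeBelow T N ≤ μ := fun c hc => (mem_shapeBelow.1 hc).1
  refine fun i => ⟨le_iff_rowLen.1 hle i, ?_⟩
  by_contra hlt
  have h1 : (i + 1, (shapeBelow T N).rowLen i) ∈ μ := mem_iff_lt_rowLen.2 (not_le.1 hlt)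
  have h2 : (i, (shapeBelow T N).rowLen i) ∈ shapeBelow T N :=
    mem_shapeBelow.2 ⟨μ.up_left_mem (Nat.le_succ i) le_rfl h1,
      (T.col_strict (Nat.lt_succ_self i) h1).trans_le (h _ _)⟩
  exact absurd (mem_iff_lt_rowLen.1 h2) (lt_irrefl _)

theorem card_shapeBelow {μ : YoungDiagram} {T : SemistandardYoungTableau μ} {N : ℕ}
    (h : ∀ i j, T i j ≤ N) : (shapeBelow T N).card + content T N = μ.card := by
  rw [content_apply, YoungDiagram.card, YoungDiagram.card, shapeBelow,
    ← Finset.card_filter_add_card_filter_not (s := μ.cells) (fun c => T c.1 c.2 < N)]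
  congr 2
  refine Finset.filter_congr fun c _ => ?_
  have := h c.1 c.2
  omega

/-- The restriction of a tableau to a smaller shape. -/
def restrictTableau {μ κ : YoungDiagram} (h : κ ≤ μ) (T : SemistandardYoungTableau μ) :
    SemistandardYoungTableau κ where
  entry i j := if (i, j) ∈ κ then T i j else 0
  row_weak' := fun {i j1 j2} hj hc => by
    rw [if_pos hc, if_pos (κ.up_left_mem le_rfl hj.le hc)]
    exact T.row_weak hj (h hc)
  col_strict' := fun {i1 i2 j} hi hc => by
    rw [if_pos hc, if_pos (κ.up_left_mem hi.le le_rfl hc)]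
    exact T.col_strict hi (h hc)
  zeros' := fun hc => if_neg hc

theorem restrictTableau_apply {μ κ : YoungDiagram} (h : κ ≤ μ) (T : SemistandardYoungTableau μ)
    {i j : ℕ} (hc : (i, j) ∈ κ) : restrictTableau h T i j = T i j := if_pos hc

/-- The extension of a tableau with entries smaller than `N` by a horizontal strip of cells
with entry `N`. -/
def extendTableau {μ κ : YoungDiagram} (h : HorizontalStrip κ μ) (N : ℕ)
    (T : SemistandardYoungTableau κ) (hT : ∀ i j, (i, j) ∈ κ → T i j < N) :
    SemistandardYoungTableau μ where
  entry i j := if (i, j) ∈ κ then T i j else if (i, j) ∈ μ then N else 0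
  row_weak' := fun {i j1 j2} hj hc => by
    by_cases h2 : (i, j2) ∈ κ
    · rw [if_pos h2, if_pos (κ.up_left_mem le_rfl hj.le h2)]
      exact T.row_weak hj h2
    · rw [if_neg h2, if_pos hc]
      by_cases h1 : (i, j1) ∈ κ
      · rw [if_pos h1]; exact (hT _ _ h1).le
      · rw [if_neg h1, if_pos (μ.up_left_mem le_rfl hj.le hc)]
  col_strict' := fun {i1 i2 j} hi hc => by
    have h1 : (i1, j) ∈ κ := by
      have h3 := mem_iff_lt_rowLen.1 hc
      have h4 := μ.rowLen_anti (i1 + 1) i2 hi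
      exact mem_iff_lt_rowLen.2 ((h3.trans_le h4).trans_le (h i1).2)
    rw [if_pos h1]
    by_cases h2 : (i2, j) ∈ κ
    · rw [if_pos h2]; exact T.col_strict hi h2
    · rw [if_neg h2, if_pos hc]; exact hT _ _ h1
  zeros' := fun {i j} hc => by
    rw [if_neg (fun h2 => hc (h.le h2)), if_neg hc]

theorem extendTableau_apply {μ κ : YoungDiagram} (h : HorizontalStrip κ μ) (N : ℕ)
    (T : SemistandardYoungTableau κ) (hT : ∀ i j, (i, j) ∈ κ → T i j < N) (i j : ℕ) :
    extendTableau h N T hT i j = if (i, j) ∈ κ then T i j else if (i, j) ∈ μ then N else 0 := rfl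

theorem content_restrictTableau {μ : YoungDiagram} {T : SemistandardYoungTableau μ} {N : ℕ}
    {κ : YoungDiagram} (hκ : shapeBelow T N = κ) (h : κ ≤ μ) (hT : ∀ i j, T i j ≤ N) :
    content (restrictTableau h T) = (content T).erase N := by
  ext k
  rw [content_apply, Finsupp.erase_apply, content_apply]
  split_ifs with hk
  · rw [Finset.card_eq_zero, Finset.filter_eq_empty_iff]
    rintro ⟨i, j⟩ hc
    rw [mem_cells] at hc
    rw [restrictTableau_apply h T hc, hk]
    rw [← hκ] at hc
    exact (mem_shapeBelow.1 hc).2.ne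
  · congr 1
    ext ⟨i, j⟩
    simp only [Finset.mem_filter, mem_cells]
    constructor
    · rintro ⟨hc, h2⟩
      rw [restrictTableau_apply h T hc] at h2
      exact ⟨h hc, h2⟩
    · rintro ⟨hc, h2⟩
      have : (i, j) ∈ κ := by
        rw [← hκ]
        exact mem_shapeBelow.2 ⟨hc, by have := hT i j; simp only; omega⟩
      exact ⟨this, by rw [restrictTableau_apply h T this, h2]⟩

theorem shapeBelow_extendTableau {μ κ : YoungDiagram} (h : HorizontalStrip κ μ) {N : ℕ}
    {T : SemistandardYoungTableau κ} (hT : ∀ i j, (i, j) ∈ κ → T i j < N) :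
    shapeBelow (extendTableau h N T hT) N = κ := by
  ext ⟨i, j⟩
  rw [mem_cells, mem_cells, mem_shapeBelow, extendTableau_apply]
  constructor
  · rintro ⟨h1, h2⟩
    by_contra h3
    rw [if_neg h3, if_pos h1] at h2
    exact lt_irrefl _ h2
  · intro h1
    rw [if_pos h1]
    exact ⟨h.le h1, hT _ _ h1⟩

theorem restrictTableau_extendTableau {μ κ : YoungDiagram} (h : HorizontalStrip κ μ) {N : ℕ}
    {T : SemistandardYoungTableau κ} (hT : ∀ i j, (i, j) ∈ κ → T i j < N) :
    restrictTableau h.le (extendTableau h N T hT) = T := by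
  refine SemistandardYoungTableau.ext fun i j => ?_
  by_cases hc : (i, j) ∈ κ
  · rw [restrictTableau_apply _ _ hc, extendTableau_apply, if_pos hc]
  · rw [T.zeros hc, (restrictTableau _ _).zeros hc]

theorem content_extendTableau {μ κ : YoungDiagram} (h : HorizontalStrip κ μ) {N : ℕ}
    {T : SemistandardYoungTableau κ} (hT : ∀ i j, (i, j) ∈ κ → T i j < N) {d : ℕ →₀ ℕ}
    (hd : content T = d.erase N) (hcard : κ.card + d N = μ.card) :
    content (extendTableau h N T hT) = d := by
  have hle : ∀ i j, extendTableau h N T hT i j ≤ N := fun i j => by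
    rw [extendTableau_apply]
    split_ifs with h1 h2
    · exact (hT _ _ h1).le
    · exact le_rfl
    · exact Nat.zero_le _
  have h1 := content_restrictTableau (shapeBelow_extendTableau h hT) h.le hle
  rw [restrictTableau_extendTableau, hd] at h1
  have h2 := card_shapeBelow hle
  rw [shapeBelow_extendTableau] at h2
  ext k
  by_cases hk : k = N
  · subst hk; omega
  · have h3 := DFunLike.congr_fun h1 k
    rw [Finsupp.erase_ne hk, Finsupp.erase_ne hk] at h3
    exact h3.symm

open scoped Classical in
/-- Removing the largest entries of a tableau leaves a tableau on a smaller shape, and the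
removed cells form a horizontal strip. -/
theorem kostka_eq_sum (μ : YoungDiagram) {d : ℕ →₀ ℕ} {N : ℕ}
    (hd : d.support ⊆ Finset.range (N + 1)) :
    kostka μ d = ∑ κ ∈ strips μ with κ.card + d N = μ.card, kostka κ (d.erase N) := by
  let s := (strips μ).filter fun κ => κ.card + d N = μ.card
  have hmem : ∀ T : {T : SemistandardYoungTableau μ // content T = d},
      shapeBelow T.1 N ∈ s := fun T => by
    have hle := entry_le hd T.2
    rw [Finset.mem_filter, mem_strips]
    refine ⟨horizontalStrip_shapeBelow hle, ?_⟩
    have h1 := card_shapeBelow hle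
    rwa [T.2] at h1
  let f : {T : SemistandardYoungTableau μ // content T = d} → s :=
    fun T => ⟨shapeBelow T.1 N, hmem T⟩
  rw [kostka, ← Nat.card_congr (Equiv.sigmaFiberEquiv f), Nat.card_sigma, ← Finset.sum_coe_sort s]
  refine Finset.sum_congr rfl fun κ _ => Nat.card_congr ?_
  obtain ⟨κ, hκ⟩ := κ
  obtain ⟨hs, hcard⟩ : HorizontalStrip κ μ ∧ κ.card + d N = μ.card := by
    simpa [s] using hκ
  have hlt : ∀ T : SemistandardYoungTableau κ, content T = d.erase N →
      ∀ i j, (i, j) ∈ κ → T i j < N := fun T hT i j hc => by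
    have h1 := mem_support_of_mem hT hc
    rw [Finsupp.support_erase, Finset.mem_erase] at h1
    have := Finset.mem_range.1 (hd h1.2)
    omega
  exact
    { toFun := fun T => ⟨restrictTableau hs.le T.1.1, by
        rw [content_restrictTableau (congrArg Subtype.val T.2) hs.le (entry_le hd T.1.2), T.1.2]⟩
      invFun := fun T => ⟨⟨extendTableau hs N T.1 (hlt T.1 T.2),
        content_extendTableau hs (hlt T.1 T.2) T.2 hcard⟩,
        Subtype.ext (shapeBelow_extendTableau hs (hlt T.1 T.2))⟩
      left_inv := by
        rintro ⟨⟨T, hT⟩, hT2⟩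
        have hT3 : shapeBelow T N = κ := congrArg Subtype.val hT2
        refine Subtype.ext (Subtype.ext (SemistandardYoungTableau.ext fun i j => ?_))
        simp only
        rw [extendTableau_apply]
        split_ifs with h1 h2
        · exact restrictTableau_apply _ _ h1
        · rw [← hT3, mem_shapeBelow] at h1
          have := entry_le hd hT i j
          simp only [h2, true_and, not_lt] at h1
          omega
        · exact (T.zeros h2).symm
      right_inv := by
        rintro ⟨T, hT⟩
        exact Subtype.ext (restrictTableau_extendTableau hs (hlt T hT)) }

theorem kostka_zero (μ : YoungDiagram) : kostka μ 0 = if μ = ⊥ then 1 else 0 := by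
  split_ifs with h
  · subst h
    rw [kostka, Nat.card_eq_one_iff_unique]
    refine ⟨⟨fun T T' => Subtype.ext (SemistandardYoungTableau.ext fun i j => ?_)⟩,
      ⟨default, ?_⟩⟩
    · rw [T.1.zeros (notMem_bot _), T'.1.zeros (notMem_bot _)]
    · simp [content]
  · rw [kostka, Nat.card_eq_zero]
    left
    refine ⟨fun T => ?_⟩
    have hne : μ.cells.Nonempty := by
      rw [Finset.nonempty_iff_ne_empty]
      intro h0
      exact h (YoungDiagram.ext (by rw [h0, cells_bot]))
    obtain ⟨⟨i, j⟩, hc⟩ := hne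
    simpa using mem_support_of_mem T.2 ((mem_cells _).1 hc)

/-- The Schur polynomial in the variables `x₀, …, x_{N-1}`, by removal of horizontal strips. -/
def partialSchur {R : Type*} [CommSemiring R] (x : ℕ → R) : ℕ → YoungDiagram → R
  | 0, μ => if μ = ⊥ then 1 else 0
  | N + 1, μ => ∑ κ ∈ strips μ, x N ^ (μ.card - κ.card) * partialSchur x N κ

/-- The complete homogeneous symmetric polynomial of degree `k` in `x₀, …, x_{N-1}`. -/
def partialComplete {R : Type*} [CommSemiring R] (x : ℕ → R) : ℕ → ℕ → R
  | 0, k => if k = 0 then 1 else 0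
  | N + 1, k => ∑ t ∈ Finset.range (k + 1), x N ^ t * partialComplete x N (k - t)

open scoped Classical in
/-- Pieri's rule in finitely many variables, by induction on their number: the strip of the last
variable is exchanged with the strip that is added. -/
theorem partialComplete_mul_partialSchur {R : Type*} [CommSemiring R] (x : ℕ → R) (N k : ℕ)
    (ν : YoungDiagram) :
    partialComplete x N k * partialSchur x N ν =
      ∑ μ ∈ sized (ν.card + k) with HorizontalStrip ν μ, partialSchur x N μ := by
  induction N generalizing k ν with
  | zero =>
    simp only [partialComplete, partialSchur]
    rw [Finset.sum_ite_eq']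
    by_cases hν : ν = ⊥
    · subst hν
      by_cases hk : k = 0
      · subst hk
        simp [HorizontalStrip, card_bot, rowLen_bot]
      · simp [hk, card_bot, Ne.symm hk]
    · rw [if_neg hν, mul_zero, if_neg]
      intro h
      simp only [Finset.mem_filter, mem_sized, card_bot] at h
      exact hν (card_eq_zero_iff.1 (by omega))
  | succ N ih =>
    simp only [partialComplete, partialSchur]
    rw [sum_strips_exchange (x N) (partialSchur x N) ν k, Finset.sum_mul]
    refine Finset.sum_congr rfl fun t _ => ?_
    rw [mul_assoc, Finset.mul_sum]
    congr 1
    refine Finset.sum_congr rfl fun τ _ => ?_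
    rw [← ih]
    ring

/-- The partial Schur functions have the same coefficients as the Schur functions, at exponents
that only involve the first `N` variables. -/
theorem coeff_partialSchur (N : ℕ) (μ : YoungDiagram) (d : ℕ →₀ ℕ) :
    MvPowerSeries.coeff d (partialSchur (fun i => (MvPowerSeries.X i : SymFun)) N μ) =
      if d.support ⊆ Finset.range N then (kostka μ d : ℂ) else 0 := by
  classical
  induction N generalizing μ d with
  | zero =>
    simp only [partialSchur, Finset.range_zero, Finset.subset_empty, Finsupp.support_eq_empty]
    by_cases hd : d = 0
    · subst hd
      rw [kostka_zero, if_pos rfl]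
      split_ifs <;> simp
    · split_ifs with h <;> simp [MvPowerSeries.coeff_one, hd]
  | succ N ih =>
    rw [partialSchur, map_sum]
    have hterm : ∀ κ ∈ strips μ, MvPowerSeries.coeff d ((MvPowerSeries.X N : SymFun) ^
        (μ.card - κ.card) * partialSchur (fun i => MvPowerSeries.X i) N κ) =
        if d.support ⊆ Finset.range (N + 1) then
          if κ.card + d N = μ.card then (kostka κ (d.erase N) : ℂ) else 0 else 0 := by
      intro κ hκ
      have hle := (mem_strips.1 hκ).card_le
      rw [MvPowerSeries.X_pow_eq, MvPowerSeries.coeff_monomial_mul, ih, one_mul]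
      by_cases h1 : κ.card + d N = μ.card
      · have h2 : Finsupp.single N (μ.card - κ.card) ≤ d := by
          rw [Finsupp.single_le_iff]; omega
        have h3 : d - Finsupp.single N (μ.card - κ.card) = d.erase N := by
          ext k
          rw [Finsupp.tsub_apply, Finsupp.single_apply, Finsupp.erase_apply]
          split_ifs with h4 h5 h5 <;> [(subst h4; omega); (subst h4; exact absurd rfl h5);
            (subst h5; exact absurd rfl h4); rfl]
        rw [if_pos h2, h3, if_pos h1]
        have h4 : (d.erase N).support ⊆ Finset.range N ↔ d.support ⊆ Finset.range (N + 1) := by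
          rw [Finsupp.support_erase, Finset.range_add_one, Finset.subset_insert_iff]
        simp only [h4]
      · rw [if_neg h1, ite_self]
        split_ifs with h2 h3
        · have h4 := Finsupp.single_le_iff.1 h2
          have h5 : (d - Finsupp.single N (μ.card - κ.card)) N = 0 := by
            by_contra hne
            exact absurd (Finset.mem_range.1 (h3 (Finsupp.mem_support_iff.2 hne))) (lt_irrefl N)
          rw [Finsupp.tsub_apply, Finsupp.single_eq_same] at h5
          omega
        · rfl
        · rfl
    rw [Finset.sum_congr rfl hterm]
    split_ifs with h
    · rw [kostka_eq_sum μ h, ← Finset.sum_filter]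
      push_cast
      rfl
    · exact Finset.sum_const_zero

/-! ### The Pieri rule -/

/-- The diagram with a single row of length `k`. -/
def rowDiagram (k : ℕ) : YoungDiagram :=
  ofRowLenFun (fun i => if i = 0 then k else 0) (antitone_nat_of_succ_le fun i => by simp) 1

theorem rowLen_rowDiagram (k i : ℕ) : (rowDiagram k).rowLen i = if i = 0 then k else 0 :=
  rowLen_ofRowLenFun _ (by simp) i

theorem card_rowDiagram (k : ℕ) : (rowDiagram k).card = k := by
  rw [card_eq_sum_rowLen (N := 1) _ (by simp [rowLen_rowDiagram])]
  simp [rowLen_rowDiagram]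

theorem horizontalStrip_bot_iff {μ : YoungDiagram} :
    HorizontalStrip ⊥ μ ↔ μ = rowDiagram μ.card := by
  constructor
  · intro h
    have h1 : ∀ i, μ.rowLen (i + 1) = 0 := fun i => by
      have := (h i).2
      rw [rowLen_bot] at this
      omega
    have h2 := card_eq_sum_rowLen μ (h1 0)
    refine ext_rowLen fun i => ?_
    rw [rowLen_rowDiagram]
    cases i with
    | zero => simpa using h2.symm
    | succ i => simp [h1 i]
  · intro h i
    rw [h, rowLen_bot, rowLen_rowDiagram, rowLen_rowDiagram]
    simp

theorem partialComplete_eq {R : Type*} [CommSemiring R] (x : ℕ → R) (N k : ℕ) :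
    partialComplete x N k = partialSchur x N (rowDiagram k) := by
  classical
  have h0 : partialSchur x N ⊥ = 1 := by
    induction N with
    | zero => simp [partialSchur]
    | succ N ih =>
      have : strips (⊥ : YoungDiagram) = {⊥} := by
        ext κ
        rw [mem_strips, Finset.mem_singleton]
        exact ⟨fun h => le_bot_iff.1 h.le, fun h => by rw [h]; intro i; simp [rowLen_bot]⟩
      rw [partialSchur, this, Finset.sum_singleton, ih]
      simp
  have h1 := partialComplete_mul_partialSchur x N k ⊥
  rw [h0, mul_one, card_bot, zero_add] at h1
  rw [h1, Finset.sum_eq_single (rowDiagram k)]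
  · intro μ hμ hne
    simp only [Finset.mem_filter, mem_sized, horizontalStrip_bot_iff] at hμ
    exact absurd (hμ.2.trans (by rw [hμ.1])) hne
  · intro h
    refine absurd ?_ h
    simp only [Finset.mem_filter, mem_sized, horizontalStrip_bot_iff, card_rowDiagram, and_self]

open scoped Classical in
/-- **Pieri's rule**. -/
theorem schur_rowDiagram_mul_schur (k : ℕ) (ν : YoungDiagram) :
    schur (rowDiagram k) * schur ν =
      ∑ μ ∈ sized (ν.card + k) with HorizontalStrip ν μ, schur μ := by
  ext d
  obtain ⟨N, hN⟩ : ∃ N, d.support ⊆ Finset.range N :=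
    ⟨d.support.sup id + 1, Finset.subset_range_sup_succ d.support⟩
  have hco : ∀ (μ : YoungDiagram) (e : ℕ →₀ ℕ), e ≤ d → MvPowerSeries.coeff e (schur μ) =
      MvPowerSeries.coeff e (partialSchur (fun i => (MvPowerSeries.X i : SymFun)) N μ) := by
    intro μ e he
    rw [coeff_partialSchur, if_pos ((Finsupp.support_mono he).trans hN), coeff_schur]
  have h1 := partialComplete_mul_partialSchur (fun i => (MvPowerSeries.X i : SymFun)) N k ν
  rw [partialComplete_eq] at h1
  have h2 := congrArg (MvPowerSeries.coeff d) h1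
  rw [map_sum, ← Finset.sum_congr rfl fun μ _ => hco μ d le_rfl, MvPowerSeries.coeff_mul] at h2
  rw [map_sum, ← h2, MvPowerSeries.coeff_mul]
  refine Finset.sum_congr rfl fun p hp => ?_
  have hp' := Finset.HasAntidiagonal.mem_antidiagonal.1 hp
  rw [hco _ p.1 (by rw [← hp']; exact le_self_add), hco _ p.2 (by rw [← hp']; exact le_add_self)]

theorem strips_rowDiagram {k : ℕ} {κ : YoungDiagram} (h : κ ≤ rowDiagram k) :
    κ = rowDiagram κ.card := by
  refine horizontalStrip_bot_iff.1 fun i => ⟨by rw [rowLen_bot]; exact Nat.zero_le _, ?_⟩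
  have := le_iff_rowLen.1 h (i + 1)
  rw [rowLen_rowDiagram] at this
  simpa [rowLen_bot] using this

theorem kostka_rowDiagram (k : ℕ) (d : ℕ →₀ ℕ) :
    kostka (rowDiagram k) d = if d.degree = k then 1 else 0 := by
  obtain ⟨N, hN⟩ : ∃ N, d.support ⊆ Finset.range N :=
    ⟨d.support.sup id + 1, Finset.subset_range_sup_succ d.support⟩
  induction N generalizing k d with
  | zero =>
    obtain rfl : d = 0 := by simpa using hN
    rw [kostka_zero]
    refine if_congr ?_ rfl rfl
    rw [← card_eq_zero_iff, card_rowDiagram]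
    simp [eq_comm]
  | succ N ih =>
    have hsupp : (d.erase N).support ⊆ Finset.range N := by
      rw [Finsupp.support_erase]
      rwa [Finset.range_add_one, Finset.subset_insert_iff] at hN
    have hdeg : d.degree = (d.erase N).degree + d N := by
      conv_lhs => rw [← Finsupp.erase_add_single N d, map_add, Finsupp.degree_single]
    rw [kostka_eq_sum _ hN, card_rowDiagram]
    by_cases hle : d N ≤ k
    · rw [Finset.sum_eq_single (rowDiagram (k - d N)), ih _ _ hsupp]
      · refine if_congr ?_ rfl rfl
        omega
      · intro κ hκ hne
        simp only [Finset.mem_filter, mem_strips] at hκ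
        refine absurd ?_ hne
        rw [strips_rowDiagram hκ.1.le]
        congr 1
        omega
      · intro h
        refine absurd ?_ h
        simp only [Finset.mem_filter, mem_strips, card_rowDiagram]
        refine ⟨fun i => ?_, by omega⟩
        simp only [rowLen_rowDiagram, Nat.add_eq_zero_iff, one_ne_zero, and_false, if_false]
        split_ifs
        · exact ⟨Nat.sub_le _ _, Nat.zero_le _⟩
        · exact ⟨le_rfl, le_rfl⟩
    · rw [if_neg (by omega), Finset.sum_eq_zero]
      intro κ hκ
      simp only [Finset.mem_filter] at hκ
      omega

/-- The complete homogeneous symmetric function `h_d = ∏ h_{d_i}` over `i < N`. -/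
def complete (d : ℕ →₀ ℕ) (N : ℕ) : SymFun := ∏ i ∈ Finset.range N, schur (rowDiagram (d i))

theorem schur_bot : schur ⊥ = 1 := by
  classical
  ext d
  have : (⊥ : YoungDiagram) = rowDiagram 0 := horizontalStrip_bot_iff.1 fun i => by
    simp [rowLen_bot]
  rw [coeff_schur, this, kostka_rowDiagram, MvPowerSeries.coeff_one]
  simp only [Finsupp.degree_eq_zero_iff]
  split_ifs <;> simp

/-- Iterated Pieri rule. -/
theorem complete_eq_sum (d : ℕ →₀ ℕ) {N : ℕ} (hd : d.support ⊆ Finset.range N) :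
    complete d N = ∑ μ ∈ sized d.degree, (kostka μ d : ℂ) • schur μ := by
  classical
  induction N generalizing d with
  | zero =>
    obtain rfl : d = 0 := by simpa using hd
    have : sized 0 = {⊥} := by
      ext μ; rw [mem_sized, card_eq_zero_iff, Finset.mem_singleton]
    simp [complete, this, kostka_zero, schur_bot]
  | succ N ih =>
    have hsupp : (d.erase N).support ⊆ Finset.range N := by
      rw [Finsupp.support_erase]
      rwa [Finset.range_add_one, Finset.subset_insert_iff] at hd
    have hdeg : d.degree = (d.erase N).degree + d N := by
      conv_lhs => rw [← Finsupp.erase_add_single N d, map_add, Finsupp.degree_single]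
    have h1 : complete d N = complete (d.erase N) N :=
      Finset.prod_congr rfl fun i hi => by
        rw [Finsupp.erase_ne (Finset.mem_range.1 hi).ne]
    rw [complete, Finset.prod_range_succ, ← complete, h1, ih _ hsupp, Finset.sum_mul]
    have h2 : ∀ κ ∈ sized (d.erase N).degree, ((kostka κ (d.erase N) : ℂ) • schur κ) *
        schur (rowDiagram (d N)) = ∑ μ ∈ sized d.degree,
          if HorizontalStrip κ μ then (kostka κ (d.erase N) : ℂ) • schur μ else 0 := by
      intro κ hκ
      rw [smul_mul_assoc, mul_comm, schur_rowDiagram_mul_schur, mem_sized.1 hκ, ← hdeg,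
        Finset.smul_sum, Finset.sum_filter]
    rw [Finset.sum_congr rfl h2, Finset.sum_comm]
    refine Finset.sum_congr rfl fun μ hμ => ?_
    rw [kostka_eq_sum μ hd, Nat.cast_sum, Finset.sum_smul, ← Finset.sum_filter]
    refine Finset.sum_congr ?_ fun _ _ => rfl
    ext κ
    simp only [Finset.mem_filter, mem_sized, mem_strips] at hμ ⊢
    constructor
    · rintro ⟨h3, h4⟩; exact ⟨h4, by omega⟩
    · rintro ⟨h3, h4⟩; exact ⟨by omega, h3⟩

/-! ### The Kostka matrix and Schur coefficients -/

theorem le_entry {μ : YoungDiagram} (T : SemistandardYoungTableau μ) {i j : ℕ}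
    (h : (i, j) ∈ μ) : i ≤ T i j := by
  induction i with
  | zero => exact Nat.zero_le _
  | succ i ih =>
    exact Nat.succ_le_of_lt ((ih (μ.up_left_mem (Nat.le_succ i) le_rfl h)).trans_lt
      (T.col_strict (Nat.lt_succ_self i) h))

theorem degree_content {μ : YoungDiagram} (T : SemistandardYoungTableau μ) :
    (content T).degree = μ.card := by
  rw [content, map_sum]
  simp [YoungDiagram.card]

theorem weight_content {μ : YoungDiagram} (T : SemistandardYoungTableau μ) :
    Finsupp.weight (id : ℕ → ℕ) (content T) = ∑ c ∈ μ.cells, T c.1 c.2 := by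
  rw [content, map_sum]
  simp [Finsupp.weight_apply]

/-- The content with exponents the row lengths of `μ`. -/
def rowContent (μ : YoungDiagram) : ℕ →₀ ℕ := content (SemistandardYoungTableau.highestWeight μ)

theorem rowContent_apply (μ : YoungDiagram) (i : ℕ) : rowContent μ i = μ.rowLen i := by
  rw [rowContent, content_apply, rowLen_eq_card, YoungDiagram.row]
  congr 1
  refine Finset.filter_congr fun c hc => ?_
  rw [SemistandardYoungTableau.highestWeight_apply, if_pos ((mem_cells _).1 hc)]

theorem rowContent_injective : Function.Injective rowContent := fun μ ν h =>
  ext_rowLen fun i => by rw [← rowContent_apply, h, rowContent_apply]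

theorem degree_rowContent (μ : YoungDiagram) : (rowContent μ).degree = μ.card := degree_content _

theorem kostka_eq_zero {μ : YoungDiagram} {d : ℕ →₀ ℕ} (h : d.degree ≠ μ.card) :
    kostka μ d = 0 := by
  rw [kostka, Nat.card_eq_zero]
  left
  exact ⟨fun T => h (by rw [← T.2, degree_content])⟩

/-- The statistic `∑ i μ_i`, which is weakly monotone along the support of the Kostka matrix. -/
def rowStat (μ : YoungDiagram) : ℕ := ∑ c ∈ μ.cells, c.1

theorem weight_rowContent (μ : YoungDiagram) :
    Finsupp.weight (id : ℕ → ℕ) (rowContent μ) = rowStat μ := by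
  rw [rowContent, weight_content, rowStat]
  refine Finset.sum_congr rfl fun c hc => ?_
  rw [SemistandardYoungTableau.highestWeight_apply, if_pos ((mem_cells _).1 hc)]

theorem rowStat_le {μ lam : YoungDiagram} {T : SemistandardYoungTableau μ}
    (hT : content T = rowContent lam) : rowStat μ ≤ rowStat lam := by
  rw [← weight_rowContent lam, ← hT, weight_content]
  exact Finset.sum_le_sum fun c hc => le_entry T ((mem_cells _).1 hc)

/-- Equality of the statistics forces each entry to be its row index, since an entry is never
smaller than that. -/
theorem eq_highestWeight {μ lam : YoungDiagram} {T : SemistandardYoungTableau μ}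
    (hT : content T = rowContent lam) (h : rowStat lam ≤ rowStat μ) :
    T = SemistandardYoungTableau.highestWeight μ := by
  have h1 : rowStat μ = ∑ c ∈ μ.cells, T c.1 c.2 := by
    rw [← weight_content, hT, weight_rowContent]
    exact le_antisymm (rowStat_le hT) h
  have h2 := (Finset.sum_eq_sum_iff_of_le
    (fun c hc => le_entry T ((mem_cells _).1 hc))).1 h1
  refine SemistandardYoungTableau.ext fun i j => ?_
  rw [SemistandardYoungTableau.highestWeight_apply]
  split_ifs with hc
  · exact (h2 (i, j) ((mem_cells _).2 hc)).symm
  · exact T.zeros hc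

theorem kostka_rowContent_self (μ : YoungDiagram) : kostka μ (rowContent μ) = 1 := by
  rw [kostka, Nat.card_eq_one_iff_unique]
  refine ⟨⟨fun T T' => Subtype.ext ?_⟩, ⟨⟨SemistandardYoungTableau.highestWeight μ, rfl⟩⟩⟩
  rw [eq_highestWeight T.2 le_rfl, eq_highestWeight T'.2 le_rfl]

theorem kostka_rowContent_eq_zero {μ lam : YoungDiagram} (h : rowStat lam ≤ rowStat μ)
    (hne : μ ≠ lam) : kostka μ (rowContent lam) = 0 := by
  rw [kostka, Nat.card_eq_zero]
  left
  refine ⟨fun T => hne (rowContent_injective ?_)⟩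
  rw [← T.2, eq_highestWeight T.2 h]
  rfl

/-- The Kostka matrix, indexed by the diagrams with `n` cells. -/
def kostkaMatrix (n : ℕ) : Matrix (sized n) (sized n) ℤ :=
  Matrix.of fun μ lam => (kostka μ.1 (rowContent lam.1) : ℤ)

/-- The Kostka matrix is block triangular with respect to `rowStat`, with identity matrices as
diagonal blocks. -/
theorem det_kostkaMatrix (n : ℕ) : (kostkaMatrix n).det = 1 := by
  classical
  have h : (kostkaMatrix n).BlockTriangular (fun μ => rowStat μ.1) := fun μ lam hlt => by
    have hne : μ.1 ≠ lam.1 := fun h => by simp only [h, lt_irrefl] at hlt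
    rw [kostkaMatrix, Matrix.of_apply, kostka_rowContent_eq_zero hlt.le hne, Nat.cast_zero]
  rw [h.det]
  refine Finset.prod_eq_one fun a _ => ?_
  refine (congrArg Matrix.det ?_).trans Matrix.det_one
  ext ⟨μ, hμ⟩ ⟨lam, hlam⟩
  rw [Matrix.toSquareBlock_def, Matrix.of_apply, Matrix.one_apply, kostkaMatrix, Matrix.of_apply]
  simp only [Subtype.mk.injEq]
  split_ifs with h1
  · subst h1; rw [kostka_rowContent_self, Nat.cast_one]
  · rw [kostka_rowContent_eq_zero (hlam.trans hμ.symm).le (fun h => h1 (Subtype.ext h)),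
      Nat.cast_zero]

/-- The inverse of the Kostka matrix. -/
def kostkaInv (n : ℕ) : Matrix (sized n) (sized n) ℤ := (kostkaMatrix n)⁻¹

theorem kostkaMatrix_mul_kostkaInv (n : ℕ) : kostkaMatrix n * kostkaInv n = 1 :=
  Matrix.mul_nonsing_inv _ (by rw [det_kostkaMatrix]; exact isUnit_one)

theorem sum_kostkaInv_mul_kostka {n : ℕ} (μ ν : sized n) :
    ∑ lam : sized n, (kostkaInv n lam μ : ℂ) * (kostka ν.1 (rowContent lam.1) : ℂ) =
      if ν = μ then 1 else 0 := by
  classical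
  have h := congrFun (congrFun (kostkaMatrix_mul_kostkaInv n) ν) μ
  rw [Matrix.mul_apply, Matrix.one_apply] at h
  have h2 := congrArg (Int.cast : ℤ → ℂ) h
  push_cast at h2
  refine Eq.trans (Finset.sum_congr rfl fun lam _ => ?_) (h2.trans ?_)
  · rw [kostkaMatrix, Matrix.of_apply, mul_comm, Int.cast_natCast]
  · congr

/-- The coefficient of `s_μ` in a symmetric function, read off from the coefficients at
partitions by means of the inverse Kostka matrix. -/
def schurCoeff (μ : YoungDiagram) : SymFun →ₗ[ℂ] ℂ :=
  ∑ lam : sized μ.card, (kostkaInv μ.card lam ⟨μ, mem_sized.2 rfl⟩ : ℂ) •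
    MvPowerSeries.coeff (rowContent lam.1)

theorem schurCoeff_apply {n : ℕ} (μ : sized n) (F : SymFun) :
    schurCoeff μ.1 F = ∑ lam : sized n, (kostkaInv n lam μ : ℂ) *
      MvPowerSeries.coeff (rowContent lam.1) F := by
  obtain ⟨μ, hμ⟩ := μ
  obtain rfl := mem_sized.1 hμ
  simp [schurCoeff]

theorem schurCoeff_schur (μ ν : YoungDiagram) :
    schurCoeff μ (schur ν) = if ν = μ then 1 else 0 := by
  have h := schurCoeff_apply ⟨μ, mem_sized.2 rfl⟩ (schur ν)
  simp only at h
  rw [h]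
  by_cases hc : ν.card = μ.card
  · have h1 := sum_kostkaInv_mul_kostka (n := μ.card) ⟨μ, mem_sized.2 rfl⟩ ⟨ν, mem_sized.2 hc⟩
    simp only [Subtype.mk.injEq] at h1
    exact h1
  · rw [if_neg (fun h => hc (by rw [h]))]
    refine Finset.sum_eq_zero fun lam _ => ?_
    rw [coeff_schur, kostka_eq_zero, Nat.cast_zero, mul_zero]
    rw [degree_rowContent, mem_sized.1 lam.2]
    exact Ne.symm hc

/-- The symmetric functions that are homogeneous of degree `n`, as the span of the Schur
functions. -/
def symSpan (n : ℕ) : Submodule ℂ SymFun :=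
  Submodule.span ℂ (schur '' (sized n : Set YoungDiagram))

theorem schur_mem_symSpan {μ : YoungDiagram} {n : ℕ} (h : μ.card = n) : schur μ ∈ symSpan n :=
  Submodule.subset_span ⟨μ, by simpa using h, rfl⟩

theorem eq_sum_schurCoeff {n : ℕ} {F : SymFun} (hF : F ∈ symSpan n) :
    F = ∑ μ ∈ sized n, schurCoeff μ F • schur μ := by
  classical
  induction hF using Submodule.span_induction with
  | mem F h =>
    obtain ⟨ν, hν, rfl⟩ := h
    rw [Finset.sum_eq_single ν]
    · rw [schurCoeff_schur, if_pos rfl, one_smul]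
    · intro μ _ hne
      rw [schurCoeff_schur, if_neg hne.symm, zero_smul]
    · exact fun h => absurd hν h
  | zero => simp
  | add F G _ _ hF hG =>
    conv_lhs => rw [hF, hG]
    rw [← Finset.sum_add_distrib]
    exact Finset.sum_congr rfl fun μ _ => by rw [map_add, add_smul]
  | smul a F _ hF =>
    conv_lhs => rw [hF]
    rw [Finset.smul_sum]
    exact Finset.sum_congr rfl fun μ _ => by rw [map_smul, smul_eq_mul, mul_smul]

theorem schur_eq_sum_complete {n : ℕ} (μ : sized n) :
    schur μ.1 = ∑ lam : sized n, (kostkaInv n lam μ : ℂ) •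
      complete (rowContent lam.1) ((rowContent lam.1).support.sup id + 1) := by
  classical
  have h : ∀ lam : sized n, (kostkaInv n lam μ : ℂ) •
      complete (rowContent lam.1) ((rowContent lam.1).support.sup id + 1) =
      ∑ ν : sized n, ((kostkaInv n lam μ : ℂ) * kostka ν.1 (rowContent lam.1)) • schur ν.1 := by
    intro lam
    rw [complete_eq_sum _ (Finset.subset_range_sup_succ _), degree_rowContent,
      mem_sized.1 lam.2, Finset.smul_sum, ← Finset.sum_coe_sort (sized n)]
    exact Finset.sum_congr rfl fun ν _ => by rw [smul_smul]
  rw [Finset.sum_congr rfl fun lam _ => h lam, Finset.sum_comm]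
  simp only [← Finset.sum_smul, sum_kostkaInv_mul_kostka, ite_smul, one_smul, zero_smul,
    Finset.sum_ite_eq', Finset.mem_univ, if_true]

theorem row_mul_mem_symSpan {n k : ℕ} {F : SymFun} (hF : F ∈ symSpan n) :
    schur (rowDiagram k) * F ∈ symSpan (n + k) := by
  classical
  induction hF using Submodule.span_induction with
  | mem F h =>
    obtain ⟨ν, hν, rfl⟩ := h
    have hν' : ν.card = n := by simpa using hν
    rw [schur_rowDiagram_mul_schur, hν']
    refine Submodule.sum_mem _ fun μ hμ => schur_mem_symSpan ?_
    simpa using (Finset.mem_filter.1 hμ).1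
  | zero => rw [mul_zero]; exact Submodule.zero_mem _
  | add F G _ _ hF hG => rw [mul_add]; exact Submodule.add_mem _ hF hG
  | smul a F _ hF => rw [mul_smul_comm]; exact Submodule.smul_mem _ _ hF

theorem complete_mul_mem_symSpan {n : ℕ} (d : ℕ →₀ ℕ) (N : ℕ) {F : SymFun}
    (hF : F ∈ symSpan n) : complete d N * F ∈ symSpan (n + ∑ i ∈ Finset.range N, d i) := by
  induction N with
  | zero => simpa [complete] using hF
  | succ N ih =>
    rw [complete, Finset.prod_range_succ, ← complete, Finset.sum_range_succ, ← add_assoc,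
      mul_comm (complete d N), mul_assoc]
    exact row_mul_mem_symSpan ih

theorem mul_mem_symSpan {m n : ℕ} {F G : SymFun} (hF : F ∈ symSpan m) (hG : G ∈ symSpan n) :
    F * G ∈ symSpan (m + n) := by
  induction hF using Submodule.span_induction with
  | mem F h =>
    obtain ⟨μ, hμ, rfl⟩ := h
    have h1 := schur_eq_sum_complete (n := m) ⟨μ, hμ⟩
    simp only at h1
    rw [h1, Finset.sum_mul]
    refine Submodule.sum_mem _ fun lam _ => ?_
    rw [smul_mul_assoc]
    refine Submodule.smul_mem _ _ ?_
    have h2 := complete_mul_mem_symSpan (rowContent lam.1)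
      ((rowContent lam.1).support.sup id + 1) hG
    rwa [← Finset.sum_subset (Finset.subset_range_sup_succ _)
      (fun i _ hi => Finsupp.notMem_support_iff.1 hi), ← Finsupp.degree_apply, degree_rowContent,
      mem_sized.1 lam.2, add_comm] at h2
  | zero => rw [zero_mul]; exact Submodule.zero_mem _
  | add F G _ _ hF hG => rw [add_mul]; exact Submodule.add_mem _ hF hG
  | smul a F _ hF => rw [smul_mul_assoc]; exact Submodule.smul_mem _ _ hF

/-! ### Words and the power sums of cycle types -/

/-- The words on the positions `X` in the alphabet `ℕ` in which the letter `i` occurs `d i`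
times. -/
@[ext] structure Word (X : Type) [Fintype X] (d : ℕ →₀ ℕ) where
  /-- The letter at each position. -/
  letter : X → ℕ
  sum_single : ∑ x, Finsupp.single (letter x) 1 = d

instance (X : Type) [Fintype X] (d : ℕ →₀ ℕ) : MulAction (Equiv.Perm X) (Word X d) where
  smul w f := ⟨fun x => f.letter (w.symm x),
    (Equiv.sum_comp w.symm fun x => Finsupp.single (f.letter x) 1).trans f.sum_single⟩
  one_smul _ := rfl
  mul_smul _ _ _ := rfl

theorem letter_smul {X : Type} [Fintype X] {d : ℕ →₀ ℕ} (w : Equiv.Perm X) (f : Word X d)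
    (x : X) : (w • f).letter x = f.letter (w.symm x) := rfl

theorem mem_fixedBy_word {X : Type} [Fintype X] {d : ℕ →₀ ℕ} {w : Equiv.Perm X}
    {f : Word X d} :
    f ∈ MulAction.fixedBy (Word X d) w ↔ ∀ x, f.letter (w x) = f.letter x := by
  rw [MulAction.mem_fixedBy]
  constructor
  · intro h x
    have h1 := congrArg (fun g : Word X d => g.letter (w x)) h
    simpa [letter_smul] using h1.symm
  · intro h
    refine Word.ext (funext fun x => ?_)
    rw [letter_smul, ← h (w.symm x), Equiv.apply_symm_apply]

theorem sum_single_apply {X : Type*} [Fintype X] (f : X → ℕ) (k : X → ℕ) (i : ℕ) :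
    (∑ x, Finsupp.single (f x) (k x)) i = ∑ x, if f x = i then k x else 0 := by
  rw [Finsupp.finsetSum_apply]
  exact Finset.sum_congr rfl fun x _ => Finsupp.single_apply

theorem letter_mem_support {X : Type} [Fintype X] {d : ℕ →₀ ℕ} (f : Word X d) (x : X) :
    f.letter x ∈ d.support := by
  have h1 := DFunLike.congr_fun f.sum_single (f.letter x)
  rw [sum_single_apply] at h1
  rw [Finsupp.mem_support_iff, ← h1]
  have := Finset.single_le_sum (s := Finset.univ)
    (f := fun y => if f.letter y = f.letter x then 1 else 0)
    (fun _ _ => Nat.zero_le _) (Finset.mem_univ x)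
  simp only [if_true] at this
  omega

instance (X : Type) [Fintype X] (d : ℕ →₀ ℕ) : Finite (Word X d) :=
  Finite.of_injective (β := X → d.support) (fun f x => ⟨f.letter x, letter_mem_support f x⟩)
    fun _ _ h => Word.ext (funext fun x => congrArg Subtype.val (congrFun h x))

/-- The character at `w` of the permutation representation on words of content `d`: the number
of such words fixed by `w`. -/
def permChar {X : Type} [Fintype X] (d : ℕ →₀ ℕ) (w : Equiv.Perm X) : ℕ :=
  Nat.card (MulAction.fixedBy (Word X d) w)

open scoped Classical in
theorem coeff_powerSum (k : ℕ) (d : ℕ →₀ ℕ) :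
    MvPowerSeries.coeff d (powerSum k) = if ∃ i, d = Finsupp.single i k then 1 else 0 := rfl

theorem coeff_prod_powerSum {I : Type} [Fintype I] (k : I → ℕ) (hk : ∀ i, 0 < k i)
    (d : ℕ →₀ ℕ) :
    MvPowerSeries.coeff d (∏ i, powerSum (k i)) =
      Nat.card {φ : I → ℕ // ∑ i, Finsupp.single (φ i) (k i) = d} := by
  classical
  rw [MvPowerSeries.coeff_prod]
  simp only [coeff_powerSum, Finset.prod_ite_zero, Finset.prod_const_one, Finset.mem_univ,
    forall_true_left]
  rw [Finset.sum_boole, ← Nat.card_eq_finsetCard, Nat.cast_inj]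
  refine (Nat.card_congr (Equiv.ofBijective (fun φ => ⟨Finsupp.equivFunOnFinite.symm
    fun i => Finsupp.single (φ.1 i) (k i), by
      rw [Finset.mem_filter, Finset.mem_finsuppAntidiag]
      exact ⟨⟨φ.2, Finset.subset_univ _⟩, fun i => ⟨φ.1 i, rfl⟩⟩⟩) ⟨?_, ?_⟩)).symm
  · intro φ φ' h
    refine Subtype.ext (funext fun i => ?_)
    have h1 := DFunLike.congr_fun (congrArg Subtype.val h) i
    exact (Finsupp.single_left_inj (hk i).ne').1 h1
  · rintro ⟨l, hl⟩
    rw [Finset.mem_filter, Finset.mem_finsuppAntidiag] at hl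
    choose φ hφ using hl.2
    refine ⟨⟨φ, ?_⟩, Subtype.ext (Finsupp.ext fun i => (hφ i).symm)⟩
    rw [← hl.1.1]
    exact Finset.sum_congr rfl fun i _ => (hφ i).symm

/-- The cycles of a permutation, including its fixed points. -/
abbrev CycleIndex {X : Type} [Fintype X] [DecidableEq X] (w : Equiv.Perm X) : Type :=
  w.cycleFactorsFinset ⊕ {x : X // w x = x}

/-- The length of a cycle. -/
def cycleLength {X : Type} [Fintype X] [DecidableEq X] {w : Equiv.Perm X} :
    CycleIndex w → ℕ :=
  Sum.elim (fun c => c.1.support.card) (fun _ => 1)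

/-- The cycle through a point. -/
def cycleAt {X : Type} [Fintype X] [DecidableEq X] (w : Equiv.Perm X) (x : X) : CycleIndex w :=
  if h : w x = x then Sum.inr ⟨x, h⟩
  else Sum.inl ⟨w.cycleOf x,
    Equiv.Perm.cycleOf_mem_cycleFactorsFinset_iff.2 (Equiv.Perm.mem_support.2 h)⟩

theorem apply_eq_of_sameCycle {X : Type} [Fintype X] {w : Equiv.Perm X} {f : X → ℕ}
    (hf : ∀ x, f (w x) = f x) {x y : X}
    (h : w.SameCycle x y) : f x = f y := by
  obtain ⟨n, hn, rfl⟩ := h.exists_pow_eq'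
  clear h hn
  induction n with
  | zero => rfl
  | succ n ih => rw [pow_succ', Equiv.Perm.mul_apply, hf]; exact ih

section

variable {X : Type} [Fintype X] [DecidableEq X] {w : Equiv.Perm X}

theorem cycleLength_pos (i : CycleIndex w) : 0 < cycleLength i := by
  rcases i with ⟨c, hc⟩ | i
  · have := (Equiv.Perm.mem_cycleFactorsFinset_iff.1 hc).1.two_le_card_support
    simp only [cycleLength, Sum.elim_inl]; omega
  · exact Nat.one_pos

theorem cycleAt_eq_inl_iff {x : X} {c : w.cycleFactorsFinset} :
    cycleAt w x = Sum.inl c ↔ x ∈ c.1.support := by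
  rw [cycleAt]
  split_ifs with h
  · simp only [false_iff]
    intro hx
    have := (Equiv.Perm.mem_cycleFactorsFinset_iff.1 c.2).2 x hx
    rw [h] at this
    exact Equiv.Perm.mem_support.1 hx this
  · rw [Sum.inl.injEq, Subtype.ext_iff]
    constructor
    · rintro hc
      rw [← hc, Equiv.Perm.mem_support_cycleOf_iff' h]
    · intro hx
      exact (Equiv.Perm.cycle_is_cycleOf hx c.2).symm

theorem cycleAt_eq_inr_iff {x : X} {y : {x : X // w x = x}} :
    cycleAt w x = Sum.inr y ↔ x = y.1 := by
  rw [cycleAt]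
  split_ifs with h
  · rw [Sum.inr.injEq, Subtype.ext_iff]
  · simp only [false_iff]
    rintro rfl
    exact h y.2

theorem sameCycle_of_cycleAt_eq {x y : X} (h : cycleAt w x = cycleAt w y) :
    w.SameCycle x y := by
  rcases hy : cycleAt w y with c | z
  · rw [hy, cycleAt_eq_inl_iff] at h
    rw [cycleAt_eq_inl_iff] at hy
    rw [Equiv.Perm.cycle_is_cycleOf hy c.2] at h
    exact (Equiv.Perm.mem_support_cycleOf_iff.1 h).1.symm
  · rw [hy, cycleAt_eq_inr_iff] at h
    rw [cycleAt_eq_inr_iff] at hy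
    rw [h, hy]

theorem cycleAt_apply (x : X) : cycleAt w (w x) = cycleAt w x := by
  rcases hy : cycleAt w x with c | z
  · rw [cycleAt_eq_inl_iff] at hy ⊢
    rw [← (Equiv.Perm.mem_cycleFactorsFinset_iff.1 c.2).2 x hy]
    exact Equiv.Perm.apply_mem_support.2 hy
  · rw [cycleAt_eq_inr_iff] at hy ⊢
    rw [hy, z.2]

theorem card_filter_cycleAt (i : CycleIndex w) :
    (Finset.univ.filter fun x => cycleAt w x = i).card = cycleLength i := by
  rcases i with c | z
  · simp only [cycleAt_eq_inl_iff, Finset.filter_univ_mem]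
    rfl
  · simp only [cycleAt_eq_inr_iff, Finset.filter_eq', Finset.mem_univ, if_true,
      Finset.card_singleton]
    rfl

theorem sum_single_comp_cycleAt (φ : CycleIndex w → ℕ) :
    ∑ x, Finsupp.single (φ (cycleAt w x)) 1 =
      ∑ i, Finsupp.single (φ i) (cycleLength i) := by
  rw [← Finset.sum_fiberwise Finset.univ (cycleAt w)]
  refine Finset.sum_congr rfl fun i _ => ?_
  rw [Finset.sum_congr rfl (g := fun _ => Finsupp.single (φ i) 1)
    (fun x hx => by rw [(Finset.mem_filter.1 hx).2]), Finset.sum_const, card_filter_cycleAt,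
    Finsupp.smul_single, smul_eq_mul, mul_one]

theorem prod_parts_partition :
    (w.partition.parts.map powerSum).prod = ∏ i : CycleIndex w, powerSum (cycleLength i) := by
  rw [Fintype.prod_sum_type, Equiv.Perm.parts_partition, Multiset.map_add, Multiset.prod_add]
  congr 1
  · rw [Equiv.Perm.cycleType_def, Multiset.map_map]
    exact (Finset.prod_coe_sort w.cycleFactorsFinset fun c => powerSum c.support.card).symm
  · simp only [cycleLength, Sum.elim_inr, Finset.prod_const, Multiset.map_replicate,
      Multiset.prod_replicate, Finset.card_univ]
    congr 1
    rw [Fintype.card_subtype, ← Finset.card_compl]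
    congr 1
    ext x
    simp

/-- The power sum of the cycle type of `w` is the generating function of the words fixed
by `w`. -/
theorem coeff_prod_parts_partition (w : Equiv.Perm X) (d : ℕ →₀ ℕ) :
    MvPowerSeries.coeff d (w.partition.parts.map powerSum).prod = permChar d w := by
  rw [prod_parts_partition, coeff_prod_powerSum _ cycleLength_pos, permChar, Nat.cast_inj]
  refine Nat.card_congr (Equiv.ofBijective (fun φ => ⟨⟨fun x => φ.1 (cycleAt w x), ?_⟩, ?_⟩)
    ⟨?_, ?_⟩)
  · rw [sum_single_comp_cycleAt, φ.2]
  · exact mem_fixedBy_word.2 fun x => by simp only [cycleAt_apply]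
  · intro φ φ' h
    refine Subtype.ext (funext fun i => ?_)
    obtain ⟨x, hx⟩ : ∃ x, cycleAt w x = i := by
      have h1 := cycleLength_pos i
      rw [← card_filter_cycleAt, Finset.card_pos] at h1
      obtain ⟨x, hx⟩ := h1
      exact ⟨x, (Finset.mem_filter.1 hx).2⟩
    have h2 := congrArg (fun f => f.1.letter x) h
    simp only [hx] at h2
    exact h2
  · rintro ⟨f, hf⟩
    rw [mem_fixedBy_word] at hf
    have hsurj : ∀ i : CycleIndex w, ∃ x, cycleAt w x = i := fun i => by
      have h1 := cycleLength_pos i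
      rw [← card_filter_cycleAt, Finset.card_pos] at h1
      obtain ⟨x, hx⟩ := h1
      exact ⟨x, (Finset.mem_filter.1 hx).2⟩
    choose r hr using hsurj
    have key : ∀ x, f.letter (r (cycleAt w x)) = f.letter x := fun x =>
      apply_eq_of_sameCycle hf (sameCycle_of_cycleAt_eq (hr _))
    refine ⟨⟨fun i => f.letter (r i), ?_⟩, Subtype.ext (Word.ext (funext key))⟩
    rw [← sum_single_comp_cycleAt (fun i => f.letter (r i))]
    exact (Finset.sum_congr rfl fun x _ => by rw [key]).trans f.sum_single

end

/-- Restricting to a Young subgroup: a word fixed by `u ⊕ v` is a pair of words fixed by `u`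
and by `v`. -/
theorem permChar_sumCongr {X Y : Type} [Fintype X] [Fintype Y] (u : Equiv.Perm X)
    (v : Equiv.Perm Y) (d : ℕ →₀ ℕ) :
    permChar d (Equiv.Perm.sumCongr u v) =
      ∑ p ∈ Finset.HasAntidiagonal.antidiagonal d, permChar p.1 u * permChar p.2 v := by
  classical
  let F : MulAction.fixedBy (Word (X ⊕ Y) d) (Equiv.Perm.sumCongr u v) →
      Finset.HasAntidiagonal.antidiagonal d := fun f =>
    ⟨(∑ x, Finsupp.single (f.1.letter (Sum.inl x)) 1,
      ∑ y, Finsupp.single (f.1.letter (Sum.inr y)) 1), by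
      rw [Finset.HasAntidiagonal.mem_antidiagonal]
      exact (Fintype.sum_sum_type fun z => Finsupp.single (f.1.letter z) 1).symm.trans
        f.1.sum_single⟩
  rw [permChar, ← Nat.card_congr (Equiv.sigmaFiberEquiv F), Nat.card_sigma,
    ← Finset.sum_coe_sort (Finset.HasAntidiagonal.antidiagonal d)]
  refine Finset.sum_congr rfl fun p _ => ?_
  rw [permChar, permChar, ← Nat.card_prod]
  refine Nat.card_congr
    { toFun := fun f => (⟨⟨fun x => f.1.1.letter (Sum.inl x), ?_⟩, ?_⟩,
        ⟨⟨fun y => f.1.1.letter (Sum.inr y), ?_⟩, ?_⟩)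
      invFun := fun q => ⟨⟨⟨Sum.elim q.1.1.letter q.2.1.letter, ?_⟩, ?_⟩, ?_⟩
      left_inv := ?_
      right_inv := ?_ }
  · exact congrArg Prod.fst (congrArg Subtype.val f.2)
  · exact mem_fixedBy_word.2 fun x => mem_fixedBy_word.1 f.1.2 (Sum.inl x)
  · exact congrArg Prod.snd (congrArg Subtype.val f.2)
  · exact mem_fixedBy_word.2 fun y => mem_fixedBy_word.1 f.1.2 (Sum.inr y)
  · rw [Fintype.sum_sum_type]
    simp only [Sum.elim_inl, Sum.elim_inr]
    rw [q.1.1.sum_single, q.2.1.sum_single]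
    exact Finset.HasAntidiagonal.mem_antidiagonal.1 p.2
  · refine mem_fixedBy_word.2 ?_
    rintro (x | y)
    · exact mem_fixedBy_word.1 q.1.2 x
    · exact mem_fixedBy_word.1 q.2.2 y
  · exact Subtype.ext (Prod.ext q.1.1.sum_single q.2.1.sum_single)
  · rintro ⟨⟨f, hf⟩, hp⟩
    refine Subtype.ext (Subtype.ext (Word.ext (funext ?_)))
    rintro (x | y) <;> rfl
  · rintro ⟨⟨f, hf⟩, ⟨g, hg⟩⟩
    rfl

theorem permChar_permCongr {X Y : Type} [Fintype X] [Fintype Y] (e : X ≃ Y) (w : Equiv.Perm X)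
    (d : ℕ →₀ ℕ) : permChar d (e.permCongr w) = permChar d w := by
  refine Nat.card_congr
    { toFun := fun f => ⟨⟨fun x => f.1.letter (e x), ?_⟩, ?_⟩
      invFun := fun f => ⟨⟨fun y => f.1.letter (e.symm y), ?_⟩, ?_⟩
      left_inv := fun f => Subtype.ext (Word.ext (funext fun y => by simp))
      right_inv := fun f => Subtype.ext (Word.ext (funext fun y => by simp)) }
  · exact (Equiv.sum_comp e fun y => Finsupp.single (f.1.letter y) 1).trans f.1.sum_single
  · refine mem_fixedBy_word.2 fun x => ?_
    have := mem_fixedBy_word.1 f.2 (e x)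
    simpa using this
  · exact (Equiv.sum_comp e.symm fun x => Finsupp.single (f.1.letter x) 1).trans f.1.sum_single
  · refine mem_fixedBy_word.2 fun y => ?_
    have := mem_fixedBy_word.1 f.2 (e.symm y)
    simpa using this

theorem permChar_inv {X : Type} [Fintype X] (w : Equiv.Perm X) (d : ℕ →₀ ℕ) :
    permChar d w⁻¹ = permChar d w := by
  rw [permChar, permChar, MulAction.fixedBy_inv]

/-! ### Burnside's count of pairs of words -/

section

variable {X : Type} [Fintype X] {d e : ℕ →₀ ℕ}

/-- The joint content of a pair of words: the matrix whose `(i, j)` entry is the number of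
positions with the letter `i` in the second word and `j` in the first. -/
def jointContent (p : Word X d × Word X e) : ℕ →₀ ℕ →₀ ℕ :=
  ∑ x, Finsupp.single (p.2.letter x) (Finsupp.single (p.1.letter x) 1)

/-- Column sums. -/
def colSum : (ℕ →₀ ℕ →₀ ℕ) →+ (ℕ →₀ ℕ) :=
  Finsupp.liftAddHom fun _ => AddMonoidHom.id _

/-- Row sums. -/
def rowSum : (ℕ →₀ ℕ →₀ ℕ) →+ (ℕ →₀ ℕ) :=
  Finsupp.mapRange.addMonoidHom Finsupp.degree

theorem colSum_jointContent (p : Word X d × Word X e) : colSum (jointContent p) = d := by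
  rw [jointContent, map_sum]
  simp only [colSum, Finsupp.liftAddHom_apply_single, AddMonoidHom.id_apply]
  exact p.1.sum_single

theorem rowSum_jointContent (p : Word X d × Word X e) : rowSum (jointContent p) = e := by
  rw [jointContent, map_sum]
  simp only [rowSum, Finsupp.mapRange.addMonoidHom_apply, Finsupp.mapRange_single,
    Finsupp.degree_single]
  exact p.2.sum_single

theorem jointContent_smul (w : Equiv.Perm X) (p : Word X d × Word X e) :
    jointContent (w • p) = jointContent p :=
  Equiv.sum_comp w.symm fun x =>
    Finsupp.single (p.2.letter x) (Finsupp.single (p.1.letter x) 1)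

theorem jointContent_apply (p : Word X d × Word X e) (i j : ℕ) :
    jointContent p i j = Nat.card {x // (p.2.letter x, p.1.letter x) = (i, j)} := by
  classical
  rw [jointContent, Finsupp.finsetSum_apply, Finsupp.finsetSum_apply, Nat.card_eq_fintype_card,
    Fintype.card_subtype, Finset.card_filter]
  refine Finset.sum_congr rfl fun x _ => ?_
  rw [Finsupp.single_apply]
  by_cases h1 : p.2.letter x = i
  · rw [if_pos h1, Finsupp.single_apply]
    simp [h1]
  · simp [h1]

/-- Two pairs of words with the same joint content are in one orbit: match the positions carrying
the same pair of letters. -/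
theorem exists_smul_eq_of_jointContent_eq {p q : Word X d × Word X e}
    (h : jointContent p = jointContent q) : ∃ w : Equiv.Perm X, w • p = q := by
  have hcard : ∀ c : ℕ × ℕ, Nonempty ({x // (p.2.letter x, p.1.letter x) = c} ≃
      {x // (q.2.letter x, q.1.letter x) = c}) := fun c => by
    obtain ⟨i, j⟩ := c
    rw [← Finite.card_eq, ← jointContent_apply, ← jointContent_apply, h]
  let w : Equiv.Perm X := Equiv.ofFiberEquiv fun c => (hcard c).some
  have hw : ∀ x, (q.2.letter (w x), q.1.letter (w x)) = (p.2.letter x, p.1.letter x) :=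
    fun x => Equiv.ofFiberEquiv_map (g := fun x => (q.2.letter x, q.1.letter x)) _ x
  refine ⟨w, Prod.ext (Word.ext (funext fun x => ?_)) (Word.ext (funext fun x => ?_))⟩
  · have := congrArg Prod.snd (hw (w.symm x))
    simp only [Equiv.apply_symm_apply] at this
    exact this.symm
  · have := congrArg Prod.fst (hw (w.symm x))
    simp only [Equiv.apply_symm_apply] at this
    exact this.symm

theorem exists_jointContent_eq (he : e.degree = Fintype.card X) {l : ℕ →₀ ℕ →₀ ℕ}
    (hc : colSum l = d) (hr : rowSum l = e) :
    ∃ p : Word X d × Word X e, jointContent p = l := by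
  classical
  let Z := Σ i : l.support, Σ j : (l i).support, Fin (l i j)
  have hsum : ∑ z : Z, Finsupp.single z.1.1 (Finsupp.single z.2.1.1 (1 : ℕ)) = l := by
    rw [Fintype.sum_sigma]
    conv_rhs => rw [← Finsupp.sum_single l, Finsupp.sum, ← Finset.sum_coe_sort]
    refine Finset.sum_congr rfl fun i _ => ?_
    rw [Fintype.sum_sigma]
    conv_rhs => rw [← Finsupp.sum_single (l i), Finsupp.sum, ← Finset.sum_coe_sort,
      ← Finsupp.singleAddHom_apply, map_sum]
    refine Finset.sum_congr rfl fun j _ => ?_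
    simp [Finsupp.smul_single]
  have hcol : ∑ z : Z, Finsupp.single z.2.1.1 1 = d := by
    have h1 := congrArg colSum hsum
    rw [map_sum, hc] at h1
    rw [← h1]
    simp [colSum]
  have hrow : ∑ z : Z, Finsupp.single z.1.1 1 = e := by
    have h1 := congrArg rowSum hsum
    rw [map_sum, hr] at h1
    rw [← h1]
    simp [rowSum]
  have hcard : Fintype.card X = Fintype.card Z := by
    rw [← he, ← hrow, map_sum]
    simp
  obtain ⟨φ⟩ := Fintype.card_eq.1 hcard
  refine ⟨(⟨fun x => (φ x).2.1.1, ?_⟩, ⟨fun x => (φ x).1.1, ?_⟩), ?_⟩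
  · exact (Equiv.sum_comp φ fun z => Finsupp.single z.2.1.1 1).trans hcol
  · exact (Equiv.sum_comp φ fun z => Finsupp.single z.1.1 1).trans hrow
  · exact (Equiv.sum_comp φ fun z => Finsupp.single z.1.1 (Finsupp.single z.2.1.1 (1 : ℕ))).trans hsum

/-- The coefficient of `x^d` in `h_e` is the number of matrices with row sums `e` and column sums
`d`. -/
theorem coeff_complete {N : ℕ} (he : e.support ⊆ Finset.range N) :
    MvPowerSeries.coeff d (complete e N) =
      Nat.card {l : ℕ →₀ ℕ →₀ ℕ // colSum l = d ∧ rowSum l = e} := by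
  classical
  rw [complete, MvPowerSeries.coeff_prod]
  simp only [coeff_schur, kostka_rowDiagram, Nat.cast_ite, Nat.cast_one, Nat.cast_zero,
    Finset.prod_ite_zero, Finset.prod_const_one]
  rw [Finset.sum_boole, ← Nat.card_eq_finsetCard, Nat.cast_inj]
  refine Nat.card_congr (Equiv.subtypeEquivRight fun l => ?_)
  rw [Finset.mem_filter, Finset.mem_finsuppAntidiag]
  have hrow : ∀ i, rowSum l i = (l i).degree := fun i => rfl
  have hcol : l.support ⊆ Finset.range N → colSum l = ∑ i ∈ Finset.range N, l i := fun h => by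
    rw [colSum, Finsupp.liftAddHom_apply, Finsupp.sum_of_support_subset _ h _ (by simp)]
    rfl
  constructor
  · rintro ⟨⟨h1, h2⟩, h3⟩
    refine ⟨by rw [hcol h2, h1], Finsupp.ext fun i => ?_⟩
    rw [hrow]
    by_cases hi : i ∈ Finset.range N
    · exact h3 i hi
    · rw [Finsupp.notMem_support_iff.1 fun h => hi (h2 h),
        Finsupp.notMem_support_iff.1 fun h => hi (he h), map_zero]
  · rintro ⟨h1, h2⟩
    have h3 : l.support ⊆ Finset.range N := fun i hi => by
      refine he (Finsupp.mem_support_iff.2 fun h0 => Finsupp.mem_support_iff.1 hi ?_)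
      rw [← h2, hrow, Finsupp.degree_eq_zero_iff] at h0
      exact h0
    exact ⟨⟨by rw [← hcol h3, h1], h3⟩, fun i _ => by rw [← hrow, h2]⟩

/-- The permutation characters pair to the coefficients of the complete homogeneous symmetric
functions: both count the orbits on pairs of words. -/
theorem sum_permChar_mul_permChar [DecidableEq X] {N : ℕ} (he : e.support ⊆ Finset.range N)
    (hX : e.degree = Fintype.card X) :
    ∑ w : Equiv.Perm X, (permChar d w : ℂ) * permChar e w =
      (Fintype.card X).factorial * MvPowerSeries.coeff d (complete e N) := by
  classical
  have hfix : ∀ w : Equiv.Perm X, permChar d w * permChar e w =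
      Nat.card (MulAction.fixedBy (Word X d × Word X e) w) := fun w => by
    rw [permChar, permChar, ← Nat.card_prod]
    refine Nat.card_congr
      { toFun := fun p => ⟨(p.1.1, p.2.1), Prod.ext p.1.2 p.2.2⟩
        invFun := fun p => (⟨p.1.1, congrArg Prod.fst p.2⟩, ⟨p.1.2, congrArg Prod.snd p.2⟩)
        left_inv := fun p => rfl
        right_inv := fun p => rfl }
  have horb : Nat.card (MulAction.orbitRel.Quotient (Equiv.Perm X) (Word X d × Word X e)) =
      Nat.card {l : ℕ →₀ ℕ →₀ ℕ // colSum l = d ∧ rowSum l = e} := by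
    refine Nat.card_congr (Equiv.ofBijective (Quotient.lift (fun p => ⟨jointContent p,
      colSum_jointContent p, rowSum_jointContent p⟩) ?_) ⟨?_, ?_⟩)
    · rintro p q ⟨w, rfl⟩
      exact Subtype.ext (jointContent_smul w q)
    · rintro ⟨p⟩ ⟨q⟩ h
      obtain ⟨w, hw⟩ := exists_smul_eq_of_jointContent_eq (congrArg Subtype.val h)
      exact (Quotient.sound (s := MulAction.orbitRel _ _) ⟨w, hw⟩).symm
    · rintro ⟨l, h1, h2⟩
      obtain ⟨p, hp⟩ := exists_jointContent_eq hX h1 h2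
      exact ⟨⟦p⟧, Subtype.ext hp⟩
  have : Fintype (MulAction.orbitRel.Quotient (Equiv.Perm X) (Word X d × Word X e)) :=
    Fintype.ofFinite _
  have : ∀ w : Equiv.Perm X, Fintype (MulAction.fixedBy (Word X d × Word X e) w) :=
    fun w => Fintype.ofFinite _
  have hB := MulAction.sum_card_fixedBy_eq_card_orbits_mul_card_group (Equiv.Perm X)
    (Word X d × Word X e)
  simp only [← Nat.card_eq_fintype_card] at hB
  rw [horb] at hB
  simp only [← hfix] at hB
  rw [coeff_complete he, ← Fintype.card_perm, mul_comm, ← Nat.card_eq_fintype_card]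
  exact_mod_cast hB

end

/-! ### The class functions attached to Schur functions -/

theorem rowLen_rowLens (μ : YoungDiagram) (i : ℕ) : μ.rowLens.getD i 0 = μ.rowLen i := by
  by_cases h : i < μ.rowLens.length
  · rw [List.getD_eq_getElem _ _ h]
    exact get_rowLens
  · rw [List.getD_eq_default _ _ (not_lt.1 h), rowLen_eq_zero_of_colLen_le]
    rw [← length_rowLens]
    exact not_lt.1 h

theorem sum_rowLens (μ : YoungDiagram) : μ.rowLens.sum = μ.card := by
  rw [card_eq_sum_rowLen μ (rowLen_eq_zero_of_colLen_le μ le_rfl), ← length_rowLens]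
  simp only [← rowLen_rowLens]
  generalize μ.rowLens = l
  induction l with
  | nil => rfl
  | cons a l ih => rw [List.sum_cons, List.length_cons, Finset.sum_range_succ', ih]; simp [add_comm]

theorem rowLens_diagram {n : ℕ} (p : n.Partition) :
    (diagram p).rowLens = p.parts.sort (· ≥ ·) :=
  rowLens_ofRowLens_eq_self fun _ hx => p.parts_pos ((Multiset.mem_sort _).1 hx)

theorem coe_rowLens_diagram {n : ℕ} (p : n.Partition) :
    ((diagram p).rowLens : Multiset ℕ) = p.parts := by
  rw [rowLens_diagram, Multiset.sort_eq]

theorem card_diagram {n : ℕ} (p : n.Partition) : (diagram p).card = n := by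
  rw [← sum_rowLens, ← Multiset.sum_coe, coe_rowLens_diagram, p.parts_sum]

theorem diagram_injective {n : ℕ} : Function.Injective (diagram (n := n)) := fun p q h =>
  Nat.Partition.ext (by rw [← coe_rowLens_diagram, h, coe_rowLens_diagram])

theorem exists_diagram_eq {n : ℕ} {μ : YoungDiagram} (h : μ.card = n) :
    ∃ p : n.Partition, diagram p = μ := by
  refine ⟨⟨μ.rowLens, fun {i} hi => pos_of_mem_rowLens μ i (by simpa using hi), by
    rw [Multiset.sum_coe, sum_rowLens, h]⟩, ext_rowLen fun i => ?_⟩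
  rw [← rowLen_rowLens, ← rowLen_rowLens, rowLens_diagram, Multiset.coe_sort,
    List.mergeSort_eq_self]
  exact μ.rowLens_sorted.pairwise.imp fun h => by simpa using h

theorem card_sized (n : ℕ) : (sized n).card = Fintype.card n.Partition := by
  rw [← Finset.card_univ, ← Finset.card_image_of_injective _ diagram_injective]
  congr 1
  ext μ
  simp only [mem_sized, Finset.mem_image, Finset.mem_univ, true_and]
  exact ⟨exists_diagram_eq, by rintro ⟨p, rfl⟩; exact card_diagram p⟩

section

variable {X : Type} [Fintype X] [DecidableEq X]

/-- The power sum of the cycle type of a permutation. -/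
def cycleSeries (w : Equiv.Perm X) : SymFun := (w.partition.parts.map powerSum).prod

/-- The class function attached to `μ`: the coefficient of `s_μ` in the power sum of the
cycle type. -/
def schurChar (μ : YoungDiagram) (w : Equiv.Perm X) : ℂ := schurCoeff μ (cycleSeries w)

/-- The Frobenius characteristic of a function on the symmetric group. -/
def charMap (f : Equiv.Perm X → ℂ) : SymFun :=
  ((Fintype.card X).factorial : ℂ)⁻¹ • ∑ w, f w • cycleSeries w

/-- The average of the product of two functions. -/
def pairing (f g : Equiv.Perm X → ℂ) : ℂ :=
  ((Fintype.card X).factorial : ℂ)⁻¹ * ∑ w, f w * g w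

theorem schurChar_eq {n : ℕ} (μ : sized n) (w : Equiv.Perm X) :
    schurChar μ.1 w = ∑ lam : sized n, (kostkaInv n lam μ : ℂ) *
      permChar (rowContent lam.1) w := by
  rw [schurChar, schurCoeff_apply]
  exact Finset.sum_congr rfl fun lam _ => by rw [cycleSeries, coeff_prod_parts_partition]

theorem schurChar_inv (μ : YoungDiagram) (w : Equiv.Perm X) :
    schurChar μ w⁻¹ = schurChar μ w := by
  have h := schurChar_eq (X := X) ⟨μ, mem_sized.2 rfl⟩
  simp only at h
  rw [h, h]
  simp only [permChar_inv]

theorem schurCoeff_charMap (μ : YoungDiagram) (f : Equiv.Perm X → ℂ) :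
    schurCoeff μ (charMap f) = pairing f (schurChar μ) := by
  rw [charMap, map_smul, map_sum, pairing, smul_eq_mul]
  congr 1
  exact Finset.sum_congr rfl fun w _ => by rw [map_smul, smul_eq_mul, schurChar]

theorem pairing_sum_left {ι : Type*} (s : Finset ι) (a : ι → ℂ) (f : ι → Equiv.Perm X → ℂ)
    (g : Equiv.Perm X → ℂ) :
    pairing (fun w => ∑ i ∈ s, a i * f i w) g = ∑ i ∈ s, a i * pairing (f i) g := by
  simp only [pairing, Finset.sum_mul, Finset.mul_sum]
  rw [Finset.sum_comm]
  refine Finset.sum_congr rfl fun i _ => Finset.sum_congr rfl fun w _ => ?_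
  ring

theorem pairing_comm (f g : Equiv.Perm X → ℂ) : pairing f g = pairing g f := by
  simp only [pairing, mul_comm]

theorem coeff_charMap (f : Equiv.Perm X → ℂ) (d : ℕ →₀ ℕ) :
    MvPowerSeries.coeff d (charMap f) = pairing f (fun w => permChar d w) := by
  rw [charMap, map_smul, map_sum, pairing, smul_eq_mul]
  congr 1
  refine Finset.sum_congr rfl fun w _ => ?_
  rw [map_smul, smul_eq_mul, cycleSeries, coeff_prod_parts_partition]

theorem pairing_permChar {d e : ℕ →₀ ℕ} {N : ℕ} (he : e.support ⊆ Finset.range N)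
    (hX : e.degree = Fintype.card X) :
    pairing (fun w : Equiv.Perm X => (permChar e w : ℂ)) (fun w => permChar d w) =
      MvPowerSeries.coeff d (complete e N) := by
  rw [pairing_comm, pairing, sum_permChar_mul_permChar he hX, inv_mul_cancel_left₀]
  exact Nat.cast_ne_zero.2 (Nat.factorial_ne_zero _)

/-- The Frobenius characteristic of `χ^μ` is `s_μ`. Both are the combination of permutation
characters and of complete functions with coefficients from the inverse Kostka matrix. -/
theorem charMap_schurChar {μ : YoungDiagram} (hμ : μ.card = Fintype.card X) :
    charMap (schurChar (X := X) μ) = schur μ := by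
  ext d
  have h1 : schurChar (X := X) μ = _ :=
    funext fun w => schurChar_eq ⟨μ, mem_sized.2 hμ⟩ w
  have h2 := schur_eq_sum_complete (n := Fintype.card X) ⟨μ, mem_sized.2 hμ⟩
  simp only at h2
  rw [coeff_charMap, h1, pairing_sum_left, h2, map_sum]
  refine Finset.sum_congr rfl fun lam _ => ?_
  rw [pairing_permChar (Finset.subset_range_sup_succ _)
    (by rw [degree_rowContent, mem_sized.1 lam.2]), map_smul, smul_eq_mul]

theorem pairing_schurChar {μ ν : YoungDiagram} (hμ : μ.card = Fintype.card X) :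
    pairing (schurChar (X := X) μ) (schurChar ν) = if μ = ν then 1 else 0 := by
  rw [← schurCoeff_charMap, charMap_schurChar hμ, schurCoeff_schur]

/-- The functions attached to Schur functions span the class functions: being orthonormal they are
linearly independent, and there are as many of them as cycle types. -/
theorem eq_sum_pairing_mul_schurChar {f : Equiv.Perm X → ℂ}
    (hf : ∀ v w : Equiv.Perm X, f (v * w * v⁻¹) = f w) (w : Equiv.Perm X) :
    f w = ∑ μ ∈ sized (Fintype.card X), pairing f (schurChar μ) * schurChar μ w := by
  classical
  let P := (Fintype.card X).Partition
  let vec : sized (Fintype.card X) → P → ℂ := fun μ p =>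
    schurCoeff μ.1 (p.parts.map powerSum).prod
  have hvec : ∀ μ (w : Equiv.Perm X), vec μ w.partition = schurChar μ.1 w := fun μ w => rfl
  have hind : LinearIndependent ℂ vec := by
    rw [Fintype.linearIndependent_iff]
    intro a ha ν
    have h1 : (fun w : Equiv.Perm X => ∑ μ : sized (Fintype.card X), a μ * schurChar μ.1 w) =
        fun _ => 0 := by
      funext w
      have := congrFun ha w.partition
      simpa [Finset.sum_apply, hvec] using this
    have h2 := pairing_sum_left Finset.univ a (fun μ w => schurChar (X := X) μ.1 w)
      (schurChar ν.1)
    rw [h1] at h2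
    have h3 : ∀ μ : sized (Fintype.card X),
        pairing (fun w => schurChar (X := X) μ.1 w) (schurChar ν.1) = if μ = ν then 1 else 0 := by
      intro μ
      rw [pairing_schurChar (mem_sized.1 μ.2)]
      simp only [Subtype.ext_iff]
    simp only [h3, mul_ite, mul_one, mul_zero, Finset.sum_ite_eq', Finset.mem_univ, if_true] at h2
    rw [← h2]
    simp [pairing]
  have hspan : Submodule.span ℂ (Set.range vec) = ⊤ := by
    refine hind.span_eq_top_of_card_eq_finrank' ?_
    rw [Fintype.card_coe, card_sized, Module.finrank_fintype_fun_eq_card]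
  let F : P → ℂ := fun p => if h : ∃ w : Equiv.Perm X, w.partition = p then f h.choose else 0
  have hF : ∀ w : Equiv.Perm X, F w.partition = f w := fun w => by
    have h : ∃ v : Equiv.Perm X, v.partition = w.partition := ⟨w, rfl⟩
    simp only [F, dif_pos h]
    obtain ⟨c, hc⟩ := isConj_iff.1 (Equiv.Perm.partition_eq_of_isConj.2 h.choose_spec)
    exact (hf c h.choose).symm.trans (congrArg f hc)
  obtain ⟨a, ha⟩ := (Submodule.mem_span_range_iff_exists_fun ℂ).1
    (show F ∈ Submodule.span ℂ (Set.range vec) from hspan ▸ Submodule.mem_top)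
  have hfa : f = fun w => ∑ μ : sized (Fintype.card X), a μ * schurChar μ.1 w := by
    funext w
    rw [← hF w, ← ha]
    simp [Finset.sum_apply, hvec]
  have hcoef : ∀ ν : sized (Fintype.card X), pairing f (schurChar ν.1) = a ν := by
    intro ν
    rw [hfa, pairing_sum_left]
    have h3 : ∀ μ : sized (Fintype.card X),
        pairing (fun w => schurChar (X := X) μ.1 w) (schurChar ν.1) = if μ = ν then 1 else 0 := by
      intro μ
      rw [pairing_schurChar (mem_sized.1 μ.2)]
      simp only [Subtype.ext_iff]
    simp only [h3, mul_ite, mul_one, mul_zero, Finset.sum_ite_eq', Finset.mem_univ, if_true]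
  rw [← Finset.sum_coe_sort]
  simp only [hcoef]
  exact congrFun hfa w

end

theorem powerSum_one : powerSum 1 = schur (rowDiagram 1) := by
  classical
  ext d
  rw [coeff_powerSum, coeff_schur, kostka_rowDiagram]
  have : (∃ i, d = Finsupp.single i 1) ↔ d.degree = 1 := by
    constructor
    · rintro ⟨i, rfl⟩
      simp
    · intro h
      have hd : d ≠ 0 := by
        rintro rfl
        simp at h
      obtain ⟨i, hi⟩ := Finsupp.ne_iff.1 hd
      have hle : Finsupp.single i 1 ≤ d :=
        Finsupp.single_le_iff.2 (Nat.one_le_iff_ne_zero.2 hi)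
      obtain ⟨e, rfl⟩ := exists_add_of_le hle
      rw [map_add, Finsupp.degree_single] at h
      have he : e = 0 := (Finsupp.degree_eq_zero_iff e).1 (by omega)
      exact ⟨i, by rw [he, add_zero]⟩
  simp only [this]
  split_ifs <;> simp

/-- A symmetric function of degree `n` whose Schur coefficients are natural numbers. -/
def SchurPositive (n : ℕ) (F : SymFun) : Prop :=
  ∃ m : YoungDiagram → ℕ, F = ∑ μ ∈ sized n, (m μ : ℂ) • schur μ

theorem schurCoeff_sum (n : ℕ) (m : YoungDiagram → ℂ) {μ : YoungDiagram} (hμ : μ.card = n) :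
    schurCoeff μ (∑ ν ∈ sized n, m ν • schur ν) = m μ := by
  rw [map_sum]
  simp only [map_smul, schurCoeff_schur, smul_eq_mul, mul_ite, mul_one, mul_zero]
  rw [Finset.sum_ite_eq', if_pos (mem_sized.2 hμ)]

theorem SchurPositive.mem_symSpan {n : ℕ} {F : SymFun} (h : SchurPositive n F) :
    F ∈ symSpan n := by
  obtain ⟨m, rfl⟩ := h
  exact Submodule.sum_mem _ fun μ hμ =>
    Submodule.smul_mem _ _ (schur_mem_symSpan (mem_sized.1 hμ))

theorem SchurPositive.of_schurCoeff {n : ℕ} {F : SymFun} (hF : F ∈ symSpan n)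
    (h : ∀ μ ∈ sized n, ∃ m : ℕ, schurCoeff μ F = m) : SchurPositive n F := by
  choose! m hm using h
  refine ⟨m, (eq_sum_schurCoeff hF).trans (Finset.sum_congr rfl fun μ hμ => ?_)⟩
  rw [hm μ hμ]

theorem schurPositive_schur (μ : YoungDiagram) : SchurPositive μ.card (schur μ) :=
  SchurPositive.of_schurCoeff (schur_mem_symSpan rfl) fun ν _ => by
    rw [schurCoeff_schur]
    exact ⟨if μ = ν then 1 else 0, by push_cast; rfl⟩

theorem SchurPositive.sum {ι : Type*} {n : ℕ} (s : Finset ι) {F : ι → SymFun}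
    (h : ∀ i ∈ s, SchurPositive n (F i)) : SchurPositive n (∑ i ∈ s, F i) := by
  choose! m hm using h
  refine ⟨fun μ => ∑ i ∈ s, m i μ, ?_⟩
  rw [Finset.sum_congr rfl hm, Finset.sum_comm]
  refine Finset.sum_congr rfl fun μ _ => ?_
  rw [Nat.cast_sum, Finset.sum_smul]

theorem SchurPositive.nsmul {n : ℕ} {F : SymFun} (h : SchurPositive n F) (k : ℕ) :
    SchurPositive n ((k : ℂ) • F) := by
  obtain ⟨m, rfl⟩ := h
  refine ⟨fun μ => k * m μ, ?_⟩
  rw [Finset.smul_sum]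
  refine Finset.sum_congr rfl fun μ _ => ?_
  rw [Nat.cast_mul, mul_smul]

theorem SchurPositive.row_mul {n : ℕ} {F : SymFun} (h : SchurPositive n F) (k : ℕ) :
    SchurPositive (n + k) (schur (rowDiagram k) * F) := by
  classical
  obtain ⟨m, rfl⟩ := h
  rw [Finset.mul_sum]
  refine SchurPositive.sum _ fun ν hν => ?_
  rw [mul_smul_comm, schur_rowDiagram_mul_schur, mem_sized.1 hν]
  refine SchurPositive.nsmul (SchurPositive.sum _ fun μ hμ => ?_) _
  have := mem_sized.1 (Finset.mem_filter.1 hμ).1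
  rw [← this]
  exact schurPositive_schur μ

/-- The value of `χ^μ` at the identity is the coefficient of `s_μ` in `p_1 ^ n`, a natural number by
Pieri's rule. -/
theorem exists_schurChar_one_eq {X : Type} [Fintype X] [DecidableEq X] {μ : YoungDiagram}
    (hμ : μ.card = Fintype.card X) : ∃ m : ℕ, schurChar μ (1 : Equiv.Perm X) = m := by
  have h : ∀ n : ℕ, SchurPositive n (powerSum 1 ^ n) := fun n => by
    induction n with
    | zero =>
      rw [pow_zero, ← schur_bot]
      exact schurPositive_schur ⊥
    | succ n ih =>
      rw [pow_succ', powerSum_one]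
      rw [powerSum_one] at ih
      exact ih.row_mul 1
  obtain ⟨m, hm⟩ := h (Fintype.card X)
  refine ⟨m μ, ?_⟩
  have h1 : cycleSeries (1 : Equiv.Perm X) = powerSum 1 ^ Fintype.card X := by
    rw [cycleSeries, Equiv.Perm.parts_partition]
    simp
  rw [schurChar, h1, hm, schurCoeff_sum _ (fun μ => (m μ : ℂ)) hμ]

/-! ### Characters of finite-dimensional representations -/

/-- A function on a group is a character if it is the character of a representation on some
`ℂⁿ`; by choosing bases, this covers all finite-dimensional representations, in all universes. -/
def IsCharacter {G : Type} [Group G] (f : G → ℂ) : Prop :=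
  ∃ (n : ℕ) (ρ : Representation ℂ G (Fin n → ℂ)), ρ.character = f

section

variable {G : Type} [Group G]

/-- Transport of a representation along a linear equivalence. -/
def transport {V : Type u} {W : Type v} [AddCommGroup V] [Module ℂ V] [AddCommGroup W]
    [Module ℂ W] (e : V ≃ₗ[ℂ] W) (ρ : Representation ℂ G V) : Representation ℂ G W where
  toFun g := e.conj (ρ g)
  map_one' := by
    rw [map_one]
    exact e.conj_id
  map_mul' x y := by
    rw [map_mul]
    exact e.conj_comp (ρ y) (ρ x)

theorem character_transport {V : Type u} {W : Type v} [AddCommGroup V] [Module ℂ V]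
    [AddCommGroup W] [Module ℂ W] (e : V ≃ₗ[ℂ] W) (ρ : Representation ℂ G V) :
    (transport e ρ).character = ρ.character :=
  funext fun g => LinearMap.trace_conj' (ρ g) e

theorem isCharacter_character {V : Type u} [AddCommGroup V] [Module ℂ V]
    [FiniteDimensional ℂ V] (ρ : Representation ℂ G V) : IsCharacter ρ.character :=
  ⟨_, transport (Module.finBasis ℂ V).equivFun ρ, character_transport _ ρ⟩

theorem IsCharacter.exists_representation {f : G → ℂ} (hf : IsCharacter f) :
    ∃ (W : Type u) (_ : AddCommGroup W) (_ : Module ℂ W) (_ : FiniteDimensional ℂ W)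
      (ρ : Representation ℂ G W), ρ.character = f := by
  obtain ⟨n, ρ, rfl⟩ := hf
  exact ⟨ULift.{u} (Fin n → ℂ), inferInstance, inferInstance, inferInstance,
    transport ULift.moduleEquiv.symm ρ, character_transport _ ρ⟩

theorem isCharacter_zero : IsCharacter (0 : G → ℂ) :=
  ⟨0, 1, funext fun g => by simp [Representation.character]⟩

theorem IsCharacter.add {f g : G → ℂ} (hf : IsCharacter f) (hg : IsCharacter g) :
    IsCharacter (f + g) := by
  obtain ⟨m, ρ, rfl⟩ := hf
  obtain ⟨n, σ, rfl⟩ := hg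
  have : (ρ.prod σ).character = ρ.character + σ.character :=
    funext fun x => LinearMap.trace_prodMap' (ρ x) (σ x)
  exact this ▸ isCharacter_character _

theorem IsCharacter.mul {f g : G → ℂ} (hf : IsCharacter f) (hg : IsCharacter g) :
    IsCharacter (f * g) := by
  obtain ⟨m, ρ, rfl⟩ := hf
  obtain ⟨n, σ, rfl⟩ := hg
  exact Representation.char_tensor ρ σ ▸ isCharacter_character _

theorem IsCharacter.comp {H : Type} [Group H] {f : G → ℂ} (hf : IsCharacter f) (φ : H →* G) :
    IsCharacter (f ∘ φ) := by
  obtain ⟨m, ρ, rfl⟩ := hf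
  exact ⟨m, ρ.comp φ, rfl⟩

theorem IsCharacter.sum_nsmul {ι : Type} (s : Finset ι) (m : ι → ℕ) {f : ι → G → ℂ}
    (hf : ∀ i ∈ s, IsCharacter (f i)) : IsCharacter (∑ i ∈ s, m i • f i) := by
  refine Finset.sum_induction _ IsCharacter (fun _ _ => IsCharacter.add) isCharacter_zero
    fun i hi => ?_
  induction m i with
  | zero => simpa using isCharacter_zero
  | succ k ih => rw [succ_nsmul]; exact ih.add (hf i hi)

theorem IsCharacter.conj {f : G → ℂ} (hf : IsCharacter f) (x y : G) :
    f (x * y * x⁻¹) = f y := by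
  obtain ⟨m, ρ, rfl⟩ := hf
  exact ρ.char_conj y x

theorem isCharacter_fixedBy (H : Type) [MulAction G H] [Finite H] :
    IsCharacter (fun g : G => (Nat.card (MulAction.fixedBy H g) : ℂ)) := by
  classical
  have := Fintype.ofFinite H
  let ρ : Representation ℂ G (H → ℂ) :=
    { toFun := fun g => LinearMap.funLeft ℂ ℂ (g⁻¹ • ·)
      map_one' := by ext; simp [LinearMap.funLeft]
      map_mul' := fun x y => by
        refine LinearMap.ext fun f => funext fun h => ?_
        simp [LinearMap.funLeft_apply, mul_smul] }
  have h : ρ.character = fun g : G => (Nat.card (MulAction.fixedBy H g) : ℂ) := by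
    funext g
    rw [Representation.character, LinearMap.trace_eq_matrix_trace ℂ (Pi.basisFun ℂ H),
      Matrix.trace]
    have : ∀ h : H, Matrix.diag (LinearMap.toMatrix (Pi.basisFun ℂ H) (Pi.basisFun ℂ H) (ρ g)) h =
        if h ∈ MulAction.fixedBy H g then 1 else 0 := fun h => by
      simp only [Matrix.diag_apply, LinearMap.toMatrix_apply, Pi.basisFun_apply,
        Pi.basisFun_repr]
      change (Pi.single h (1 : ℂ) : H → ℂ) (g⁻¹ • h) = _
      rw [Pi.single_apply]
      refine if_congr ?_ rfl rfl
      rw [MulAction.mem_fixedBy, inv_smul_eq_iff, eq_comm]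
    simp only [this]
    rw [Finset.sum_boole, Nat.card_eq_fintype_card, Fintype.card_subtype]
  exact h ▸ isCharacter_character ρ

variable [Fintype G]

/-- The average of a character is the dimension of the space of invariants. -/
theorem IsCharacter.exists_average_eq {f : G → ℂ} (hf : IsCharacter f) :
    ∃ m : ℕ, (Nat.card G : ℂ)⁻¹ * ∑ g, f g = m := by
  obtain ⟨n, ρ, rfl⟩ := hf
  have : Invertible (Nat.card G : ℂ) := invertibleOfNonzero (Nat.cast_ne_zero.2 Nat.card_pos.ne')
  exact ⟨_, Representation.card_inv_mul_sum_char_eq_finrank ρ⟩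

/-- An irreducible representation of a finite group is spanned by the orbit of any nonzero
vector. -/
theorem finiteDimensional_of_isIrreducible {V : Type u} [AddCommGroup V] [Module ℂ V]
    (σ : Representation ℂ G V) (hσ : σ.IsIrreducible) : FiniteDimensional ℂ V := by
  by_cases hV : ∀ v : V, v = 0
  · have : Subsingleton V := ⟨fun a b => (hV a).trans (hV b).symm⟩
    infer_instance
  push Not at hV
  obtain ⟨x, hx⟩ := hV
  let S : Subrepresentation σ :=
    { toSubmodule := Submodule.span ℂ (Set.range fun g => σ g x)
      apply_mem_toSubmodule := fun g y hy => by
        have : Submodule.map (σ g) (Submodule.span ℂ (Set.range fun g => σ g x)) ≤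
            Submodule.span ℂ (Set.range fun g => σ g x) := by
          rw [Submodule.map_span, Submodule.span_le]
          rintro _ ⟨_, ⟨k, rfl⟩, rfl⟩
          refine Submodule.subset_span ⟨g * k, ?_⟩
          simp
        exact this (Submodule.mem_map_of_mem hy) }
  have hxS : x ∈ S.toSubmodule := Submodule.subset_span ⟨1, by simp⟩
  have hS : S = ⊤ := (hσ.eq_bot_or_eq_top S).resolve_left fun h => by
    rw [h] at hxS
    exact hx hxS
  have : S.toSubmodule = ⊤ := by rw [hS]; rfl
  have hfg : S.toSubmodule.FG := Submodule.fg_span (Set.finite_range _)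
  rw [this] at hfg
  exact ⟨hfg⟩

end

theorem isCharacter_permChar {X : Type} [Fintype X] (d : ℕ →₀ ℕ) :
    IsCharacter (fun w : Equiv.Perm X => (permChar d w : ℂ)) :=
  isCharacter_fixedBy (Word X d)

theorem IsCharacter.exists_apply_one_eq {G : Type} [Group G] {f : G → ℂ} (hf : IsCharacter f) :
    ∃ m : ℕ, f 1 = m := by
  obtain ⟨n, ρ, rfl⟩ := hf
  exact ⟨_, ρ.char_one⟩

section

variable {X : Type} [Fintype X] [DecidableEq X]

theorem natCard_perm : Nat.card (Equiv.Perm X) = (Fintype.card X).factorial := by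
  rw [Nat.card_eq_fintype_card, Fintype.card_perm]

theorem IsCharacter.exists_pairing_eq {f g : Equiv.Perm X → ℂ} (hf : IsCharacter f)
    (hg : IsCharacter g) : ∃ m : ℕ, pairing f g = m := by
  obtain ⟨m, hm⟩ := (hf.mul hg).exists_average_eq
  rw [natCard_perm] at hm
  exact ⟨m, hm⟩

/-- The function `χ^μ` is an integral combination of permutation characters, so it pairs
integrally with every character. -/
theorem IsCharacter.exists_pairing_schurChar_eq {f : Equiv.Perm X → ℂ} (hf : IsCharacter f)
    (μ : YoungDiagram) : ∃ z : ℤ, pairing f (schurChar μ) = z := by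
  choose m hm using fun d => hf.exists_pairing_eq (isCharacter_permChar (X := X) d)
  have h1 : schurChar (X := X) μ = _ :=
    funext fun w => schurChar_eq ⟨μ, mem_sized.2 rfl⟩ w
  refine ⟨∑ lam : sized μ.card, kostkaInv _ lam ⟨μ, mem_sized.2 rfl⟩ * m (rowContent lam.1), ?_⟩
  rw [h1, pairing_comm, pairing_sum_left]
  push_cast
  exact Finset.sum_congr rfl fun lam _ => by rw [pairing_comm, hm]

theorem IsCharacter.apply_inv {f : Equiv.Perm X → ℂ} (hf : IsCharacter f) (w : Equiv.Perm X) :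
    f w⁻¹ = f w := by
  rw [eq_sum_pairing_mul_schurChar hf.conj, eq_sum_pairing_mul_schurChar hf.conj]
  simp only [schurChar_inv]

theorem pairing_self_eq {f : Equiv.Perm X → ℂ} (hf : IsCharacter f) :
    pairing f f = ∑ μ ∈ sized (Fintype.card X), pairing f (schurChar μ) ^ 2 := by
  conv_lhs => rw [funext (eq_sum_pairing_mul_schurChar hf.conj)]
  rw [pairing_sum_left]
  refine Finset.sum_congr rfl fun μ _ => ?_
  rw [← funext (eq_sum_pairing_mul_schurChar hf.conj), pairing_comm, sq]

/-- A character of norm one is one of the functions attached to Schur functions. -/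
theorem IsCharacter.eq_schurChar {f : Equiv.Perm X → ℂ} (hf : IsCharacter f)
    (h : pairing f f = 1) : ∃ μ ∈ sized (Fintype.card X), f = schurChar μ := by
  choose z hz using hf.exists_pairing_schurChar_eq
  rw [pairing_self_eq hf] at h
  simp only [hz] at h
  have h' : ∑ μ ∈ sized (Fintype.card X), z μ ^ 2 = 1 := by exact_mod_cast h
  obtain ⟨μ, hμ, hne⟩ : ∃ μ ∈ sized (Fintype.card X), z μ ^ 2 ≠ 0 := by
    by_contra! h0
    rw [Finset.sum_eq_zero h0] at h'
    exact zero_ne_one h'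
  have hle : ∀ ν ∈ sized (Fintype.card X), ν ≠ μ → z ν = 0 := fun ν hν hνμ => by
    have h1 := Finset.sum_le_sum_of_subset_of_nonneg
      (f := fun μ => z μ ^ 2)
      (Finset.insert_subset_iff.2 ⟨hν, Finset.singleton_subset_iff.2 hμ⟩)
      (fun i _ _ => sq_nonneg (z i))
    rw [Finset.sum_pair hνμ, h'] at h1
    have h2 : 0 < z μ ^ 2 := lt_of_le_of_ne (sq_nonneg _) hne.symm
    have h3 : z ν ^ 2 ≤ 0 := by omega
    exact pow_eq_zero_iff two_ne_zero |>.1 (le_antisymm h3 (sq_nonneg _))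
  have hsq : z μ ^ 2 = 1 := by
    rw [← h', Finset.sum_eq_single_of_mem μ hμ fun ν hν hνμ => by simp [hle ν hν hνμ]]
  have hf' : ∀ w, f w = z μ * schurChar μ w := fun w => by
    rw [eq_sum_pairing_mul_schurChar hf.conj, Finset.sum_eq_single_of_mem μ hμ, hz]
    intro ν hν hνμ
    rw [hz, hle ν hν hνμ]
    simp
  refine ⟨μ, hμ, ?_⟩
  rcases eq_or_eq_neg_of_sq_eq_sq (z μ) 1 (by rw [hsq, one_pow]) with h1 | h1
  · funext w
    rw [hf', h1]
    simp
  -- A negative sign would force the dimension, and with it the character, to vanish.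
  · exfalso
    obtain ⟨a, ha⟩ := hf.exists_apply_one_eq
    obtain ⟨b, hb⟩ := exists_schurChar_one_eq (X := X) (mem_sized.1 hμ)
    have h2 := hf' 1
    rw [ha, hb, h1] at h2
    have h3 : (a : ℤ) = -b := by exact_mod_cast (by simpa using h2 : (a : ℂ) = -(b : ℂ))
    have ha0 : a = 0 := by omega
    obtain ⟨n, ρ, rfl⟩ := hf
    rw [ρ.char_one, ha0, Nat.cast_zero, Nat.cast_eq_zero, Module.finrank_fin_fun] at ha
    subst ha
    have h0 : ρ.character = 0 := funext fun w => by
      rw [Representation.character, Subsingleton.elim (ρ w) 0, map_zero]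
      rfl
    have h4 := hz μ
    rw [h0, h1] at h4
    simp [pairing] at h4

theorem pairing_character_eq_finrank {V : Type u} {W : Type v} [AddCommGroup V] [Module ℂ V]
    [FiniteDimensional ℂ V] [AddCommGroup W] [Module ℂ W] [FiniteDimensional ℂ W]
    (σ : Representation ℂ (Equiv.Perm X) V) (ρ : Representation ℂ (Equiv.Perm X) W) :
    pairing ρ.character σ.character = Module.finrank ℂ (σ.IntertwiningMap ρ) := by
  have : Invertible (Nat.card (Equiv.Perm X) : ℂ) :=
    invertibleOfNonzero (Nat.cast_ne_zero.2 Nat.card_pos.ne')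
  rw [← Representation.card_inv_mul_sum_char_mul_char_eq_finrank, natCard_perm, pairing]
  simp only [(isCharacter_character σ).apply_inv]

theorem exists_schurChar_eq_character {V : Type u} [AddCommGroup V] [Module ℂ V]
    [FiniteDimensional ℂ V] (σ : Representation ℂ (Equiv.Perm X) V) (hσ : σ.IsIrreducible) :
    ∃ μ ∈ sized (Fintype.card X), σ.character = schurChar μ := by
  refine (isCharacter_character σ).eq_schurChar ?_
  rw [pairing_character_eq_finrank, Representation.IsIrreducible.finrank_intertwiningMap_self,
    Nat.cast_one]

/-- Decomposing a representation with Maschke's theorem until the parts are irreducible finds an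
irreducible representation with character `χ^μ`, as soon as `χ^μ` pairs nontrivially with the
character. -/
theorem exists_isIrreducible_of_pairing_ne_zero {μ : YoungDiagram} (n : ℕ) :
    ∀ (V : Type u) [AddCommGroup V] [Module ℂ V] [FiniteDimensional ℂ V]
      (ρ : Representation ℂ (Equiv.Perm X) V), Module.finrank ℂ V = n →
      pairing ρ.character (schurChar μ) ≠ 0 →
      ∃ (W : Type u) (_ : AddCommGroup W) (_ : Module ℂ W) (_ : FiniteDimensional ℂ W)
        (σ : Representation ℂ (Equiv.Perm X) W), σ.IsIrreducible ∧ σ.character = schurChar μ := by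
  induction n using Nat.strong_induction_on with
  | _ n ih =>
  intro V _ _ _ ρ hn hne
  by_cases hirr : ρ.IsIrreducible
  · obtain ⟨ν, hν, h⟩ := exists_schurChar_eq_character ρ hirr
    rw [h, pairing_schurChar (mem_sized.1 hν)] at hne
    have : ν = μ := by
      by_contra h0
      exact hne (if_neg h0)
    exact ⟨V, _, _, ‹_›, ρ, hirr, this ▸ h⟩
  · have hss : ρ.IsSemisimpleRepresentation := by
      have : NeZero (Nat.card (Equiv.Perm X) : ℂ) := ⟨Nat.cast_ne_zero.2 Nat.card_pos.ne'⟩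
      infer_instance
    have hnt : Nontrivial (Subrepresentation ρ) := by
      by_contra h0
      have h1 : Subsingleton (Subrepresentation ρ) := not_nontrivial_iff_subsingleton.1 h0
      have h2 : (⊤ : Submodule ℂ V) = ⊥ :=
        congrArg Subrepresentation.toSubmodule (Subsingleton.elim (⊤ : Subrepresentation ρ) ⊥)
      have h3 : Subsingleton V := ⟨fun a b => by
        have ha : a ∈ (⊤ : Submodule ℂ V) := trivial
        have hb : b ∈ (⊤ : Submodule ℂ V) := trivial
        rw [h2, Submodule.mem_bot] at ha hb
        rw [ha, hb]⟩
      apply hne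
      have : ρ.character = 0 := funext fun w => by
        rw [Representation.character, Subsingleton.elim (ρ w) 0, map_zero]
        rfl
      rw [this]
      simp [pairing]
    obtain ⟨S, hS0, hS1⟩ : ∃ S : Subrepresentation ρ, S ≠ ⊥ ∧ S ≠ ⊤ := by
      by_contra! h0
      exact hirr ⟨fun S => or_iff_not_imp_left.2 (h0 S)⟩
    obtain ⟨T, hT⟩ := exists_isCompl S
    have hc : IsCompl S.toSubmodule T.toSubmodule :=
      ⟨disjoint_iff.2 (congrArg Subrepresentation.toSubmodule (disjoint_iff.1 hT.1)),
        codisjoint_iff.2 (congrArg Subrepresentation.toSubmodule (codisjoint_iff.1 hT.2))⟩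
    have hchar : ρ.character = S.toRepresentation.character + T.toRepresentation.character := by
      rw [← show (S.toRepresentation.prod T.toRepresentation).character =
        S.toRepresentation.character + T.toRepresentation.character from
        funext fun x => LinearMap.trace_prodMap' (S.toRepresentation x) (T.toRepresentation x)]
      rw [← character_transport (Submodule.prodEquivOfIsCompl _ _ hc)]
      funext w
      rw [Representation.character, Representation.character]
      congr 1
      refine LinearMap.ext fun v => ?_
      obtain ⟨p, rfl⟩ := (Submodule.prodEquivOfIsCompl _ _ hc).surjective v
      simp [transport, LinearEquiv.conj_apply, Subrepresentation.toRepresentation]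
    have hSn : S.toSubmodule ≠ ⊤ := fun h => hS1 (Subrepresentation.toSubmodule_injective h)
    have hTn : T.toSubmodule ≠ ⊤ := fun h => hS0 <| Subrepresentation.toSubmodule_injective <| by
      have := hc.disjoint
      rw [h, disjoint_top] at this
      exact this
    have hadd : pairing ρ.character (schurChar μ) =
        pairing S.toRepresentation.character (schurChar μ) +
          pairing T.toRepresentation.character (schurChar μ) := by
      rw [hchar]
      simp only [pairing, Pi.add_apply, add_mul, Finset.sum_add_distrib, mul_add]
    by_cases h0 : pairing S.toRepresentation.character (schurChar μ) = 0
    · rw [hadd, h0, zero_add] at hne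
      exact ih _ (hn ▸ Submodule.finrank_lt hTn) _ _ rfl hne
    · exact ih _ (hn ▸ Submodule.finrank_lt hSn) _ _ rfl h0

theorem exists_isIrreducible_character_eq {μ : YoungDiagram} (hμ : μ.card = Fintype.card X) :
    ∃ (W : Type u) (_ : AddCommGroup W) (_ : Module ℂ W) (_ : FiniteDimensional ℂ W)
      (σ : Representation ℂ (Equiv.Perm X) W), σ.IsIrreducible ∧ σ.character = schurChar μ := by
  obtain ⟨W, _, _, _, ρ, hρ⟩ :=
    (isCharacter_permChar (X := X) (rowContent μ)).exists_representation
  refine exists_isIrreducible_of_pairing_ne_zero _ W ρ rfl ?_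
  rw [hρ, pairing_comm, ← coeff_charMap, charMap_schurChar hμ, coeff_schur, kostka_rowContent_self]
  simp

theorem isCharacter_schurChar {μ : YoungDiagram} (hμ : μ.card = Fintype.card X) :
    IsCharacter (schurChar (X := X) μ) := by
  obtain ⟨W, _, _, _, σ, -, h⟩ := exists_isIrreducible_character_eq.{0} hμ
  exact h ▸ isCharacter_character σ

end

theorem frobeniusCharacteristic_eq_charMap {n : ℕ} {W : Type u} [AddCommGroup W] [Module ℂ W]
    (ρ : Representation ℂ (Equiv.Perm (Fin n)) W) :
    frobeniusCharacteristic ρ = charMap ρ.character := by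
  have h : (Fintype.card (Fin n)).factorial = n.factorial := by rw [Fintype.card_fin]
  rw [frobeniusCharacteristic, charMap, h]
  rfl

/-- By Schur's lemma, an irreducible representation embeds into `ρ` exactly if its character pairs
nontrivially with the character of `ρ`. -/
theorem containsEveryIrreducible_iff {n : ℕ} {W : Type u} [AddCommGroup W] [Module ℂ W]
    [FiniteDimensional ℂ W] (ρ : Representation ℂ (Equiv.Perm (Fin n)) W) :
    ContainsEveryIrreducible.{u, v} ρ ↔
      ∀ μ ∈ sized n, schurCoeff μ (frobeniusCharacteristic ρ) ≠ 0 := by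
  have key : ∀ (V : Type v) [AddCommGroup V] [Module ℂ V] [FiniteDimensional ℂ V]
      (σ : Representation ℂ (Equiv.Perm (Fin n)) V), σ.IsIrreducible →
      ((∃ f : σ.IntertwiningMap ρ, Function.Injective f) ↔
        pairing ρ.character σ.character ≠ 0) := by
    intro V _ _ _ σ hσ
    rw [pairing_character_eq_finrank, Nat.cast_ne_zero, ← Nat.pos_iff_ne_zero,
      Module.finrank_pos_iff]
    constructor
    · rintro ⟨f, hf⟩
      refine ⟨f, 0, ?_⟩
      rintro rfl
      have h1 : Subsingleton V := ⟨fun a b => hf rfl⟩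
      have h2 : (⊥ : Subrepresentation σ) = ⊤ :=
        Subrepresentation.toSubmodule_injective (Subsingleton.elim _ _)
      exact bot_ne_top h2
    · rintro h
      obtain ⟨f, hf⟩ := exists_ne (0 : σ.IntertwiningMap ρ)
      exact ⟨f, (Representation.IsIrreducible.injective_or_eq_zero f).resolve_right hf⟩
  simp only [frobeniusCharacteristic_eq_charMap, schurCoeff_charMap]
  constructor
  · intro h μ hμ
    obtain ⟨V, _, _, _, σ, hσ, hχ⟩ := exists_isIrreducible_character_eq.{v} (X := Fin n)
      ((mem_sized.1 hμ).trans (Fintype.card_fin n).symm)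
    rw [← hχ]
    exact (key V σ hσ).1 (h V σ hσ)
  · intro h V _ _ σ hσ
    have := finiteDimensional_of_isIrreducible σ hσ
    obtain ⟨μ, hμ, hχ⟩ := exists_schurChar_eq_character σ hσ
    rw [key V σ hσ, hχ]
    exact h μ (by rwa [Fintype.card_fin] at hμ)

theorem SchurPositive.exists_representation {n : ℕ} {F : SymFun} (hF : SchurPositive n F) :
    ∃ (W : Type u) (_ : AddCommGroup W) (_ : Module ℂ W)
      (ρ : Representation ℂ (Equiv.Perm (Fin n)) W),
      FiniteDimensional ℂ W ∧ frobeniusCharacteristic ρ = F := by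
  obtain ⟨m, rfl⟩ := hF
  have h1 : IsCharacter (∑ μ ∈ sized n, m μ • schurChar (X := Fin n) μ) :=
    IsCharacter.sum_nsmul _ _ fun μ hμ =>
      isCharacter_schurChar ((mem_sized.1 hμ).trans (Fintype.card_fin n).symm)
  obtain ⟨W, _, _, hW, ρ, hρ⟩ := h1.exists_representation
  refine ⟨W, _, _, ρ, hW, ?_⟩
  rw [frobeniusCharacteristic_eq_charMap, hρ]
  have h2 : charMap (∑ μ ∈ sized n, m μ • schurChar (X := Fin n) μ) =
      ∑ μ ∈ sized n, (m μ : ℂ) • charMap (schurChar (X := Fin n) μ) := by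
    simp only [charMap, Finset.sum_apply, Finset.sum_smul, Finset.smul_sum]
    rw [Finset.sum_comm]
    refine Finset.sum_congr rfl fun μ _ => Finset.sum_congr rfl fun w _ => ?_
    rw [Pi.smul_apply, nsmul_eq_mul, mul_smul, smul_comm]
  rw [h2]
  exact Finset.sum_congr rfl fun μ hμ => by
    rw [charMap_schurChar ((mem_sized.1 hμ).trans (Fintype.card_fin n).symm)]

/-! ### Products of Schur functions -/

theorem cycleSeries_mul_cycleSeries {X Y : Type} [Fintype X] [DecidableEq X] [Fintype Y]
    [DecidableEq Y] (u : Equiv.Perm X) (v : Equiv.Perm Y) :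
    cycleSeries u * cycleSeries v = cycleSeries (Equiv.Perm.sumCongr u v) := by
  classical
  ext d
  rw [MvPowerSeries.coeff_mul, cycleSeries, cycleSeries, cycleSeries, coeff_prod_parts_partition,
    permChar_sumCongr]
  push_cast
  refine Finset.sum_congr rfl fun p _ => ?_
  rw [coeff_prod_parts_partition, coeff_prod_parts_partition]

theorem cycleSeries_permCongr {X Y : Type} [Fintype X] [DecidableEq X] [Fintype Y]
    [DecidableEq Y] (e : X ≃ Y) (w : Equiv.Perm X) :
    cycleSeries (e.permCongr w) = cycleSeries w := by
  ext d
  rw [cycleSeries, cycleSeries, coeff_prod_parts_partition, coeff_prod_parts_partition,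
    permChar_permCongr]

theorem schurCoeff_eq_zero_of_mem_symSpan {n : ℕ} {F : SymFun} (hF : F ∈ symSpan n)
    {μ : YoungDiagram} (hμ : μ.card ≠ n) : schurCoeff μ F = 0 := by
  rw [eq_sum_schurCoeff hF, map_sum]
  refine Finset.sum_eq_zero fun ν hν => ?_
  rw [map_smul, schurCoeff_schur, if_neg, smul_zero]
  rintro rfl
  exact hμ (mem_sized.1 hν)

section

variable {X Y : Type} [Fintype X] [DecidableEq X] [Fintype Y] [DecidableEq Y]

/-- Frobenius reciprocity for a Young subgroup: the coefficient of `s_μ` in `s_α s_β` is the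
multiplicity of `χ^α ⊗ χ^β` in the restriction of `χ^μ`. -/
theorem schurCoeff_mul_schur {α β : YoungDiagram} (hα : α.card = Fintype.card X)
    (hβ : β.card = Fintype.card Y) (μ : YoungDiagram) :
    schurCoeff μ (schur α * schur β) =
      ((Fintype.card X).factorial : ℂ)⁻¹ * ((Fintype.card Y).factorial : ℂ)⁻¹ *
        ∑ u : Equiv.Perm X, ∑ v : Equiv.Perm Y, schurChar α u * schurChar β v *
          schurChar μ (Equiv.Perm.sumCongr u v) := by
  rw [← charMap_schurChar hα, ← charMap_schurChar hβ, charMap, charMap, smul_mul_smul_comm,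
    map_smul, smul_eq_mul, Finset.sum_mul_sum, map_sum]
  congr 1
  refine Finset.sum_congr rfl fun u _ => ?_
  rw [map_sum]
  refine Finset.sum_congr rfl fun v _ => ?_
  rw [smul_mul_smul_comm, map_smul, cycleSeries_mul_cycleSeries, smul_eq_mul, schurChar]
  rfl

end

/-- The Littlewood–Richardson coefficients are natural numbers, being multiplicities for a Young
subgroup. -/
theorem exists_schurCoeff_mul_eq (α β μ : YoungDiagram) :
    ∃ m : ℕ, schurCoeff μ (schur α * schur β) = m := by
  by_cases hμ : μ.card = α.card + β.card
  · let X := Fin α.card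
    let Y := Fin β.card
    have hα : α.card = Fintype.card X := (Fintype.card_fin _).symm
    have hβ : β.card = Fintype.card Y := (Fintype.card_fin _).symm
    have hX : μ.card = Fintype.card (X ⊕ Y) := by rw [Fintype.card_sum, ← hα, ← hβ, hμ]
    have h1 := ((isCharacter_schurChar hα).comp
      (MonoidHom.fst (Equiv.Perm X) (Equiv.Perm Y))).mul ((isCharacter_schurChar hβ).comp
      (MonoidHom.snd (Equiv.Perm X) (Equiv.Perm Y)))
    obtain ⟨m, hm⟩ := (h1.mul ((isCharacter_schurChar hX).comp
      (Equiv.Perm.sumCongrHom X Y))).exists_average_eq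
    refine ⟨m, ?_⟩
    rw [schurCoeff_mul_schur hα hβ, ← hm, Nat.card_prod, natCard_perm, natCard_perm,
      Nat.cast_mul, mul_inv, Fintype.sum_prod_type]
    rfl
  · exact ⟨0, by rw [schurCoeff_eq_zero_of_mem_symSpan
      (mul_mem_symSpan (schur_mem_symSpan rfl) (schur_mem_symSpan rfl)) hμ, Nat.cast_zero]⟩

theorem SchurPositive.exists_schurCoeff_eq {n : ℕ} {F : SymFun} (h : SchurPositive n F)
    (μ : YoungDiagram) : ∃ m : ℕ, schurCoeff μ F = m := by
  by_cases hμ : μ.card = n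
  · obtain ⟨m, rfl⟩ := h
    exact ⟨m μ, schurCoeff_sum n (fun μ => (m μ : ℂ)) hμ⟩
  · exact ⟨0, by rw [schurCoeff_eq_zero_of_mem_symSpan h.mem_symSpan hμ, Nat.cast_zero]⟩

theorem schurPositive_schur_mul_schur (α β : YoungDiagram) :
    SchurPositive (α.card + β.card) (schur α * schur β) :=
  SchurPositive.of_schurCoeff (mul_mem_symSpan (schur_mem_symSpan rfl) (schur_mem_symSpan rfl))
    fun μ _ => exists_schurCoeff_mul_eq α β μ

theorem SchurPositive.mul {a b : ℕ} {F G : SymFun} (hF : SchurPositive a F)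
    (hG : SchurPositive b G) : SchurPositive (a + b) (F * G) := by
  obtain ⟨m, rfl⟩ := hF
  obtain ⟨k, rfl⟩ := hG
  rw [Finset.sum_mul_sum]
  refine SchurPositive.sum _ fun α hα => SchurPositive.sum _ fun β hβ => ?_
  rw [smul_mul_assoc, mul_smul_comm, ← mem_sized.1 hα, ← mem_sized.1 hβ]
  exact ((schurPositive_schur_mul_schur α β).nsmul _).nsmul _

/-- The Schur function `s_μ` occurs in `F`. -/
def Occurs (F : SymFun) (μ : YoungDiagram) : Prop := schurCoeff μ F ≠ 0

theorem occurs_sum_iff {ι : Type*} {n : ℕ} (s : Finset ι) {F : ι → SymFun}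
    (h : ∀ i ∈ s, SchurPositive n (F i)) (μ : YoungDiagram) :
    Occurs (∑ i ∈ s, F i) μ ↔ ∃ i ∈ s, Occurs (F i) μ := by
  choose! m hm using fun i (hi : i ∈ s) => (h i hi).exists_schurCoeff_eq μ
  rw [Occurs, map_sum, Finset.sum_congr rfl hm, ← Nat.cast_sum, Nat.cast_ne_zero, Ne,
    Finset.sum_eq_zero_iff]
  push Not
  refine exists_congr fun i => and_congr_right fun hi => ?_
  rw [Occurs, hm i hi, Nat.cast_ne_zero]

/-- The Schur function `s_μ` occurs in `s_α s_β`; that is, the Littlewood–Richardson coefficient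
of the triple is not zero. -/
def LR (α β μ : YoungDiagram) : Prop := Occurs (schur α * schur β) μ

theorem LR.card_eq {α β μ : YoungDiagram} (h : LR α β μ) : μ.card = α.card + β.card := by
  by_contra hμ
  exact h (schurCoeff_eq_zero_of_mem_symSpan
    (mul_mem_symSpan (schur_mem_symSpan rfl) (schur_mem_symSpan rfl)) hμ)

theorem LR.symm {α β μ : YoungDiagram} (h : LR α β μ) : LR β α μ := by
  rwa [LR, mul_comm] at h

theorem occurs_mul_iff {a b : ℕ} {F G : SymFun} (hF : SchurPositive a F)
    (hG : SchurPositive b G) (μ : YoungDiagram) :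
    Occurs (F * G) μ ↔ ∃ α β, Occurs F α ∧ Occurs G β ∧ LR α β μ := by
  have hcard : ∀ {n : ℕ} {H : SymFun} {ν : YoungDiagram}, SchurPositive n H → Occurs H ν →
      ν.card = n := fun hH hν => by
    by_contra h0
    exact hν (schurCoeff_eq_zero_of_mem_symSpan hH.mem_symSpan h0)
  have hF' := hF
  have hG' := hG
  obtain ⟨m, rfl⟩ := hF
  obtain ⟨k, rfl⟩ := hG
  have h1 : ∀ α ∈ sized a, ∀ β ∈ sized b,
      SchurPositive (a + b) (((m α : ℂ) • schur α) * ((k β : ℂ) • schur β)) := by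
    intro α hα β hβ
    rw [smul_mul_assoc, mul_smul_comm, ← mem_sized.1 hα, ← mem_sized.1 hβ]
    exact ((schurPositive_schur_mul_schur α β).nsmul _).nsmul _
  have h2 : ∀ α β, Occurs (((m α : ℂ) • schur α) * ((k β : ℂ) • schur β)) μ ↔
      (m α : ℂ) ≠ 0 ∧ (k β : ℂ) ≠ 0 ∧ LR α β μ := by
    intro α β
    rw [Occurs, smul_mul_assoc, mul_smul_comm, map_smul, map_smul, smul_eq_mul, smul_eq_mul,
      mul_ne_zero_iff, mul_ne_zero_iff]
    rfl
  rw [Finset.sum_mul_sum, occurs_sum_iff _ fun α hα => SchurPositive.sum _ fun β hβ => h1 α hα β hβ]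
  constructor
  · rintro ⟨α, hα, h⟩
    obtain ⟨β, hβ, h⟩ := (occurs_sum_iff _ (h1 α hα) μ).1 h
    obtain ⟨h3, h4, h5⟩ := (h2 α β).1 h
    refine ⟨α, β, ?_, ?_, h5⟩
    · rwa [Occurs, schurCoeff_sum _ (fun α => (m α : ℂ)) (mem_sized.1 hα)]
    · rwa [Occurs, schurCoeff_sum _ (fun β => (k β : ℂ)) (mem_sized.1 hβ)]
  · rintro ⟨α, β, h3, h4, h5⟩
    have hα := hcard hF' h3
    have hβ := hcard hG' h4
    rw [Occurs, schurCoeff_sum _ (fun α => (m α : ℂ)) hα] at h3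
    rw [Occurs, schurCoeff_sum _ (fun β => (k β : ℂ)) hβ] at h4
    exact ⟨α, mem_sized.2 hα, (occurs_sum_iff _ (h1 α (mem_sized.2 hα)) μ).2
      ⟨β, mem_sized.2 hβ, (h2 α β).2 ⟨h3, h4, h5⟩⟩⟩

theorem occurs_schur_iff {μ ν : YoungDiagram} : Occurs (schur ν) μ ↔ ν = μ := by
  rw [Occurs, schurCoeff_schur]
  split_ifs with h <;> simp [h]

theorem occurs_triple_iff (α β γ μ : YoungDiagram) :
    Occurs (schur α * schur β * schur γ) μ ↔ ∃ κ, LR α β κ ∧ LR κ γ μ := by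
  rw [occurs_mul_iff (schurPositive_schur_mul_schur α β) (schurPositive_schur γ)]
  constructor
  · rintro ⟨κ, γ', h1, h2, h3⟩
    exact ⟨κ, h1, occurs_schur_iff.1 h2 ▸ h3⟩
  · rintro ⟨κ, h1, h2⟩
    exact ⟨κ, γ, h1, occurs_schur_iff.2 rfl, h2⟩

/-- Associativity of the product; it may be applied because no cancellation takes place. -/
theorem LR.assoc {α β γ κ μ : YoungDiagram} (h1 : LR α β κ) (h2 : LR κ γ μ) :
    ∃ κ', LR β γ κ' ∧ LR α κ' μ := by
  have h := (occurs_triple_iff α β γ μ).2 ⟨κ, h1, h2⟩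
  rw [mul_assoc, mul_comm, occurs_triple_iff] at h
  obtain ⟨κ', h3, h4⟩ := h
  exact ⟨κ', h3, h4.symm⟩

theorem lr_rowDiagram_iff {k : ℕ} {ν μ : YoungDiagram} :
    LR (rowDiagram k) ν μ ↔ HorizontalStrip ν μ ∧ μ.card = ν.card + k := by
  classical
  rw [LR, schur_rowDiagram_mul_schur, occurs_sum_iff (n := ν.card + k)]
  · simp only [occurs_schur_iff, exists_eq_right, Finset.mem_filter, mem_sized]
    exact and_comm
  · intro κ hκ
    rw [← mem_sized.1 (Finset.mem_filter.1 hκ).1]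
    exact schurPositive_schur κ

theorem lr_bot_iff {ν μ : YoungDiagram} : LR ⊥ ν μ ↔ ν = μ := by
  rw [LR, schur_bot, one_mul, occurs_schur_iff]

/-- Removing the first row leaves a diagram contained in `μ` with complement a horizontal strip. -/
theorem exists_horizontalStrip_lt {μ : YoungDiagram} (h : μ ≠ ⊥) :
    ∃ κ, HorizontalStrip κ μ ∧ κ.card < μ.card := by
  have hN := rowLen_eq_zero_of_colLen_le μ (i := μ.colLen 0) le_rfl
  obtain ⟨κ, hκ⟩ := exists_rowLen_eq (f := fun i => μ.rowLen (i + 1)) (N := μ.colLen 0)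
    (fun i j hij => μ.rowLen_anti _ _ (by omega))
    (Nat.le_zero.1 ((μ.rowLen_anti _ _ (Nat.le_succ _)).trans hN.le))
  have hs : HorizontalStrip κ μ := fun i => by
    rw [hκ]
    exact ⟨μ.rowLen_anti _ _ (Nat.le_succ i), le_rfl⟩
  refine ⟨κ, hs, lt_of_le_of_ne hs.card_le fun hc => h ?_⟩
  have heq := eq_of_le_of_card_le hs.le hc.ge
  refine ext_rowLen fun i => ?_
  rw [rowLen_bot]
  have hstep : ∀ i, μ.rowLen (i + 1) = μ.rowLen i := fun i => by rw [← hκ, heq]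
  have hall : ∀ i, μ.rowLen i = μ.rowLen 0 := fun i => by
    induction i with
    | zero => rfl
    | succ i ih => rw [hstep, ih]
  rw [hall, ← hall (μ.colLen 0), hN]

/-- A diagram `β ≠ ∅` is obtained from a smaller one by adding a row, which only enlarges the
product. -/
theorem LR.le {α β μ : YoungDiagram} (h : LR α β μ) : α ≤ μ := by
  induction hn : β.card using Nat.strong_induction_on generalizing α β μ with
  | _ n ih =>
  by_cases hβ : β = ⊥
  · subst hβ
    rw [lr_bot_iff.1 h.symm]
  · obtain ⟨κ, hκ, hlt⟩ := exists_horizontalStrip_lt hβ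
    have h1 : LR (rowDiagram (β.card - κ.card)) κ β :=
      lr_rowDiagram_iff.2 ⟨hκ, by omega⟩
    obtain ⟨τ, h2, h3⟩ := h1.assoc h.symm
    exact (ih _ (hn ▸ hlt) h2.symm rfl).trans (lr_rowDiagram_iff.1 h3).1.le

/-- Between two diagrams, one cell at a time. -/
theorem exists_add_cell {κ μ : YoungDiagram} (h : κ ≤ μ) (hne : κ ≠ μ) :
    ∃ τ, κ ≤ τ ∧ τ ≤ μ ∧ LR (rowDiagram 1) κ τ := by
  have hex : ∃ i, κ.rowLen i < μ.rowLen i := by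
    by_contra! h0
    exact hne (le_antisymm h (le_iff_rowLen.2 h0))
  classical
  let i := Nat.find hex
  have hi : κ.rowLen i < μ.rowLen i := Nat.find_spec hex
  have hlt : ∀ j < i, κ.rowLen j = μ.rowLen j := fun j hj =>
    le_antisymm (le_iff_rowLen.1 h j) (not_lt.1 (Nat.find_min hex hj))
  obtain ⟨τ, hτ⟩ := exists_rowLen_eq (f := fun j => κ.rowLen j + if j = i then 1 else 0)
    (N := κ.colLen 0 + i + 1) (fun a b hab => by
      have := κ.rowLen_anti _ _ hab
      by_cases hb : b = i
      · by_cases ha : a = i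
        · simp only [if_pos ha, if_pos hb]
          omega
        · have h1 := μ.rowLen_anti _ _ hab
          have h2 := hlt a (by omega)
          subst hb
          simp only [if_neg ha, if_true]
          omega
      · simp only [if_neg hb]
        omega)
    (by
      simp only [rowLen_eq_zero_of_colLen_le κ (show κ.colLen 0 ≤ κ.colLen 0 + i + 1 by omega)]
      rw [if_neg (by omega)])
  have hle : κ ≤ τ := le_iff_rowLen.2 fun j => by rw [hτ]; omega
  refine ⟨τ, hle, le_iff_rowLen.2 fun j => ?_, lr_rowDiagram_iff.2 ⟨fun j => ?_, ?_⟩⟩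
  · rw [hτ]
    have := le_iff_rowLen.1 h j
    by_cases hj : j = i
    · subst hj
      simp only [if_true]
      omega
    · simp only [if_neg hj]
      omega
  · have h1 := κ.rowLen_anti _ _ (Nat.le_succ j)
    rw [hτ, hτ]
    refine ⟨by omega, ?_⟩
    by_cases hj : j + 1 = i
    · have h2 := hlt j (by omega)
      have h3 := μ.rowLen_anti _ _ (Nat.le_succ j)
      rw [← hj] at hi
      simp only [if_pos hj]
      simp only [Nat.succ_eq_add_one] at *
      omega
    · simp only [if_neg hj]
      exact h1
  · let N := κ.colLen 0 + i + 1
    have hκN : κ.rowLen N = 0 := rowLen_eq_zero_of_colLen_le κ (by omega)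
    have hτN : τ.rowLen N = 0 := by
      rw [hτ, hκN, if_neg (by omega)]
    rw [card_eq_sum_rowLen κ hκN, card_eq_sum_rowLen τ hτN]
    simp only [hτ, Finset.sum_add_distrib]
    rw [Finset.sum_ite_eq', if_pos (Finset.mem_range.2 (by omega))]

/-- Littlewood–Richardson triples can be enlarged: grow `μ₀` one cell at a time, and move the new
cell into one of the two factors by associativity. -/
theorem LR.exists_enlarge {α₀ β₀ μ₀ μ : YoungDiagram} (h : LR α₀ β₀ μ₀) (hμ : μ₀ ≤ μ) {a b : ℕ}
    (ha : α₀.card ≤ a) (hb : β₀.card ≤ b) (hab : μ.card = a + b) :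
    ∃ α β, α₀ ≤ α ∧ β₀ ≤ β ∧ α.card = a ∧ β.card = b ∧ LR α β μ := by
  induction hn : μ.card - μ₀.card using Nat.strong_induction_on generalizing α₀ β₀ μ₀ with
  | _ n ih =>
  have hc := h.card_eq
  by_cases hne : μ₀ = μ
  · subst hne
    exact ⟨α₀, β₀, le_rfl, le_rfl, by omega, by omega, h⟩
  · obtain ⟨μ₁, hle, hle', h1⟩ := exists_add_cell hμ hne
    have hc1 := h1.card_eq
    have hc2 := card_mono hle'
    rw [card_rowDiagram] at hc1
    by_cases hlt : α₀.card < a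
    · obtain ⟨α₁, h2, h3⟩ := LR.assoc h.symm h1.symm
      have hc3 := h2.card_eq
      rw [card_rowDiagram] at hc3
      obtain ⟨α, β, h4, h5, h6⟩ := ih (μ.card - μ₁.card) (by omega) h3.symm hle' (by omega) hb rfl
      exact ⟨α, β, h2.le.trans h4, h5, h6⟩
    · obtain ⟨β₁, h2, h3⟩ := LR.assoc h h1.symm
      have hc3 := h2.card_eq
      rw [card_rowDiagram] at hc3
      obtain ⟨α, β, h4, h5, h6⟩ := ih (μ.card - μ₁.card) (by omega) h3 hle' ha (by omega) rfl
      exact ⟨α, β, h4, h2.le.trans h5, h6⟩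

theorem le_iff_exists_lr {α μ : YoungDiagram} : α ≤ μ ↔ ∃ β, LR α β μ := by
  refine ⟨fun h => ?_, fun ⟨β, hβ⟩ => hβ.le⟩
  have hc := card_mono h
  obtain ⟨α', β, h1, -, h2, -, h3⟩ := (lr_bot_iff.2 (rfl : α = α)).symm.exists_enlarge h
    le_rfl (b := μ.card - α.card) (by rw [card_bot]; omega) (by omega)
  exact ⟨β, eq_of_le_of_card_le h1 h2.le ▸ h3⟩

/-! ### Transposition and the sign character -/

theorem isCharacter_monoidHom {G : Type} [Group G] (φ : G →* ℂ) : IsCharacter (φ : G → ℂ) := by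
  let ρ : Representation ℂ G ℂ :=
    { toFun := fun g => φ g • LinearMap.id
      map_one' := by rw [map_one, one_smul]; rfl
      map_mul' := fun x y => by
        ext
        simp [mul_comm] }
  have h : ρ.character = φ := funext fun g => by
    change LinearMap.trace ℂ ℂ (φ g • LinearMap.id) = _
    rw [map_smul, LinearMap.trace_id]
    simp
  exact h ▸ isCharacter_character ρ

/-- The sign of a permutation as a complex number. -/
def complexSign (X : Type) [Fintype X] [DecidableEq X] : Equiv.Perm X →* ℂ :=
  ((Int.castRingHom ℂ : ℤ →* ℂ).comp (Units.coeHom ℤ)).comp Equiv.Perm.sign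

theorem complexSign_mul_self {X : Type} [Fintype X] [DecidableEq X] (w : Equiv.Perm X) :
    complexSign X w * complexSign X w = 1 := by
  rw [← map_mul]
  change (((Equiv.Perm.sign (w * w) : ℤˣ) : ℤ) : ℂ) = 1
  rw [Equiv.Perm.sign_mul, Int.units_mul_self]
  simp

theorem schurChar_permCongr {X Y : Type} [Fintype X] [DecidableEq X] [Fintype Y]
    [DecidableEq Y] (e : X ≃ Y) (w : Equiv.Perm X) (μ : YoungDiagram) :
    schurChar μ (e.permCongr w) = schurChar μ w := by
  rw [schurChar, schurChar, cycleSeries_permCongr]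

/-- Multiplication by the sign character permutes the functions attached to Schur functions. -/
theorem exists_complexSign_mul_schurChar (μ : YoungDiagram) :
    ∃ ν : YoungDiagram, ν.card = μ.card ∧ ∀ (X : Type) [Fintype X] [DecidableEq X],
      Fintype.card X = μ.card → ∀ w : Equiv.Perm X,
        complexSign X w * schurChar μ w = schurChar ν w := by
  have hμ : μ.card = Fintype.card (Fin μ.card) := (Fintype.card_fin _).symm
  obtain ⟨ν, hν, h⟩ := ((isCharacter_monoidHom (complexSign (Fin μ.card))).mul
    (isCharacter_schurChar hμ)).eq_schurChar (by
      rw [← if_pos (rfl : μ = μ) (α := ℂ) (t := 1) (e := 0), ← pairing_schurChar hμ, pairing,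
        pairing]
      congr 1
      refine Finset.sum_congr rfl fun w _ => ?_
      rw [Pi.mul_apply, mul_mul_mul_comm, complexSign_mul_self, one_mul])
  refine ⟨ν, (mem_sized.1 hν).trans hμ.symm, fun X _ _ hX w => ?_⟩
  let e : X ≃ Fin μ.card := Fintype.equivFinOfCardEq hX
  have h1 := congrFun h (e.permCongr w)
  rw [Pi.mul_apply, schurChar_permCongr, schurChar_permCongr] at h1
  rw [← h1]
  congr 1
  change (((Equiv.Perm.sign w : ℤˣ) : ℤ) : ℂ) = ((Equiv.Perm.sign (e.permCongr w) : ℤˣ) : ℤ)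
  rw [Equiv.Perm.sign_permCongr]

/-- The diagram whose character is the product of `χ^μ` with the sign; it turns out to be the
transpose, see `signTwist_eq_transpose`. -/
def signTwist (μ : YoungDiagram) : YoungDiagram := (exists_complexSign_mul_schurChar μ).choose

theorem card_signTwist (μ : YoungDiagram) : (signTwist μ).card = μ.card :=
  (exists_complexSign_mul_schurChar μ).choose_spec.1

theorem schurChar_signTwist {X : Type} [Fintype X] [DecidableEq X] {μ : YoungDiagram}
    (hμ : μ.card = Fintype.card X) (w : Equiv.Perm X) :
    schurChar (signTwist μ) w = complexSign X w * schurChar μ w :=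
  ((exists_complexSign_mul_schurChar μ).choose_spec.2 X hμ.symm w).symm

theorem eq_of_schurChar_eq {X : Type} [Fintype X] [DecidableEq X] {μ ν : YoungDiagram}
    (hμ : μ.card = Fintype.card X) (h : ∀ w : Equiv.Perm X, schurChar μ w = schurChar ν w) :
    μ = ν := by
  by_contra hne
  have h1 := pairing_schurChar (X := X) (ν := μ) hμ
  rw [if_pos rfl, pairing_comm] at h1
  have h2 := pairing_schurChar (X := X) (ν := ν) hμ
  rw [if_neg hne, ← funext h] at h2
  rw [pairing_comm, h2] at h1
  exact zero_ne_one h1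

theorem signTwist_signTwist (μ : YoungDiagram) : signTwist (signTwist μ) = μ := by
  have hμ : μ.card = Fintype.card (Fin μ.card) := (Fintype.card_fin _).symm
  refine eq_of_schurChar_eq (X := Fin μ.card) (by rw [card_signTwist, card_signTwist, ← hμ])
    fun w => ?_
  rw [schurChar_signTwist (by rw [card_signTwist, ← hμ]), schurChar_signTwist hμ, ← mul_assoc,
    complexSign_mul_self, one_mul]

/-- The sign of a permutation in a Young subgroup is the product of the signs of its components. -/
theorem LR.signTwist {α β μ : YoungDiagram} (h : LR α β μ) :
    LR (signTwist α) (signTwist β) (signTwist μ) := by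
  let X := Fin α.card
  let Y := Fin β.card
  have hα : α.card = Fintype.card X := (Fintype.card_fin _).symm
  have hβ : β.card = Fintype.card Y := (Fintype.card_fin _).symm
  have hμ : μ.card = Fintype.card (X ⊕ Y) := by rw [Fintype.card_sum, ← hα, ← hβ, h.card_eq]
  rw [LR, Occurs, schurCoeff_mul_schur (X := X) (Y := Y) ((card_signTwist α).trans hα)
    ((card_signTwist β).trans hβ)]
  rw [LR, Occurs, schurCoeff_mul_schur hα hβ] at h
  convert h using 4 with u _ v _
  rw [schurChar_signTwist hα, schurChar_signTwist hβ, schurChar_signTwist hμ]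
  have hs : complexSign (X ⊕ Y) (Equiv.Perm.sumCongr u v) =
      complexSign X u * complexSign Y v := by
    change (((Equiv.Perm.sign (Equiv.Perm.sumCongr u v) : ℤˣ) : ℤ) : ℂ) =
      (((Equiv.Perm.sign u : ℤˣ) : ℤ) : ℂ) * (((Equiv.Perm.sign v : ℤˣ) : ℤ) : ℂ)
    rw [Equiv.Perm.sign_sumCongr]
    push_cast
    rfl
  rw [hs]
  linear_combination (schurChar α u * schurChar β v * schurChar μ (Equiv.Perm.sumCongr u v)) *
    (complexSign Y v * complexSign Y v * complexSign_mul_self u + complexSign_mul_self v)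

theorem signTwist_le_signTwist {α μ : YoungDiagram} (h : α ≤ μ) : signTwist α ≤ signTwist μ := by
  obtain ⟨β, hβ⟩ := le_iff_exists_lr.1 h
  exact hβ.signTwist.le

theorem card_transpose (μ : YoungDiagram) : μ.transpose.card = μ.card := by
  rw [YoungDiagram.card, YoungDiagram.card, transpose]
  exact Finset.card_map _

/-- On two letters, a character of norm one cannot vanish off the identity, since `2` is not the
square of an integer. -/
theorem signTwist_ne_self {μ : YoungDiagram} (hμ : μ.card = 2) : signTwist μ ≠ μ := by
  intro h
  have hX : μ.card = Fintype.card (Fin 2) := by rw [hμ, Fintype.card_fin]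
  have h1 := schurChar_signTwist hX (Equiv.swap 0 1)
  have hs : complexSign (Fin 2) (Equiv.swap 0 1) = -1 := by
    change (((Equiv.Perm.sign (Equiv.swap (0 : Fin 2) 1) : ℤˣ) : ℤ) : ℂ) = -1
    rw [Equiv.Perm.sign_swap (by decide)]
    simp
  rw [h, hs] at h1
  have h2 : schurChar μ (Equiv.swap (0 : Fin 2) 1) = 0 := by linear_combination h1 / 2
  have h3 := pairing_schurChar (X := Fin 2) (ν := μ) hX
  have huniv : (Finset.univ : Finset (Equiv.Perm (Fin 2))) = {1, Equiv.swap 0 1} := by decide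
  obtain ⟨m, hm⟩ := exists_schurChar_one_eq (X := Fin 2) hX
  rw [if_pos rfl, pairing, huniv, Finset.sum_pair (by decide), h2, hm, Fintype.card_fin] at h3
  have h4 : (m : ℂ) * m = 2 := by
    rw [Nat.factorial_two] at h3
    push_cast at h3
    linear_combination 2 * h3
  have h5 : m * m = 2 := by exact_mod_cast h4
  have h6 : m < 2 := by nlinarith
  interval_cases m <;> omega

/-- The cells weakly above and to the left of a given cell. -/
def rectangle (i j : ℕ) : YoungDiagram where
  cells := Finset.Iic (i, j)
  isLowerSet := by
    rw [Finset.coe_Iic]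
    exact isLowerSet_Iic _

theorem mem_rectangle {i j : ℕ} {c : ℕ × ℕ} : c ∈ rectangle i j ↔ c ≤ (i, j) := by
  change c ∈ Finset.Iic (i, j) ↔ _
  exact Finset.mem_Iic

theorem rectangle_le_iff {i j : ℕ} {μ : YoungDiagram} : rectangle i j ≤ μ ↔ (i, j) ∈ μ :=
  ⟨fun h => h (mem_rectangle.2 le_rfl), fun h _ hc => μ.isLowerSet (mem_rectangle.1 hc) h⟩

theorem card_rectangle (i j : ℕ) : (rectangle i j).card = (i + 1) * (j + 1) := by
  change (Finset.Iic (i, j)).card = _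
  rw [← Finset.Iic_product_Iic, Finset.card_product, Nat.card_Iic, Nat.card_Iic]

/-- Two diagrams with at least three cells that contain the same smaller diagrams are equal:
otherwise both are rectangles spanned by a single cell, and these are compared directly. -/
theorem eq_of_forall_lt {μ ν : YoungDiagram} (hc : μ.card = ν.card) (h3 : 3 ≤ μ.card)
    (h1 : ∀ κ, κ.card < μ.card → (κ ≤ μ ↔ κ ≤ ν)) : μ = ν := by
  by_contra hne
  have hrect : ∀ {μ ν : YoungDiagram}, μ.card = ν.card →
      (∀ κ, κ.card < μ.card → κ ≤ μ → κ ≤ ν) → ∀ {i j}, (i, j) ∈ μ → (i, j) ∉ ν →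
      rectangle i j = μ := by
    intro μ ν hc h i j hm hn
    refine eq_of_le_of_card_le (rectangle_le_iff.2 hm) (not_lt.1 fun hlt => hn ?_)
    exact rectangle_le_iff.1 (h _ hlt (rectangle_le_iff.2 hm))
  have hA := @hrect μ ν hc fun κ hκ => (h1 κ hκ).1
  have hB := @hrect ν μ hc.symm fun κ hκ => (h1 κ (hc ▸ hκ)).2
  obtain ⟨⟨i, j⟩, hx, hx'⟩ : ∃ c ∈ μ, c ∉ ν := by
    by_contra! h0
    exact hne (eq_of_le_of_card_le h0 hc.ge)
  obtain ⟨⟨k, l⟩, hy, hy'⟩ : ∃ c ∈ ν, c ∉ μ := by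
    by_contra! h0
    exact hne (eq_of_le_of_card_le h0 hc.le).symm
  have hμ := hA hx hx'
  have hν := hB hy hy'
  have main : ∀ {μ ν : YoungDiagram} {i j k l : ℕ}, μ.card = ν.card → 3 ≤ μ.card →
      (∀ κ, κ.card < μ.card → (κ ≤ μ ↔ κ ≤ ν)) →
      rectangle i j = μ → rectangle k l = ν → (i, j) ∉ ν → i < k → l < j → False := by
    intro μ ν i j k l hc h3 h1 hμ hν hx hik hlj
    have hcμ := card_rectangle i j
    have hcν := card_rectangle k l
    rw [hμ] at hcμ
    rw [hν] at hcν
    have hi : i = 0 := by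
      by_contra hi
      have h2 : rectangle 0 j ≤ μ := rectangle_le_iff.2 (hμ ▸ mem_rectangle.2 ⟨Nat.zero_le _, le_rfl⟩)
      have h4 : (rectangle 0 j).card < μ.card := by
        rw [card_rectangle, hcμ]
        exact Nat.mul_lt_mul_of_pos_right (by omega) (by omega)
      have h5 := rectangle_le_iff.1 ((h1 _ h4).1 h2)
      rw [← hν, mem_rectangle] at h5
      have : j ≤ l := h5.2
      omega
    have hl : l = 0 := by
      by_contra hl
      have h2 : rectangle k 0 ≤ ν := rectangle_le_iff.2 (hν ▸ mem_rectangle.2 ⟨le_rfl, Nat.zero_le _⟩)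
      have h4 : (rectangle k 0).card < μ.card := by
        rw [card_rectangle, hc, hcν]
        exact Nat.mul_lt_mul_of_pos_left (by omega) (by omega)
      have h5 := rectangle_le_iff.1 ((h1 _ h4).2 h2)
      rw [← hμ, mem_rectangle] at h5
      have : k ≤ i := h5.1
      omega
    subst hi hl
    have h2 : rectangle 0 1 ≤ μ := rectangle_le_iff.2 (hμ ▸ mem_rectangle.2 ⟨le_rfl, by
      change 1 ≤ j
      omega⟩)
    have h5 := rectangle_le_iff.1 ((h1 _ (by rw [card_rectangle]; omega)).1 h2)
    rw [← hν, mem_rectangle] at h5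
    have : 1 ≤ 0 := h5.2
    omega
  have hxr : ¬ (i, j) ≤ (k, l) := fun h => hx' (hν ▸ mem_rectangle.2 h)
  have hyr : ¬ (k, l) ≤ (i, j) := fun h => hy' (hμ ▸ mem_rectangle.2 h)
  rw [Prod.mk_le_mk] at hxr hyr
  rcases lt_or_ge i k with hik | hik
  · exact main hc h3 h1 hμ hν hx' hik (by omega)
  · exact main hc.symm (hc ▸ h3) (fun κ hκ => (h1 κ (hc ▸ hκ)).symm) hν hμ hy' (by omega) (by omega)

theorem eq_rectangle_of_card_eq_two {μ : YoungDiagram} (h : μ.card = 2) :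
    μ = rectangle 0 1 ∨ μ = rectangle 1 0 := by
  by_cases h1 : (0, 1) ∈ μ
  · exact Or.inl (eq_of_le_of_card_le (rectangle_le_iff.2 h1) (by rw [h, card_rectangle])).symm
  · refine Or.inr (eq_of_le_of_card_le (fun c hc => mem_rectangle.2 ⟨?_, ?_⟩)
      (by rw [h, card_rectangle]))
    · have := (lt_card_of_mem hc).1
      change c.1 ≤ 1
      omega
    · change c.2 ≤ 0
      by_contra h2
      exact h1 (μ.isLowerSet (show ((0, 1) : ℕ × ℕ) ≤ c from ⟨Nat.zero_le _, by
        change 1 ≤ c.2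
        omega⟩) hc)

theorem transpose_rectangle (i j : ℕ) : (rectangle i j).transpose = rectangle j i := by
  refine eq_of_le_of_card_le (fun c hc => ?_) (by
    rw [card_transpose, card_rectangle, card_rectangle, mul_comm])
  exact mem_rectangle.2 (Prod.swap_le_swap.1 (mem_rectangle.1 (mem_transpose.1 hc)))

theorem transpose_signTwist_of_card_eq_two {μ : YoungDiagram} (h : μ.card = 2) :
    (signTwist μ).transpose = μ := by
  have h1 := signTwist_ne_self h
  rcases eq_rectangle_of_card_eq_two h with h2 | h2 <;>
    rcases eq_rectangle_of_card_eq_two ((card_signTwist μ).trans h) with h3 | h3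
  · exact absurd (h3.trans h2.symm) h1
  · rw [h3, transpose_rectangle, h2]
  · rw [h3, transpose_rectangle, h2]
  · exact absurd (h3.trans h2.symm) h1

theorem eq_of_card_le_one {μ ν : YoungDiagram} (hc : μ.card = ν.card) (h : μ.card ≤ 1) :
    μ = ν := by
  have key : ∀ {κ : YoungDiagram}, κ.card ≤ 1 → κ ≤ rectangle 0 0 := fun hκ c hcell =>
    mem_rectangle.2 ⟨by
      have := (lt_card_of_mem hcell).1
      change c.1 ≤ 0
      omega, by
      have := (lt_card_of_mem hcell).2
      change c.2 ≤ 0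
      omega⟩
  by_cases h0 : μ.card = 0
  · exact (card_eq_zero_iff.1 h0).trans (card_eq_zero_iff.1 (hc.symm.trans h0)).symm
  · exact (eq_of_le_of_card_le (key h) (by rw [card_rectangle]; omega)).trans
      (eq_of_le_of_card_le (key (hc.symm.trans_le h)) (by rw [card_rectangle]; omega)).symm

/-- The sign twist followed by transposition is an automorphism of the poset of diagrams that
fixes the two diagrams with two cells; a diagram with at least three cells is determined by the
smaller diagrams it contains, so the automorphism is the identity. -/
theorem signTwist_eq_transpose (μ : YoungDiagram) : signTwist μ = μ.transpose := by
  have key : (signTwist μ).transpose = μ := by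
    induction hn : μ.card using Nat.strong_induction_on generalizing μ with
    | _ n ih =>
    have hc : (signTwist μ).transpose.card = μ.card := by rw [card_transpose, card_signTwist]
    by_cases h3 : 3 ≤ μ.card
    · refine eq_of_forall_lt hc (hc ▸ h3) fun κ hκ => ?_
      rw [hc, hn] at hκ
      have h1 := ih _ hκ κ rfl
      constructor
      · intro h
        rw [← h1, transpose_le_iff] at h
        have := signTwist_le_signTwist h
        rwa [signTwist_signTwist, signTwist_signTwist] at this
      · intro h
        rw [← h1, transpose_le_iff]
        exact signTwist_le_signTwist h
    · by_cases h2 : μ.card = 2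
      · exact transpose_signTwist_of_card_eq_two h2
      · exact eq_of_card_le_one hc (by omega)
  rw [← key, transpose_transpose, key]

theorem LR.transpose {α β μ : YoungDiagram} (h : LR α β μ) :
    LR α.transpose β.transpose μ.transpose := by
  have := h.signTwist
  rwa [signTwist_eq_transpose, signTwist_eq_transpose, signTwist_eq_transpose] at this

/-! ### Young diagrams as lists -/

/-- The Young diagram whose row lengths are the entries of a weakly decreasing list. -/
def dg (l : List ℕ) : YoungDiagram :=
  if h : l.SortedGE then ofRowLens l h else ⊥

theorem rowLen_dg {l : List ℕ} (h : l.SortedGE) (i : ℕ) : (dg l).rowLen i = l.getD i 0 := by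
  rw [dg, dif_pos h]
  refine eq_of_forall_lt_iff fun j => ?_
  rw [← mem_iff_lt_rowLen, mem_ofRowLens]
  by_cases hi : i < l.length
  · rw [List.getD_eq_getElem _ _ hi]
    exact ⟨fun ⟨_, h⟩ => h, fun h => ⟨hi, h⟩⟩
  · rw [List.getD_eq_default _ _ (not_lt.1 hi)]
    exact ⟨fun ⟨h, _⟩ => absurd h hi, fun h => absurd h (Nat.not_lt_zero _)⟩

theorem card_dg {l : List ℕ} (h : l.SortedGE) : (dg l).card = l.sum := by
  rw [card_eq_sum_rowLen _ (N := l.length) (by rw [rowLen_dg h, List.getD_eq_default _ _ le_rfl])]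
  simp only [rowLen_dg h]
  clear h
  induction l with
  | nil => rfl
  | cons a l ih => rw [List.sum_cons, List.length_cons, Finset.sum_range_succ', ← ih]; simp [add_comm]

theorem dg_rowLens (μ : YoungDiagram) : dg μ.rowLens = μ :=
  ext_rowLen fun i => by rw [rowLen_dg μ.rowLens_sorted, rowLen_rowLens]

/-- The weakly decreasing lists of positive numbers, at most `m`, with sum `n`, provided that the
first argument is at least `n`. -/
def boundedPartitions : ℕ → ℕ → ℕ → List (List ℕ)
  | _, 0, _ => [[]]
  | 0, _ + 1, _ => []
  | f + 1, n + 1, m => (List.range (min m (n + 1))).flatMap fun k =>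
      (boundedPartitions f (n - k) (k + 1)).map (List.cons (k + 1))

/-- All partitions of `n`, as lists of parts. -/
def partitionLists (n : ℕ) : List (List ℕ) := boundedPartitions n n n

theorem of_mem_boundedPartitions {f n m : ℕ} {l : List ℕ} (h : l ∈ boundedPartitions f n m) :
    l.Pairwise (· ≥ ·) ∧ l.sum = n ∧ ∀ x ∈ l, 0 < x ∧ x ≤ m := by
  induction f generalizing n m l with
  | zero =>
    cases n with
    | zero =>
      obtain rfl := List.mem_singleton.1 h
      simp
    | succ n => simp [boundedPartitions] at h
  | succ f ih =>
    cases n with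
    | zero =>
      obtain rfl := List.mem_singleton.1 h
      simp
    | succ n =>
      rw [boundedPartitions, List.mem_flatMap] at h
      obtain ⟨k, hk, h⟩ := h
      obtain ⟨l', hl', rfl⟩ := List.mem_map.1 h
      rw [List.mem_range] at hk
      obtain ⟨h1, h2, h3⟩ := ih hl'
      refine ⟨List.pairwise_cons.2 ⟨fun x hx => (h3 x hx).2, h1⟩, ?_, ?_⟩
      · rw [List.sum_cons, h2]
        omega
      · intro x hx
        rcases List.mem_cons.1 hx with rfl | hx
        · omega
        · have := h3 x hx
          omega

theorem mem_boundedPartitions {f n m : ℕ} {l : List ℕ} (hf : n ≤ f) (h1 : l.Pairwise (· ≥ ·))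
    (h2 : l.sum = n) (h3 : ∀ x ∈ l, 0 < x ∧ x ≤ m) : l ∈ boundedPartitions f n m := by
  induction f generalizing n m l with
  | zero =>
    obtain rfl : n = 0 := by omega
    cases l with
    | nil => simp [boundedPartitions]
    | cons a l =>
      have := h3 a (by simp)
      rw [List.sum_cons] at h2
      omega
  | succ f ih =>
    cases l with
    | nil =>
      subst h2
      simp [boundedPartitions]
    | cons a l =>
      have ha := h3 a (by simp)
      rw [List.sum_cons] at h2
      cases n with
      | zero => omega
      | succ n =>
        rw [List.pairwise_cons] at h1
        rw [boundedPartitions, List.mem_flatMap]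
        refine ⟨a - 1, List.mem_range.2 (by omega), List.mem_map.2 ⟨l, ?_, by
          rw [Nat.sub_add_cancel ha.1]⟩⟩
        refine ih (by omega) h1.2 (by omega) fun x hx => ⟨(h3 x (by simp [hx])).1, ?_⟩
        have := h1.1 x hx
        omega

theorem sortedGE_of_mem {n : ℕ} {l : List ℕ} (h : l ∈ partitionLists n) : l.SortedGE :=
  (of_mem_boundedPartitions h).1.sortedGE

theorem sum_of_mem {n : ℕ} {l : List ℕ} (h : l ∈ partitionLists n) : l.sum = n :=
  (of_mem_boundedPartitions h).2.1

theorem rowLens_mem_partitionLists {n : ℕ} {μ : YoungDiagram} (h : μ.card = n) :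
    μ.rowLens ∈ partitionLists n := by
  have hs : μ.rowLens.sum = n := by rw [sum_rowLens, h]
  refine mem_boundedPartitions le_rfl μ.rowLens_sorted.pairwise hs
    fun x hx => ⟨pos_of_mem_rowLens μ x hx, ?_⟩
  rw [← hs]
  exact List.single_le_sum (fun _ _ => Nat.zero_le _) x hx

theorem exists_mem_partitionLists {n : ℕ} {μ : YoungDiagram} (h : μ.card = n) :
    ∃ l ∈ partitionLists n, dg l = μ :=
  ⟨μ.rowLens, rowLens_mem_partitionLists h, dg_rowLens μ⟩

theorem rowLens_dg {n : ℕ} {l : List ℕ} (h : l ∈ partitionLists n) : (dg l).rowLens = l := by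
  rw [dg, dif_pos (sortedGE_of_mem h)]
  exact rowLens_ofRowLens_eq_self fun x hx => ((of_mem_boundedPartitions h).2.2 x hx).1

theorem sized_eq_image (n : ℕ) : sized n = (partitionLists n).toFinset.image dg := by
  ext μ
  simp only [mem_sized, Finset.mem_image, List.mem_toFinset]
  refine ⟨exists_mem_partitionLists, ?_⟩
  rintro ⟨l, hl, rfl⟩
  rw [card_dg (sortedGE_of_mem hl), sum_of_mem hl]

theorem sum_sized {M : Type*} [AddCommMonoid M] {n : ℕ} (hn : (partitionLists n).Nodup)
    (f : YoungDiagram → M) :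
    ∑ μ ∈ sized n, f μ = ((partitionLists n).map fun l => f (dg l)).sum := by
  rw [sized_eq_image, Finset.sum_image, List.sum_toFinset _ hn]
  intro a ha b hb hab
  rw [← rowLens_dg (List.mem_toFinset.1 ha), hab, rowLens_dg (List.mem_toFinset.1 hb)]

/-- The horizontal strip condition on lists. -/
def isHorizontalStrip : List ℕ → List ℕ → Bool
  | k, [] => k.all (· == 0)
  | [], _ :: m => m.all (· == 0)
  | a :: k, b :: m => decide (a ≤ b) && decide (m.headD 0 ≤ a) && isHorizontalStrip k m

theorem getD_eq_zero_of_all {l : List ℕ} (h : l.all (· == 0)) (i : ℕ) : l.getD i 0 = 0 := by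
  by_cases hi : i < l.length
  · rw [List.getD_eq_getElem _ _ hi]
    have := List.all_eq_true.1 h _ (List.getElem_mem hi)
    simpa using this
  · rw [List.getD_eq_default _ _ (not_lt.1 hi)]

theorem all_iff_getD {l : List ℕ} : (l.all (· == 0)) = true ↔ ∀ i, l.getD i 0 = 0 := by
  refine ⟨fun h i => getD_eq_zero_of_all h i, fun h => List.all_eq_true.2 fun x hx => ?_⟩
  obtain ⟨i, hi, rfl⟩ := List.getElem_of_mem hx
  have := h i
  rw [List.getD_eq_getElem _ _ hi] at this
  simpa using this

theorem isHorizontalStrip_iff (k m : List ℕ) : isHorizontalStrip k m = true ↔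
    ∀ i, k.getD i 0 ≤ m.getD i 0 ∧ m.getD (i + 1) 0 ≤ k.getD i 0 := by
  induction m generalizing k with
  | nil =>
    rw [isHorizontalStrip, all_iff_getD]
    simp
  | cons b m ih =>
    cases k with
    | nil =>
      rw [isHorizontalStrip, all_iff_getD]
      simp
    | cons a k =>
      rw [isHorizontalStrip, Bool.and_eq_true, Bool.and_eq_true, decide_eq_true_iff,
        decide_eq_true_iff, ih]
      have hm : m.headD 0 = m.getD 0 0 := by cases m <;> rfl
      rw [hm]
      constructor
      · rintro ⟨h1, h2⟩ (_ | i)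
        · exact h1
        · exact h2 i
      · exact fun h => ⟨h 0, fun i => h (i + 1)⟩

theorem horizontalStrip_dg_iff {k m : List ℕ} (hk : k.SortedGE) (hm : m.SortedGE) :
    HorizontalStrip (dg k) (dg m) ↔ isHorizontalStrip k m = true := by
  rw [isHorizontalStrip_iff]
  simp only [HorizontalStrip, rowLen_dg hk, rowLen_dg hm]

/-- The vertical strip condition on lists. -/
def isVerticalStrip : List ℕ → List ℕ → Bool
  | [], [] => true
  | [], b :: m => decide (b ≤ 1) && isVerticalStrip [] m
  | _ :: _, [] => false
  | a :: k, b :: m => decide (a ≤ b) && decide (b ≤ a + 1) && isVerticalStrip k m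

theorem getD_of_isVerticalStrip {k m : List ℕ} (h : isVerticalStrip k m = true) (i : ℕ) :
    k.getD i 0 ≤ m.getD i 0 ∧ m.getD i 0 ≤ k.getD i 0 + 1 := by
  induction m generalizing k i with
  | nil =>
    cases k with
    | nil => simp
    | cons a k => simp [isVerticalStrip] at h
  | cons b m ih =>
    cases k with
    | nil =>
      rw [isVerticalStrip, Bool.and_eq_true, decide_eq_true_iff] at h
      cases i with
      | zero => simpa using h.1
      | succ i => simpa using ih h.2 i
    | cons a k =>
      rw [isVerticalStrip, Bool.and_eq_true, Bool.and_eq_true, decide_eq_true_iff,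
        decide_eq_true_iff] at h
      cases i with
      | zero => simpa using h.1
      | succ i => simpa using ih h.2 i

/-- A column of `k` cells. -/
def colDiagram (k : ℕ) : YoungDiagram := (rowDiagram k).transpose

theorem card_colDiagram (k : ℕ) : (colDiagram k).card = k := by
  rw [colDiagram, card_transpose, card_rowDiagram]

/-- Pieri's rule for columns. -/
theorem lr_colDiagram_iff {k : ℕ} {ν μ : YoungDiagram} :
    LR (colDiagram k) ν μ ↔
      (∀ i, ν.rowLen i ≤ μ.rowLen i ∧ μ.rowLen i ≤ ν.rowLen i + 1) ∧ μ.card = ν.card + k := by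
  have h : LR (colDiagram k) ν μ ↔ LR (rowDiagram k) ν.transpose μ.transpose :=
    ⟨fun h => by simpa [colDiagram] using h.transpose, fun h => by
      simpa [colDiagram] using h.transpose⟩
  rw [h, lr_rowDiagram_iff, card_transpose, card_transpose]
  refine and_congr_left fun _ => ?_
  constructor
  · intro hs i
    refine ⟨le_iff_rowLen.1 (transpose_le_iff.1 hs.le) i, ?_⟩
    by_contra! hlt
    have h1 : (i, ν.rowLen i + 1) ∈ μ := mem_iff_lt_rowLen.2 hlt
    have h2 := (hs (ν.rowLen i)).2
    rw [rowLen_transpose, rowLen_transpose] at h2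
    have h3 := mem_iff_lt_rowLen.1 (mem_iff_lt_colLen.2 ((mem_iff_lt_colLen.1 h1).trans_le h2))
    exact lt_irrefl _ h3
  · intro hs j
    have hle : ν ≤ μ := le_iff_rowLen.2 fun i => (hs i).1
    refine ⟨le_iff_rowLen.1 (transpose_le_iff.2 hle) j, ?_⟩
    rw [rowLen_transpose, rowLen_transpose]
    refine le_of_forall_lt fun i hi => ?_
    rw [← mem_iff_lt_colLen, mem_iff_lt_rowLen] at hi ⊢
    have := (hs i).2
    omega

theorem LR.of_isHorizontalStrip {k m : List ℕ} (hk : k.SortedGE) (hm : m.SortedGE) {r : ℕ}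
    (h : isHorizontalStrip k m = true) (hs : m.sum = k.sum + r) :
    LR (rowDiagram r) (dg k) (dg m) :=
  lr_rowDiagram_iff.2 ⟨(horizontalStrip_dg_iff hk hm).2 h, by rw [card_dg hk, card_dg hm, hs]⟩

theorem LR.of_isVerticalStrip {k m : List ℕ} (hk : k.SortedGE) (hm : m.SortedGE) {r : ℕ}
    (h : isVerticalStrip k m = true) (hs : m.sum = k.sum + r) :
    LR (colDiagram r) (dg k) (dg m) :=
  lr_colDiagram_iff.2 ⟨fun i => by
    rw [rowLen_dg hk, rowLen_dg hm]
    exact getD_of_isVerticalStrip h i, by rw [card_dg hk, card_dg hm, hs]⟩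

/-! ### Products with the Schur function of the two by two square -/

/-- The number of ways to go from `a` to `m` by adding a horizontal strip of size `r` and then
another horizontal strip. -/
def stripChains (a m : List ℕ) (r : ℕ) : ℕ :=
  ((partitionLists (a.sum + r)).filter fun k =>
    isHorizontalStrip a k && isHorizontalStrip k m).length

open scoped Classical in
theorem schurCoeff_row_mul_schur (k : ℕ) (κ μ : YoungDiagram) (hμ : μ.card = κ.card + k) :
    schurCoeff μ (schur (rowDiagram k) * schur κ) = if HorizontalStrip κ μ then 1 else 0 := by
  rw [schur_rowDiagram_mul_schur, map_sum]
  simp only [schurCoeff_schur, Finset.sum_ite_eq', Finset.mem_filter, mem_sized, hμ, true_and]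

theorem schurCoeff_row_mul_row_mul_schur {a m : List ℕ} (ha : a.SortedGE) (hm : m.SortedGE)
    {k r : ℕ} (hs : m.sum = a.sum + r + k) (hn : (partitionLists (a.sum + r)).Nodup) :
    schurCoeff (dg m) (schur (rowDiagram k) * (schur (rowDiagram r) * schur (dg a))) =
      stripChains a m r := by
  classical
  have h1 : ∀ l ∈ partitionLists (a.sum + r),
      schurCoeff (dg m) (schur (rowDiagram k) *
        if HorizontalStrip (dg a) (dg l) then schur (dg l) else 0) =
      if (isHorizontalStrip a l && isHorizontalStrip l m) = true then 1 else 0 := by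
    intro l hl
    have hl' := sortedGE_of_mem hl
    simp only [horizontalStrip_dg_iff ha hl', Bool.and_eq_true]
    by_cases h : isHorizontalStrip a l = true
    · rw [if_pos h, schurCoeff_row_mul_schur _ _ _ (by
        rw [card_dg hm, card_dg hl', sum_of_mem hl, hs])]
      simp only [horizontalStrip_dg_iff hl' hm, h, true_and]
    · rw [if_neg h, mul_zero, map_zero, if_neg fun h' => h h'.1]
  rw [schur_rowDiagram_mul_schur, card_dg ha, Finset.sum_filter, Finset.mul_sum, map_sum,
    sum_sized hn, stripChains, List.map_congr_left h1]
  generalize partitionLists (a.sum + r) = L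
  induction L with
  | nil => simp
  | cons x L ih =>
    rw [List.map_cons, List.sum_cons, ih, List.filter_cons]
    split_ifs with h
    · rw [List.length_cons]
      push_cast
      ring
    · rw [zero_add]

theorem rowDiagram_eq_dg (k : ℕ) : rowDiagram k = dg [k] := by
  have h : [k].SortedGE := (List.pairwise_singleton _ _).sortedGE
  refine ext_rowLen fun i => ?_
  rw [rowLen_rowDiagram, rowLen_dg h]
  cases i <;> simp

/-- The Jacobi–Trudi formula for the two by two square. -/
theorem schur_square_add :
    schur (dg [2, 2]) + schur (rowDiagram 3) * schur (rowDiagram 1) =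
      schur (rowDiagram 2) * schur (rowDiagram 2) := by
  classical
  have hn : (partitionLists 4).Nodup := by decide
  have key : ∀ k r : ℕ, k + r = 4 → schur (rowDiagram k) * schur (rowDiagram r) =
      ((partitionLists 4).map fun l =>
        if isHorizontalStrip [r] l = true then schur (dg l) else 0).sum := by
    intro k r hkr
    have hr : [r].SortedGE := (List.pairwise_singleton _ _).sortedGE
    have hc : r + k = 4 := by omega
    rw [schur_rowDiagram_mul_schur, card_rowDiagram, Finset.sum_filter, hc, sum_sized hn,
      rowDiagram_eq_dg]
    congr 1
    refine List.map_congr_left fun l hl => ?_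
    simp only [horizontalStrip_dg_iff hr (sortedGE_of_mem hl)]
  rw [key 3 1 rfl, key 2 2 rfl]
  have hp : partitionLists 4 = [[1, 1, 1, 1], [2, 1, 1], [2, 2], [3, 1], [4]] := by decide
  rw [hp]
  simp [isHorizontalStrip]

/-- By the Jacobi–Trudi formula, the coefficient of `s_m` in `s_{22} s_a` is a difference of two
numbers of chains of strips, and it is decidable whether they agree. -/
theorem lr_square_iff {a m : List ℕ} (ha : a.SortedGE) (hm : m.SortedGE)
    (hs : m.sum = a.sum + 4) (h1 : (partitionLists (a.sum + 1)).Nodup)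
    (h2 : (partitionLists (a.sum + 2)).Nodup) :
    LR (dg [2, 2]) (dg a) (dg m) ↔ stripChains a m 2 ≠ stripChains a m 1 := by
  have h := congrArg (fun F => schurCoeff (dg m) (F * schur (dg a))) schur_square_add
  simp only [add_mul, map_add, mul_assoc] at h
  rw [schurCoeff_row_mul_row_mul_schur ha hm (by omega) h1,
    schurCoeff_row_mul_row_mul_schur ha hm (by omega) h2] at h
  rw [LR, Occurs, eq_sub_of_add_eq h, sub_ne_zero, Ne, Nat.cast_inj]

theorem lr_square_44 : LR (dg [2, 2]) (dg [2, 2]) (dg [4, 4]) :=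
  (lr_square_iff (by decide) (by decide) (by decide) (by decide) (by decide)).2 (by decide)

/-! ### The diagrams that are not left out -/

/-- The diagrams whose Schur functions are summands of `g_n`: from three cells on, neither the
first row nor the first column may have exactly one cell less than the diagram. -/
def Good (μ : YoungDiagram) : Prop :=
  μ.card ≤ 2 ∨ μ.rowLen 0 + 1 ≠ μ.card ∧ μ.colLen 0 + 1 ≠ μ.card

theorem Good.transpose {μ : YoungDiagram} (h : Good μ) : Good μ.transpose := by
  rwa [Good, card_transpose, rowLen_transpose, colLen_transpose, and_comm]

theorem eq_replicate_of_sum_eq_length {l : List ℕ} (h0 : ∀ x ∈ l, 0 < x)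
    (h : l.sum = l.length) : l = List.replicate l.length 1 := by
  induction l with
  | nil => rfl
  | cons a l ih =>
    have h1 := h0 a (by simp)
    have h2 : l.length ≤ l.sum := by
      have := List.card_nsmul_le_sum l 1 fun x hx => h0 x (by simp [hx])
      simpa using this
    rw [List.sum_cons, List.length_cons] at h
    have h3 := ih (fun x hx => h0 x (by simp [hx])) (by omega)
    obtain rfl : a = 1 := by omega
    rw [List.length_cons, List.replicate_succ, ← h3]

theorem eq_cons_replicate_of_sum_eq {l : List ℕ} (hs : l.Pairwise (· ≥ ·)) (h0 : ∀ x ∈ l, 0 < x)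
    (h : l.sum = l.length + 1) : l = 2 :: List.replicate (l.length - 1) 1 := by
  cases l with
  | nil => simp at h
  | cons a l =>
    have h1 := h0 a (by simp)
    have h2 : l.length ≤ l.sum := by
      have := List.card_nsmul_le_sum l 1 fun x hx => h0 x (by simp [hx])
      simpa using this
    rw [List.sum_cons, List.length_cons] at h
    have ha : a = 2 := by
      by_contra hne
      have ha : a = 1 := by omega
      have h3 : l.sum ≤ l.length := by
        have := List.sum_le_card_nsmul l 1 fun x hx => by
          have := (List.pairwise_cons.1 hs).1 x hx
          omega
        simpa using this
      omega
    subst ha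
    rw [List.length_cons, Nat.add_sub_cancel,
      ← eq_replicate_of_sum_eq_length (fun x hx => h0 x (by simp [hx])) (by omega)]

theorem omitted_iff_not_good {n : ℕ} (p : n.Partition) : Omitted p ↔ ¬ Good (diagram p) := by
  have hparts := coe_rowLens_diagram p
  have hcard := card_diagram p
  have hs := (diagram p).rowLens_sorted.pairwise
  have h0 : ∀ x ∈ (diagram p).rowLens, 0 < x := pos_of_mem_rowLens _
  have hsum := sum_rowLens (diagram p)
  have hhead := rowLen_rowLens (diagram p) 0
  have hlen := (diagram p).length_rowLens
  rw [Good, hcard, ← hhead, ← hlen, Omitted, ← hparts]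
  rw [hcard] at hsum
  generalize (diagram p).rowLens = l at *
  push Not
  have key : ∀ l' : List ℕ, l'.Pairwise (· ≥ ·) → ((l : Multiset ℕ) = l' ↔ l = l') :=
    fun l' hl' => by
      rw [Multiset.coe_eq_coe]
      exact ⟨fun h => h.eq_of_sortedGE hs.sortedGE hl'.sortedGE, fun h => h ▸ List.Perm.refl _⟩
  constructor
  · rintro ⟨h3, h | h⟩
    · have h' : l = [n - 1, 1] := (key [n - 1, 1] (by
        simp only [List.pairwise_cons, List.mem_singleton, forall_eq, List.not_mem_nil,
          IsEmpty.forall_iff, implies_true, List.Pairwise.nil, and_true]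
        omega)).1 h
      refine ⟨by omega, fun h4 => absurd ?_ h4⟩
      rw [h']
      simp
      omega
    · have h' : l = 2 :: List.replicate (n - 2) 1 := (key (2 :: List.replicate (n - 2) 1) (by
        refine List.pairwise_cons.2 ⟨fun x hx => ?_, List.pairwise_replicate.2 (Or.inr le_rfl)⟩
        rw [List.eq_of_mem_replicate hx]
        omega)).1 (by rw [h]; rfl)
      refine ⟨by omega, fun _ => ?_⟩
      rw [h', List.length_cons, List.length_replicate]
      omega
  · rintro ⟨h3, h⟩
    refine ⟨h3, ?_⟩
    by_cases h4 : l.getD 0 0 + 1 = n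
    · left
      cases l with
      | nil => simp at h4; omega
      | cons a l =>
        rw [List.getD_cons_zero] at h4
        rw [List.sum_cons] at hsum
        have h5 : l.sum = 1 := by omega
        have h6 : l = [1] := by
          cases l with
          | nil => simp at h5
          | cons b l =>
            have hb := h0 b (by simp)
            rw [List.sum_cons] at h5
            cases l with
            | nil => simp at h5; rw [h5]
            | cons c l =>
              have hc := h0 c (by simp)
              rw [List.sum_cons] at h5
              omega
        rw [h6, ← h4, Nat.add_sub_cancel]
        rfl
    · right
      have h5 := h h4
      have h6 := eq_cons_replicate_of_sum_eq hs h0 (by omega)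
      have h7 : n - 2 = l.length - 1 := by omega
      rw [h7]
      exact congrArg _ h6

theorem g_eq_sum (n : ℕ) : g n = by
    classical exact ∑ μ ∈ sized n with Good μ, schur μ := by
  classical
  have h : (sized n).filter Good =
      (Finset.univ.filter fun p : n.Partition => ¬ Omitted p).image diagram := by
    ext μ
    simp only [Finset.mem_filter, mem_sized, Finset.mem_image, Finset.mem_univ, true_and]
    constructor
    · rintro ⟨h1, h2⟩
      obtain ⟨p, rfl⟩ := exists_diagram_eq h1
      exact ⟨p, by rwa [omitted_iff_not_good, not_not], rfl⟩
    · rintro ⟨p, h1, rfl⟩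
      rw [omitted_iff_not_good, not_not] at h1
      exact ⟨card_diagram p, h1⟩
  rw [g, h, Finset.sum_image fun p _ q _ hpq => diagram_injective hpq]

theorem schurPositive_g (n : ℕ) : SchurPositive n (g n) := by
  classical
  rw [g_eq_sum]
  refine SchurPositive.sum _ fun μ hμ => ?_
  rw [← mem_sized.1 (Finset.mem_filter.1 hμ).1]
  exact schurPositive_schur μ

theorem occurs_g_iff {n : ℕ} {μ : YoungDiagram} : Occurs (g n) μ ↔ μ.card = n ∧ Good μ := by
  classical
  rw [g_eq_sum, occurs_sum_iff (n := n)]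
  · simp only [occurs_schur_iff, exists_eq_right, Finset.mem_filter, mem_sized]
  · intro ν hν
    rw [← mem_sized.1 (Finset.mem_filter.1 hν).1]
    exact schurPositive_schur ν

theorem schurPositive_prod_g (S : Multiset ℕ) : SchurPositive S.sum (S.map g).prod := by
  induction S using Multiset.induction_on with
  | empty =>
    rw [Multiset.map_zero, Multiset.prod_zero, Multiset.sum_zero, ← schur_bot]
    exact schurPositive_schur ⊥
  | cons a S ih =>
    rw [Multiset.map_cons, Multiset.prod_cons, Multiset.sum_cons]
    exact (schurPositive_g a).mul ih

/-- All Schur functions of the right degree occur in `∏ g_k`, the product over `k ∈ S`. -/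
def Full (S : Multiset ℕ) : Prop :=
  ∀ μ : YoungDiagram, μ.card = S.sum → Occurs (S.map g).prod μ

theorem occurs_cons_iff {k : ℕ} {S : Multiset ℕ} {μ : YoungDiagram} :
    Occurs ((k ::ₘ S).map g).prod μ ↔
      ∃ α β, (α.card = k ∧ Good α) ∧ Occurs (S.map g).prod β ∧ LR α β μ := by
  rw [Multiset.map_cons, Multiset.prod_cons,
    occurs_mul_iff (schurPositive_g k) (schurPositive_prod_g S)]
  simp only [occurs_g_iff]

theorem occurs_singleton_iff {k : ℕ} {μ : YoungDiagram} :
    Occurs (({k} : Multiset ℕ).map g).prod μ ↔ μ.card = k ∧ Good μ := by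
  rw [Multiset.map_singleton, Multiset.prod_singleton, occurs_g_iff]

/-- The Schur function `s_μ` occurs in `g_a g_b`. -/
def PairOccurs (a b : ℕ) (μ : YoungDiagram) : Prop :=
  ∃ α β, (α.card = a ∧ Good α) ∧ (β.card = b ∧ Good β) ∧ LR α β μ

theorem occurs_pair_iff {a b : ℕ} {μ : YoungDiagram} :
    Occurs (({a, b} : Multiset ℕ).map g).prod μ ↔ PairOccurs a b μ := by
  rw [Multiset.insert_eq_cons, occurs_cons_iff]
  simp only [occurs_singleton_iff]
  rfl

theorem PairOccurs.transpose {a b : ℕ} {μ : YoungDiagram} (h : PairOccurs a b μ) :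
    PairOccurs a b μ.transpose := by
  obtain ⟨α, β, ⟨h1, h1'⟩, ⟨h2, h2'⟩, h3⟩ := h
  exact ⟨_, _, ⟨by rw [card_transpose, h1], h1'.transpose⟩,
    ⟨by rw [card_transpose, h2], h2'.transpose⟩, h3.transpose⟩

theorem rowLen_add_le_card (μ : YoungDiagram) :
    μ.rowLen 0 + μ.rowLen 1 + μ.rowLen 2 ≤ μ.card := by
  rw [card_eq_sum_rowLen μ (rowLen_eq_zero_of_colLen_le μ (Nat.le_add_right _ 3))]
  have h : Finset.range 3 ⊆ Finset.range (μ.colLen 0 + 3) :=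
    Finset.range_subset_range.2 (Nat.le_add_left _ _)
  have := Finset.sum_le_sum_of_subset (f := μ.rowLen) h
  simpa [Finset.sum_range_succ] using this

theorem colLen_add_le_card (μ : YoungDiagram) :
    μ.colLen 0 + μ.colLen 1 + μ.colLen 2 ≤ μ.card := by
  have := rowLen_add_le_card μ.transpose
  rwa [rowLen_transpose, rowLen_transpose, rowLen_transpose, card_transpose] at this

theorem good_of_one_one_mem {μ : YoungDiagram} (h : (1, 1) ∈ μ) : Good μ := by
  have h1 := rowLen_add_le_card μ
  have h2 := colLen_add_le_card μ
  have h3 := mem_iff_lt_rowLen.1 h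
  have h4 := mem_iff_lt_colLen.1 h
  exact Or.inr ⟨by omega, by omega⟩

theorem good_of_mem_of_mem {μ : YoungDiagram} (h : (0, 2) ∈ μ) (h' : (2, 0) ∈ μ) : Good μ := by
  have h1 := rowLen_add_le_card μ
  have h2 := colLen_add_le_card μ
  have h3 := mem_iff_lt_colLen.1 h
  have h4 := mem_iff_lt_rowLen.1 h'
  have h5 := μ.rowLen_anti 1 2 (by omega)
  have h6 := μ.colLen_anti 1 2 (by omega)
  exact Or.inr ⟨by omega, by omega⟩

theorem colLen_pos_iff {μ : YoungDiagram} : 0 < μ.colLen 0 ↔ 0 < μ.rowLen 0 := by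
  rw [← mem_iff_lt_colLen, mem_iff_lt_rowLen]

theorem colLen_rowDiagram {k : ℕ} (hk : 0 < k) : (rowDiagram k).colLen 0 = 1 := by
  refine eq_of_forall_lt_iff fun i => ?_
  rw [← mem_iff_lt_colLen, mem_iff_lt_rowLen, rowLen_rowDiagram]
  split_ifs <;> omega

theorem good_rowDiagram (k : ℕ) : Good (rowDiagram k) := by
  rw [Good, card_rowDiagram, rowLen_rowDiagram]
  by_cases hk : k ≤ 2
  · exact Or.inl hk
  · rw [colLen_rowDiagram (by omega)]
    exact Or.inr ⟨by simp, by omega⟩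

theorem good_colDiagram (k : ℕ) : Good (colDiagram k) := (good_rowDiagram k).transpose

theorem rowDiagram_le_iff {k : ℕ} {μ : YoungDiagram} : rowDiagram k ≤ μ ↔ k ≤ μ.rowLen 0 := by
  rw [le_iff_rowLen]
  simp only [rowLen_rowDiagram]
  refine ⟨fun h => by simpa using h 0, fun h i => ?_⟩
  split_ifs with hi
  · rwa [hi]
  · exact Nat.zero_le _

theorem colDiagram_le_iff {k : ℕ} {μ : YoungDiagram} : colDiagram k ≤ μ ↔ k ≤ μ.colLen 0 := by
  rw [colDiagram, ← transpose_le_iff, transpose_transpose, rowDiagram_le_iff, rowLen_transpose]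

theorem card_eq_sum_colLen_zero (μ : YoungDiagram) :
    μ.card = ∑ i ∈ Finset.range (μ.colLen 0), μ.rowLen i :=
  card_eq_sum_rowLen μ (rowLen_eq_zero_of_colLen_le μ le_rfl)

/-- The number of cells of a hook. -/
theorem card_add_one_of_hook {μ : YoungDiagram} (h : μ.rowLen 1 ≤ 1) (hne : 0 < μ.rowLen 0) :
    μ.card + 1 = μ.rowLen 0 + μ.colLen 0 := by
  have hc := colLen_pos_iff.2 hne
  obtain ⟨k, hk⟩ := Nat.exists_eq_add_of_lt hc
  rw [card_eq_sum_colLen_zero, hk, zero_add, Finset.sum_range_succ']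
  have : ∀ i ∈ Finset.range k, μ.rowLen (i + 1) = 1 := fun i hi => by
    have h1 := μ.rowLen_anti 1 (i + 1) (by omega)
    have h2 : (i + 1, 0) ∈ μ := mem_iff_lt_colLen.2 (by have := Finset.mem_range.1 hi; omega)
    have h3 := mem_iff_lt_rowLen.1 h2
    omega
  rw [Finset.sum_congr rfl this]
  simp
  omega

theorem rowLen_zero_pos {μ : YoungDiagram} (h : 0 < μ.card) : 0 < μ.rowLen 0 := by
  by_contra h0
  rw [card_eq_sum_rowLen μ (N := 0) (by omega)] at h
  simp at h

theorem exists_le_card_eq {κ μ : YoungDiagram} (h : κ ≤ μ) {k : ℕ} (h1 : κ.card ≤ k)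
    (h2 : k ≤ μ.card) : ∃ α, κ ≤ α ∧ α ≤ μ ∧ α.card = k := by
  obtain ⟨α, β, h3, -, h4, -, h5⟩ := (lr_bot_iff.2 (rfl : κ = κ)).symm.exists_enlarge h h1
    (b := μ.card - k) (by rw [card_bot]; omega) (by omega)
  exact ⟨α, h3, h5.le, h4⟩

/-- A diagram contains a diagram with `k` cells that is not left out, unless it is too small:
the exceptions are the square, for `k = 3`, and `(3, 1, 1)`, for `k = 4`. -/
theorem exists_good_le {μ : YoungDiagram} {k m : ℕ} (hμ : μ.card = k + m)
    (h : k ≤ 2 ∨ 2 ≤ m ∨ 5 ≤ k ∧ 1 ≤ m) : ∃ α, α ≤ μ ∧ α.card = k ∧ Good α := by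
  by_cases hk : k ≤ 2
  · obtain ⟨α, -, h1, h2⟩ := exists_le_card_eq (bot_le : ⊥ ≤ μ) (k := k)
      (by rw [card_bot]; omega) (by omega)
    exact ⟨α, h1, h2, Or.inl (by omega)⟩
  by_cases hr : k ≤ μ.rowLen 0
  · exact ⟨_, rowDiagram_le_iff.2 hr, card_rowDiagram k, good_rowDiagram k⟩
  by_cases hc : k ≤ μ.colLen 0
  · exact ⟨_, colDiagram_le_iff.2 hc, card_colDiagram k, good_colDiagram k⟩
  have hpos := rowLen_zero_pos (μ := μ) (by omega)
  by_cases h11 : (1, 1) ∈ μ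
  · by_cases hk3 : k = 3
    · -- At most two columns and at most two rows leave room for at most four cells.
      exfalso
      subst hk3
      have h1 : μ.card ≤ μ.colLen 0 * 2 := by
        rw [card_eq_sum_colLen_zero]
        have := Finset.sum_le_card_nsmul (Finset.range (μ.colLen 0)) μ.rowLen 2 fun i _ =>
          (μ.rowLen_anti 0 i (Nat.zero_le _)).trans (by omega)
        simpa using this
      omega
    · obtain ⟨α, h1, h2, h3⟩ := exists_le_card_eq (rectangle_le_iff.2 h11) (k := k)
        (by rw [card_rectangle]; omega) (by omega)
      exact ⟨α, h2, h3, good_of_one_one_mem (rectangle_le_iff.1 h1)⟩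
  · rw [mem_iff_lt_rowLen] at h11
    have hhook := card_add_one_of_hook (by omega) hpos
    obtain ⟨α, h1, h2, h3⟩ : ∃ α, rowDiagram 3 ⊔ colDiagram 3 ≤ α ∧ α ≤ μ ∧ α.card = k := by
      refine exists_le_card_eq (sup_le (rowDiagram_le_iff.2 (by omega))
        (colDiagram_le_iff.2 (by omega))) ?_ (by omega)
      have h5 : (rowDiagram 3 ⊔ colDiagram 3).card ≤ 5 := by
        have hle : rectangle 0 0 ≤ rowDiagram 3 ⊓ colDiagram 3 :=
          le_inf (rectangle_le_iff.2 (mem_iff_lt_rowLen.2 (by rw [rowLen_rowDiagram]; simp)))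
            (rectangle_le_iff.2 (mem_iff_lt_colLen.2 (by
              rw [colDiagram, colLen_transpose, rowLen_rowDiagram]; simp)))
        have h6 := card_mono hle
        rw [card_rectangle] at h6
        have h7 : (rowDiagram 3 ⊔ colDiagram 3).card + (rowDiagram 3 ⊓ colDiagram 3).card =
            (rowDiagram 3).card + (colDiagram 3).card :=
          Finset.card_union_add_card_inter _ _
        rw [card_rowDiagram, card_colDiagram] at h7
        omega
      omega
    refine ⟨α, h2, h3, good_of_mem_of_mem (mem_iff_lt_rowLen.2 ?_) (mem_iff_lt_colLen.2 ?_)⟩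
    · exact rowDiagram_le_iff.1 (le_sup_left.trans h1)
    · exact colDiagram_le_iff.1 (le_sup_right.trans h1)

/-- Remove a good diagram `α` of size `k` from `μ`; what remains can be any diagram `β`. -/
theorem Full.cons {S : Multiset ℕ} (h : Full S) (h2 : 2 ≤ S.sum) (k : ℕ) : Full (k ::ₘ S) := by
  intro μ hμ
  rw [Multiset.sum_cons] at hμ
  obtain ⟨α, h3, h4, h5⟩ := exists_good_le hμ (Or.inr (Or.inl h2))
  obtain ⟨β, hβ⟩ := le_iff_exists_lr.1 h3
  have := hβ.card_eq
  exact occurs_cons_iff.2 ⟨α, β, ⟨h4, h5⟩, h β (by omega), hβ⟩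

/-- A product with a full subproduct of degree at least two is full. -/
theorem Full.mono {S T : Multiset ℕ} (h : Full S) (h2 : 2 ≤ S.sum) (hST : S ≤ T) : Full T := by
  obtain ⟨U, rfl⟩ := exists_add_of_le hST
  induction U using Multiset.induction_on with
  | empty => rwa [add_zero]
  | cons a U ih =>
    rw [Multiset.add_cons]
    refine (ih (Multiset.le_add_right _ _)).cons ?_ a
    rw [Multiset.sum_add]
    omega

/-- Nothing is left out of `g_b` for `b ≤ 2`, so only the factor `g_a` matters. -/
theorem pairOccurs_of_le_two {a b : ℕ} (hb : b ≤ 2) (h : a ≤ 2 ∨ b = 2 ∨ 5 ≤ a ∧ 1 ≤ b)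
    {μ : YoungDiagram} (hμ : μ.card = a + b) : PairOccurs a b μ := by
  obtain ⟨α, h3, h4, h5⟩ := exists_good_le hμ (by omega)
  obtain ⟨β, hβ⟩ := le_iff_exists_lr.1 h3
  have := hβ.card_eq
  exact ⟨α, β, ⟨h4, h5⟩, ⟨by omega, Or.inl (by omega)⟩, hβ⟩

/-! ### Products of two factors -/

theorem dg_le_of {l : List ℕ} (hl : l.SortedGE) {μ : YoungDiagram}
    (h : ∀ i < l.length, l.getD i 0 ≤ μ.rowLen i) : dg l ≤ μ := by
  refine le_iff_rowLen.2 fun i => ?_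
  rw [rowLen_dg hl]
  by_cases hi : i < l.length
  · exact h i hi
  · rw [List.getD_eq_default _ _ (not_lt.1 hi)]
    exact Nat.zero_le _

theorem dg_two_le {a b : ℕ} (hab : [a, b].SortedGE) {μ : YoungDiagram} (h0 : a ≤ μ.rowLen 0)
    (h1 : b ≤ μ.rowLen 1) : dg [a, b] ≤ μ :=
  dg_le_of hab fun i hi => by
    simp only [List.length_cons, List.length_nil] at hi
    interval_cases i
    · exact h0
    · exact h1

theorem dg_three_le {a b c : ℕ} (habc : [a, b, c].SortedGE) {μ : YoungDiagram}
    (h0 : a ≤ μ.rowLen 0) (h1 : b ≤ μ.rowLen 1) (h2 : c ≤ μ.rowLen 2) : dg [a, b, c] ≤ μ :=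
  dg_le_of habc fun i hi => by
    simp only [List.length_cons, List.length_nil] at hi
    interval_cases i
    · exact h0
    · exact h1
    · exact h2

theorem dg_four_le {a b c d : ℕ} (h : [a, b, c, d].SortedGE) {μ : YoungDiagram}
    (h0 : a ≤ μ.rowLen 0) (h1 : b ≤ μ.rowLen 1) (h2 : c ≤ μ.rowLen 2) (h3 : d ≤ μ.rowLen 3) :
    dg [a, b, c, d] ≤ μ :=
  dg_le_of h fun i hi => by
    simp only [List.length_cons, List.length_nil] at hi
    interval_cases i
    · exact h0
    · exact h1
    · exact h2
    · exact h3

/-- Every diagram containing `κ` is good. -/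
def AlwaysGood (κ : YoungDiagram) : Prop := ∀ α, κ ≤ α → Good α

theorem alwaysGood_of_one_one_mem {κ : YoungDiagram} (h : (1, 1) ∈ κ) : AlwaysGood κ :=
  fun _ hα => good_of_one_one_mem (hα h)

theorem alwaysGood_square : AlwaysGood (dg [2, 2]) :=
  alwaysGood_of_one_one_mem (mem_iff_lt_rowLen.2 (by rw [rowLen_dg (by decide)]; decide))

theorem alwaysGood_hook : AlwaysGood (dg [3, 1, 1]) := fun _ hα =>
  good_of_mem_of_mem (hα (mem_iff_lt_rowLen.2 (by rw [rowLen_dg (by decide)]; decide)))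
    (hα (mem_iff_lt_rowLen.2 (by rw [rowLen_dg (by decide)]; decide)))

/-- An occurrence of `μ₀` in `s_{α₀} s_{β₀}` persists in `g_a g_b` for all larger diagrams, as long
as the enlarged factors cannot leave the range of the sums. -/
theorem pairOccurs_of_le {α₀ β₀ μ₀ μ : YoungDiagram} (h : LR α₀ β₀ μ₀) (hμ : μ₀ ≤ μ) {a b : ℕ}
    (hc : μ.card = a + b) (ha : α₀.card ≤ a) (hb : β₀.card ≤ b) (hα : AlwaysGood α₀)
    (hβ : AlwaysGood β₀ ∨ β₀.card = b ∧ Good β₀) : PairOccurs a b μ := by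
  obtain ⟨α, β, h1, h2, h3, h4, h5⟩ := h.exists_enlarge hμ ha hb hc
  refine ⟨α, β, ⟨h3, hα α h1⟩, ⟨h4, ?_⟩, h5⟩
  rcases hβ with hβ | ⟨hβ, hβ'⟩
  · exact hβ β h2
  · exact eq_of_le_of_card_le h2 (by omega) ▸ hβ'

theorem pairOccurs_of_square {b : ℕ} {m : List ℕ} {μ : YoungDiagram}
    (hμ : dg m ≤ μ) {a : ℕ} (hc : μ.card = a + b) (ha : 4 ≤ a) (hb : 4 ≤ b)
    (h : LR (dg [2, 2]) (dg [2, 2]) (dg m)) : PairOccurs a b μ :=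
  pairOccurs_of_le h hμ hc (by rw [card_dg (by decide)]; exact ha)
    (by rw [card_dg (by decide)]; exact hb) alwaysGood_square (Or.inl alwaysGood_square)

theorem lr_square_431 : LR (dg [2, 2]) (dg [2, 2]) (dg [4, 3, 1]) :=
  (lr_square_iff (by decide) (by decide) (by decide) (by decide) (by decide)).2 (by decide)

theorem lr_square_422 : LR (dg [2, 2]) (dg [2, 2]) (dg [4, 2, 2]) :=
  (lr_square_iff (by decide) (by decide) (by decide) (by decide) (by decide)).2 (by decide)

theorem lr_square_hook_5211 : LR (dg [2, 2]) (dg [3, 1, 1]) (dg [5, 2, 1, 1]) :=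
  (lr_square_iff (by decide) (by decide) (by decide) (by decide) (by decide)).2 (by decide)

theorem lr_square_hook_333 : LR (dg [2, 2]) (dg [3, 1, 1]) (dg [3, 3, 3]) :=
  (lr_square_iff (by decide) (by decide) (by decide) (by decide) (by decide)).2 (by decide)

/-- For a hook `μ`, a hook `α` with first row `p` can be completed to `μ` by a horizontal strip of
size `b` as soon as `p` is `μ₀ - b` or `μ₀ - b + 1`. -/
theorem pairOccurs_of_hook {μ : YoungDiagram} {a b p : ℕ} (h1 : μ.rowLen 1 ≤ 1)
    (hc : μ.card = a + b) (hp : 0 < p) (hpa : p ≤ a) (hb : 0 < b)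
    (hpb : p + b = μ.rowLen 0 ∨ p + b = μ.rowLen 0 + 1) (h2 : p ≠ 2) (ha1 : p + 1 ≠ a) :
    PairOccurs a b μ := by
  have hpos := rowLen_zero_pos (μ := μ) (by omega)
  have hhook := card_add_one_of_hook h1 hpos
  obtain ⟨α, hα⟩ := exists_rowLen_eq (N := a - p + 1)
    (f := fun i => if i = 0 then p else if i ≤ a - p then 1 else 0)
    (fun i j hij => by
      by_cases hj0 : j = 0
      · obtain rfl : i = 0 := by omega
        simp [hj0]
      · by_cases hi0 : i = 0 <;> by_cases hi : i ≤ a - p <;> by_cases hj : j ≤ a - p <;>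
          simp only [hj0, hi0, hi, hj, if_true, if_false] <;> omega)
    (by rw [if_neg (by omega), if_neg (by omega)])
  have hα0 : α.rowLen 0 = p := by rw [hα, if_pos rfl]
  have hαc : α.colLen 0 = a - p + 1 := by
    refine eq_of_forall_lt_iff fun i => ?_
    rw [← mem_iff_lt_colLen, mem_iff_lt_rowLen, hα]
    split_ifs <;> omega
  have hα1 : α.rowLen 1 ≤ 1 := by
    rw [hα, if_neg one_ne_zero]
    split_ifs <;> omega
  have hαcard := card_add_one_of_hook hα1 (by omega)
  have hαa : α.card = a := by omega
  have hμi : ∀ i, μ.rowLen i = if i = 0 then μ.rowLen 0 else if i < μ.colLen 0 then 1 else 0 := by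
    intro i
    by_cases hi : i = 0
    · rw [if_pos hi, hi]
    · rw [if_neg hi]
      have h3 := μ.rowLen_anti 1 i (by omega)
      have h4 : i < μ.colLen 0 ↔ 0 < μ.rowLen i := by
        rw [← mem_iff_lt_colLen, mem_iff_lt_rowLen]
      split_ifs with h5
      · have := h4.1 h5
        omega
      · have := mt h4.2 h5
        omega
  have hlr : LR (rowDiagram b) α μ := by
    refine lr_rowDiagram_iff.2 ⟨fun i => ?_, by rw [hc, hαa]⟩
    rw [hα, hμi i, hμi (i + 1), if_neg (Nat.succ_ne_zero i)]
    split_ifs <;> omega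
  exact ⟨α, rowDiagram b, ⟨hαa, Or.inr ⟨by omega, by omega⟩⟩,
    ⟨card_rowDiagram b, good_rowDiagram b⟩, hlr.symm⟩

/-- Two rows are filled by a row and a row. -/
theorem pairOccurs_of_two_rows {μ : YoungDiagram} {a b : ℕ} (h2 : μ.rowLen 2 = 0)
    (hc : μ.card = a + b) (h1 : μ.rowLen 1 ≤ b) (hba : b ≤ a) : PairOccurs a b μ := by
  have hsum : μ.card = μ.rowLen 0 + μ.rowLen 1 := by
    rw [card_eq_sum_rowLen μ h2, Finset.sum_range_succ, Finset.sum_range_one]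
  refine ⟨rowDiagram a, rowDiagram b, ⟨card_rowDiagram a, good_rowDiagram a⟩,
    ⟨card_rowDiagram b, good_rowDiagram b⟩, (lr_rowDiagram_iff.2 ⟨fun i => ?_, ?_⟩).symm⟩
  · have h3 := μ.rowLen_anti 2 (i + 2)
    rw [rowLen_rowDiagram]
    rcases i with _ | i
    · simp only [if_true, zero_add]
      omega
    · rw [if_neg (Nat.succ_ne_zero i)]
      have := μ.rowLen_anti 2 (i + 1 + 1) (by omega)
      omega
  · rw [hc, card_rowDiagram]

theorem rowLen_two_pos_iff {μ : YoungDiagram} : 0 < μ.rowLen 2 ↔ 2 < μ.colLen 0 := by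
  rw [← mem_iff_lt_colLen, mem_iff_lt_rowLen]

/-- The number of cells of a diagram with at most three rows. -/
theorem card_of_colLen_le_three {μ : YoungDiagram} (h : μ.colLen 0 ≤ 3) :
    μ.card = μ.rowLen 0 + μ.rowLen 1 + μ.rowLen 2 := by
  rw [card_eq_sum_rowLen μ (rowLen_eq_zero_of_colLen_le μ h)]
  simp [Finset.sum_range_succ]

/-- Outside hooks and two rows, a wide `μ` contains one of `(5, 2)`, `(4, 2, 1)`, `(3, 2, 2)`,
`(3, 3, 1)`, all of which arise from the two by two square by a strip of size three. -/
theorem pairOccurs_three_of_colLen_le {a : ℕ} (ha : a = 4 ∨ 6 ≤ a) {μ : YoungDiagram}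
    (hc : μ.card = a + 3) (hwide : μ.colLen 0 ≤ μ.rowLen 0) : PairOccurs a 3 μ := by
  have hpos := rowLen_zero_pos (μ := μ) (by omega)
  have hcpos := colLen_pos_iff.2 hpos
  by_cases h1 : μ.rowLen 1 ≤ 1
  · have hhook := card_add_one_of_hook h1 hpos
    by_cases h511 : a = 4 ∧ μ.rowLen 0 = 5
    · -- The hook `(5, 1, 1)` is a row of four cells and a column of three cells.
      refine ⟨rowDiagram a, colDiagram 3, ⟨card_rowDiagram a, good_rowDiagram a⟩,
        ⟨card_colDiagram 3, good_colDiagram 3⟩, (lr_colDiagram_iff.2 ⟨fun i => ?_, ?_⟩).symm⟩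
      · rw [rowLen_rowDiagram]
        rcases i with _ | i
        · simp only [if_true]
          omega
        · rw [if_neg (Nat.succ_ne_zero i)]
          have := μ.rowLen_anti 1 (i + 1) (by omega)
          omega
      · rw [hc, card_rowDiagram]
    · -- The first row of the smaller hook is chosen so that this hook is not left out.
      by_cases hp : μ.rowLen 0 - 3 = 2 ∨ μ.rowLen 0 - 3 + 1 = a ∨ a < μ.rowLen 0 - 3
      · exact pairOccurs_of_hook (p := μ.rowLen 0 - 2) h1 hc (by omega) (by omega) (by omega)
          (by omega) (by omega) (by omega)
      · exact pairOccurs_of_hook (p := μ.rowLen 0 - 3) h1 hc (by omega) (by omega) (by omega)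
          (by omega) (by omega) (by omega)
  have row : ∀ m : List ℕ, m.SortedGE → isHorizontalStrip [2, 2] m = true → m.sum = 7 →
      dg m ≤ μ → PairOccurs a 3 μ := fun m hm hs h7 hle =>
    pairOccurs_of_le (LR.of_isHorizontalStrip (r := 3) (by decide) hm hs h7).symm hle hc
      (by rw [card_dg (by decide)]; change 4 ≤ a; omega) (by rw [card_rowDiagram])
      alwaysGood_square (Or.inr ⟨card_rowDiagram 3, good_rowDiagram 3⟩)
  by_cases h2 : μ.rowLen 2 = 0
  · by_cases h52 : 5 ≤ μ.rowLen 0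
    · exact row [5, 2] (by decide) (by decide) (by decide) (dg_two_le (by decide) h52 (by omega))
    · have := rowLen_two_pos_iff (μ := μ)
      have := card_of_colLen_le_three (μ := μ) (by omega)
      have := μ.rowLen_anti 0 1 (by omega)
      exact pairOccurs_of_two_rows h2 hc (by omega) (by omega)
  have h3 := rowLen_two_pos_iff.1 (Nat.pos_of_ne_zero h2)
  by_cases h4 : 4 ≤ μ.rowLen 0
  · exact row [4, 2, 1] (by decide) (by decide) (by decide)
      (dg_three_le (by decide) h4 (by omega) (by omega))
  by_cases h22 : 2 ≤ μ.rowLen 2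
  · exact row [3, 2, 2] (by decide) (by decide) (by decide)
      (dg_three_le (by decide) (by omega) (by omega) h22)
  by_cases h33 : 3 ≤ μ.rowLen 1
  · exact pairOccurs_of_le
      (LR.of_isVerticalStrip (r := 3) (k := [2, 2]) (m := [3, 3, 1]) (by decide) (by decide)
        (by decide) (by decide)).symm (dg_three_le (by decide) (by omega) h33 (by omega)) hc
      (by rw [card_dg (by decide)]; change 4 ≤ a; omega) (by rw [card_colDiagram])
      alwaysGood_square (Or.inr ⟨card_colDiagram 3, good_colDiagram 3⟩)
  have := card_of_colLen_le_three (μ := μ) (by omega)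
  omega

/-- Outside hooks, two rows and `(m, 2, 1)`, a wide `μ` contains a diagram that occurs in the
product of the Schur functions of two diagrams from `(2, 2)` and `(3, 1, 1)`. -/
theorem pairOccurs_four_of_colLen_le {a b : ℕ} (ha : 5 ≤ a) (hb : 4 ≤ b) (hba : b ≤ a)
    {μ : YoungDiagram} (hc : μ.card = a + b) (hwide : μ.colLen 0 ≤ μ.rowLen 0) :
    PairOccurs a b μ := by
  have hpos := rowLen_zero_pos (μ := μ) (by omega)
  have hcpos := colLen_pos_iff.2 hpos
  by_cases h1 : μ.rowLen 1 ≤ 1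
  · have hhook := card_add_one_of_hook h1 hpos
    -- The first row of the smaller hook is chosen so that this hook is not left out.
    by_cases hp : μ.rowLen 0 - b = 2 ∨ μ.rowLen 0 - b + 1 = a
    · exact pairOccurs_of_hook (p := μ.rowLen 0 - b + 1) h1 hc (by omega) (by omega) (by omega)
        (by omega) (by omega) (by omega)
    · exact pairOccurs_of_hook (p := μ.rowLen 0 - b) h1 hc (by omega) (by omega) (by omega)
        (by omega) (by omega) (by omega)
  have h01 := μ.rowLen_anti 0 1 (by omega)
  have h12 := μ.rowLen_anti 1 2 (by omega)
  by_cases h2 : μ.rowLen 2 = 0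
  · by_cases h44 : 4 ≤ μ.rowLen 1
    · exact pairOccurs_of_square (dg_two_le (by decide) (by omega) h44) hc (by omega)
        hb lr_square_44
    · exact pairOccurs_of_two_rows h2 hc (by omega) hba
  have h3 := rowLen_two_pos_iff.1 (Nat.pos_of_ne_zero h2)
  have hook : ∀ m : List ℕ, LR (dg [2, 2]) (dg [3, 1, 1]) (dg m) → dg m ≤ μ →
      PairOccurs a b μ := fun m h hle =>
    pairOccurs_of_le h.symm hle hc (by rw [card_dg (by decide)]; exact ha)
      (by rw [card_dg (by decide)]; exact hb) alwaysGood_hook (Or.inl alwaysGood_square)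
  by_cases h33 : 3 ≤ μ.rowLen 1
  · by_cases h4 : 4 ≤ μ.rowLen 0
    · exact pairOccurs_of_square
        (dg_three_le (by decide) h4 h33 (Nat.pos_of_ne_zero h2)) hc (by omega) hb lr_square_431
    · have := card_of_colLen_le_three (μ := μ) (by omega)
      exact hook _ lr_square_hook_333 (dg_three_le (by decide) (by omega) h33 (by omega))
  by_cases h22 : 2 ≤ μ.rowLen 2
  · by_cases h4 : 4 ≤ μ.rowLen 0
    · exact pairOccurs_of_square
        (dg_three_le (by decide) h4 (by omega) h22) hc (by omega) hb lr_square_422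
    · have := card_of_colLen_le_three (μ := μ) (by omega)
      omega
  by_cases hc3 : μ.colLen 0 ≤ 3
  · -- Here `μ = (m, 2, 1)`, and the strip can be taken from the first row.
    have hcard := card_of_colLen_le_three hc3
    obtain ⟨α, hα⟩ := exists_rowLen_eq (N := 3)
      (f := fun i => if i = 0 then a - 3 else if i = 1 then 2 else if i = 2 then 1 else 0)
      (fun i j hij => by
        simp only
        split_ifs <;> omega) (by simp)
    have hα3 : α.rowLen 3 = 0 := by rw [hα]; simp
    have hαa : α.card = a := by
      rw [card_eq_sum_rowLen α hα3]
      simp only [hα, Finset.sum_range_succ, Finset.sum_range_zero]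
      simp
      omega
    refine ⟨α, rowDiagram b, ⟨hαa, good_of_one_one_mem (mem_iff_lt_rowLen.2 (by
      rw [hα]; simp))⟩, ⟨card_rowDiagram b, good_rowDiagram b⟩,
      (lr_rowDiagram_iff.2 ⟨fun i => ?_, by rw [hc, hαa]⟩).symm⟩
    rw [hα]
    have h3' := rowLen_eq_zero_of_colLen_le μ hc3
    rcases i with _ | _ | _ | i
    · simp; omega
    · simp; omega
    · simp; omega
    · have h4 := μ.rowLen_anti 3 (i + 1 + 1 + 1) (by omega)
      have h5 := μ.rowLen_anti 3 (i + 1 + 1 + 1 + 1) (by omega)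
      simp
      omega
  · have h13 : 1 ≤ μ.rowLen 3 := by
      rw [Nat.one_le_iff_ne_zero, ← Nat.pos_iff_ne_zero, ← mem_iff_lt_rowLen, mem_iff_lt_colLen]
      omega
    by_cases h5 : 5 ≤ μ.rowLen 0
    · exact hook _ lr_square_hook_5211
        (dg_four_le (by decide) h5 (by omega) (by omega) h13)
    · exfalso
      have h6 := card_eq_sum_rowLen μ (rowLen_eq_zero_of_colLen_le μ
        (show μ.colLen 0 ≤ 4 by omega))
      have h7 := μ.rowLen_anti 2 3 (by omega)
      simp [Finset.sum_range_succ] at h6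
      omega

/-- By transposition, only diagrams that are at least as wide as high need to be considered. -/
theorem pairOccurs_of_wide {a b : ℕ}
    (h : ∀ μ : YoungDiagram, μ.card = a + b → μ.colLen 0 ≤ μ.rowLen 0 → PairOccurs a b μ)
    {μ : YoungDiagram} (hμ : μ.card = a + b) : PairOccurs a b μ := by
  rcases le_total (μ.colLen 0) (μ.rowLen 0) with hle | hle
  · exact h μ hμ hle
  · have := h μ.transpose (by rw [card_transpose, hμ]) (by
      rwa [colLen_transpose, rowLen_transpose])
    simpa using this.transpose

/-- The pairs `a ≥ b` for which some Schur function is missing from `g_a g_b`. -/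
def ExceptionalPair (a b : ℕ) : Prop :=
  a = 3 ∧ b = 1 ∨ a = 4 ∧ b = 1 ∨ a = 3 ∧ b = 3 ∨ a = 4 ∧ b = 4 ∨ a = 5 ∧ b = 3

theorem full_pair {a b : ℕ} (hb : 0 < b) (hba : b ≤ a) (h : ¬ ExceptionalPair a b) :
    Full {a, b} := by
  intro μ hμ
  rw [Multiset.insert_eq_cons, Multiset.sum_cons, Multiset.sum_singleton] at hμ
  rw [occurs_pair_iff]
  rw [ExceptionalPair] at h
  by_cases hb2 : b ≤ 2
  · exact pairOccurs_of_le_two hb2 (by omega) hμ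
  by_cases hb3 : b = 3
  · subst hb3
    exact pairOccurs_of_wide (fun μ hμ => pairOccurs_three_of_colLen_le (by omega) hμ) hμ
  · exact pairOccurs_of_wide
      (fun μ hμ => pairOccurs_four_of_colLen_le (by omega) (by omega) hba hμ) hμ

/-! ### Products of three factors and the exceptions -/

/-- The list version of `Good`. -/
def isGood (l : List ℕ) : Bool :=
  decide (l.sum ≤ 2) || (l.headD 0 + 1 != l.sum && l.length + 1 != l.sum)

theorem good_dg_iff {n : ℕ} {l : List ℕ} (h : l ∈ partitionLists n) :
    Good (dg l) ↔ isGood l = true := by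
  have hs := sortedGE_of_mem h
  have h1 : (dg l).colLen 0 = l.length := by rw [← length_rowLens, rowLens_dg h]
  have h2 : l.headD 0 = l.getD 0 0 := by cases l <;> rfl
  rw [Good, card_dg hs, rowLen_dg hs, h1, isGood, h2]
  simp

theorem colDiagram_eq_dg (k : ℕ) : colDiagram k = dg (List.replicate k 1) := by
  have h0 : (List.replicate k 1).Pairwise (· ≥ ·) := List.pairwise_replicate.2 (Or.inr le_rfl)
  have h := h0.sortedGE
  refine ext_rowLen fun i => eq_of_forall_lt_iff fun j => ?_
  rw [rowLen_dg h, ← mem_iff_lt_rowLen, colDiagram, mem_transpose, mem_iff_lt_rowLen,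
    rowLen_rowDiagram]
  by_cases hi : i < k
  · rw [List.getD_eq_getElem _ _ (by simpa using hi), List.getElem_replicate]
    simp only [Prod.swap_prod_mk]
    split_ifs <;> omega
  · rw [List.getD_eq_default _ _ (by simpa using hi)]
    simp only [Prod.swap_prod_mk]
    split_ifs <;> omega

/-- Either a row or a column can be added to go from `k` to `m`. -/
def isStrip (k m : List ℕ) : Bool := isHorizontalStrip k m || isVerticalStrip k m

theorem exists_lr_of_isStrip {k m : List ℕ} (hk : k.SortedGE) (hm : m.SortedGE) {r : ℕ}
    (h : isStrip k m = true) (hs : m.sum = k.sum + r) :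
    ∃ α, (α.card = r ∧ Good α) ∧ LR α (dg k) (dg m) := by
  rw [isStrip, Bool.or_eq_true] at h
  rcases h with h | h
  · exact ⟨rowDiagram r, ⟨card_rowDiagram r, good_rowDiagram r⟩,
      LR.of_isHorizontalStrip hk hm h hs⟩
  · exact ⟨colDiagram r, ⟨card_colDiagram r, good_colDiagram r⟩,
      LR.of_isVerticalStrip hk hm h hs⟩

/-- Every partition of `a + b + c` arises by adding strips of sizes `b` and `c` to a partition
of `a` that is not left out; in the first step, the partitions in `L` are granted. -/
def coversAll (a b c : ℕ) (L : List (List ℕ)) : Bool :=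
  (partitionLists (a + b + c)).all fun m => (partitionLists (a + b)).any fun x =>
    isStrip x m && (L.contains x || (partitionLists a).any fun y => isGood y && isStrip y x)

theorem full_triple {a b c : ℕ} {L : List (List ℕ)} (h : coversAll a b c L = true)
    (hL : ∀ x ∈ L, PairOccurs b a (dg x)) : Full {c, b, a} := by
  intro μ hμ
  have hμ' : μ.card = a + b + c := by
    rw [hμ]
    simp only [Multiset.insert_eq_cons, Multiset.sum_cons, Multiset.sum_singleton]
    omega
  obtain ⟨m, hm, rfl⟩ := exists_mem_partitionLists hμ'
  have h1 := List.all_eq_true.1 h m hm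
  rw [List.any_eq_true] at h1
  obtain ⟨x, hx, h1⟩ := h1
  rw [Bool.and_eq_true, Bool.or_eq_true] at h1
  have hms := sortedGE_of_mem hm
  have hxs := sortedGE_of_mem hx
  obtain ⟨γ, hγ, hlr⟩ := exists_lr_of_isStrip (r := c) hxs hms h1.1
    (by rw [sum_of_mem hm, sum_of_mem hx])
  rw [Multiset.insert_eq_cons, occurs_cons_iff]
  refine ⟨γ, dg x, hγ, ?_, hlr⟩
  rw [occurs_pair_iff]
  rcases h1.2 with h2 | h2
  · exact hL x (by simpa using h2)
  · rw [List.any_eq_true] at h2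
    obtain ⟨y, hy, h2⟩ := h2
    rw [Bool.and_eq_true] at h2
    have hys := sortedGE_of_mem hy
    obtain ⟨β, hβ, hlr'⟩ := exists_lr_of_isStrip (r := b) hys hxs h2.2
      (by rw [sum_of_mem hx, sum_of_mem hy])
    exact ⟨β, dg y, hβ, ⟨by rw [card_dg hys, sum_of_mem hy], (good_dg_iff hy).2 h2.1⟩, hlr'⟩

theorem full_one_three_three : Full {1, 3, 3} :=
  full_triple (L := []) (by decide) (by simp)

theorem full_three_three_three : Full {3, 3, 3} :=
  full_triple (L := []) (by decide) (by simp)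

theorem full_three_three_five : Full {3, 3, 5} :=
  full_triple (L := []) (by decide) (by simp)

theorem lr_square_3221 : LR (dg [2, 2]) (dg [2, 2]) (dg [3, 2, 2, 1]) :=
  (lr_square_iff (by decide) (by decide) (by decide) (by decide) (by decide)).2 (by decide)

/-- Adding strips does not suffice here: the partitions `(4, 3, 1)` and `(3, 2, 2, 1)` of `8` are
obtained from the product of two squares. -/
theorem full_four_four_four : Full {4, 4, 4} := by
  have hs : (dg [2, 2]).card = 4 ∧ Good (dg [2, 2]) :=
    ⟨card_dg (by decide), alwaysGood_square _ le_rfl⟩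
  refine full_triple (L := [[4, 3, 1], [3, 2, 2, 1]]) (by decide) fun x hx => ?_
  simp only [List.mem_cons, List.not_mem_nil, or_false] at hx
  rcases hx with rfl | rfl
  · exact ⟨_, _, hs, hs, lr_square_431⟩
  · exact ⟨_, _, hs, hs, lr_square_3221⟩

/-- The partitions of `n` that are not left out. -/
def goodLists (n : ℕ) : List (List ℕ) := (partitionLists n).filter isGood

theorem PairOccurs.exists_lists {a b : ℕ} {μ : YoungDiagram} (h : PairOccurs a b μ) :
    ∃ x ∈ goodLists a, ∃ y ∈ goodLists b, LR (dg x) (dg y) μ := by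
  obtain ⟨α, β, ⟨h1, h1'⟩, ⟨h2, h2'⟩, h3⟩ := h
  obtain ⟨x, hx, rfl⟩ := exists_mem_partitionLists h1
  obtain ⟨y, hy, rfl⟩ := exists_mem_partitionLists h2
  exact ⟨x, List.mem_filter.2 ⟨hx, (good_dg_iff hx).1 h1'⟩, y,
    List.mem_filter.2 ⟨hy, (good_dg_iff hy).1 h2'⟩, h3⟩

theorem getD_le_of_lr {x m : List ℕ} {β : YoungDiagram} (hx : x.SortedGE) (hm : m.SortedGE)
    (h : LR (dg x) β (dg m)) (i : ℕ) : x.getD i 0 ≤ m.getD i 0 := by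
  rw [← rowLen_dg hx, ← rowLen_dg hm]
  exact le_iff_rowLen.1 h.le i

theorem isHorizontalStrip_of_lr {k : ℕ} {y m : List ℕ} (hy : y.SortedGE) (hm : m.SortedGE)
    (h : LR (dg [k]) (dg y) (dg m)) : isHorizontalStrip y m = true := by
  rw [← rowDiagram_eq_dg] at h
  exact (horizontalStrip_dg_iff hy hm).1 (lr_rowDiagram_iff.1 h).1

theorem goodLists_three : goodLists 3 = [[1, 1, 1], [3]] := by decide

theorem goodLists_four : goodLists 4 = [[1, 1, 1, 1], [2, 2], [4]] := by decide

theorem goodLists_five :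
    goodLists 5 = [[1, 1, 1, 1, 1], [2, 2, 1], [3, 1, 1], [3, 2], [5]] := by decide

theorem not_pairOccurs_three_one : ¬ PairOccurs 3 1 (dg [2, 2]) := fun h => by
  obtain ⟨x, hx, y, -, h⟩ := h.exists_lists
  rw [goodLists_three] at hx
  simp only [List.mem_cons, List.not_mem_nil, or_false] at hx
  rcases hx with rfl | rfl
  · exact absurd (getD_le_of_lr (by decide) (by decide) h 2) (by decide)
  · exact absurd (getD_le_of_lr (by decide) (by decide) h 0) (by decide)

theorem not_pairOccurs_four_one : ¬ PairOccurs 4 1 (dg [3, 1, 1]) := fun h => by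
  obtain ⟨x, hx, y, -, h⟩ := h.exists_lists
  rw [goodLists_four] at hx
  simp only [List.mem_cons, List.not_mem_nil, or_false] at hx
  rcases hx with rfl | rfl | rfl
  · exact absurd (getD_le_of_lr (by decide) (by decide) h 3) (by decide)
  · exact absurd (getD_le_of_lr (by decide) (by decide) h 1) (by decide)
  · exact absurd (getD_le_of_lr (by decide) (by decide) h 0) (by decide)

theorem not_pairOccurs_three_three : ¬ PairOccurs 3 3 (dg [3, 2, 1]) := fun h => by
  obtain ⟨x, hx, y, hy, h⟩ := h.exists_lists
  rw [goodLists_three] at hx hy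
  simp only [List.mem_cons, List.not_mem_nil, or_false] at hx hy
  rcases hx with rfl | rfl <;> rcases hy with rfl | rfl
  · rw [show dg [1, 1, 1] = colDiagram 3 from (colDiagram_eq_dg 3).symm, lr_colDiagram_iff,
      colDiagram_eq_dg] at h
    have h1 := (h.1 0).2
    rw [rowLen_dg (by decide), rowLen_dg (by decide)] at h1
    exact absurd h1 (by decide)
  · exact absurd (isHorizontalStrip_of_lr (by decide) (by decide) h.symm) (by decide)
  · exact absurd (isHorizontalStrip_of_lr (by decide) (by decide) h) (by decide)
  · exact absurd (isHorizontalStrip_of_lr (by decide) (by decide) h) (by decide)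

theorem not_pairOccurs_five_three : ¬ PairOccurs 5 3 (dg [4, 4]) := fun h => by
  obtain ⟨x, hx, y, hy, h⟩ := h.exists_lists
  rw [goodLists_five] at hx
  rw [goodLists_three] at hy
  simp only [List.mem_cons, List.not_mem_nil, or_false] at hx hy
  rcases hy with rfl | rfl
  · exact absurd (getD_le_of_lr (by decide) (by decide) h.symm 2) (by decide)
  · rcases hx with rfl | rfl | rfl | rfl | rfl <;>
      exact absurd (isHorizontalStrip_of_lr (by decide) (by decide) h.symm) (by decide)

theorem not_pairOccurs_four_four : ¬ PairOccurs 4 4 (dg [3, 3, 2]) := fun h => by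
  obtain ⟨x, hx, y, hy, h⟩ := h.exists_lists
  rw [goodLists_four] at hx hy
  simp only [List.mem_cons, List.not_mem_nil, or_false] at hx hy
  rcases hx with rfl | rfl | rfl
  · exact absurd (getD_le_of_lr (by decide) (by decide) h 3) (by decide)
  · rcases hy with rfl | rfl | rfl
    · exact absurd (getD_le_of_lr (by decide) (by decide) h.symm 3) (by decide)
    · exact (lr_square_iff (by decide) (by decide) (by decide) (by decide) (by decide)).1 h
        (by decide)
    · exact absurd (getD_le_of_lr (by decide) (by decide) h.symm 0) (by decide)
  · exact absurd (getD_le_of_lr (by decide) (by decide) h 0) (by decide)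

/-- Only `(3, 3, 2)` is obtained by removing a cell from the square of size three, and it does not
occur in `g_4 g_4`. -/
theorem not_full_four_four_one : ¬ Full {1, 4, 4} := fun h => by
  have h1 := h (dg [3, 3, 3]) (by rw [card_dg (by decide)]; rfl)
  rw [Multiset.insert_eq_cons, occurs_cons_iff] at h1
  obtain ⟨α, β, ⟨h2, -⟩, h3, h4⟩ := h1
  rw [eq_of_card_le_one (ν := rowDiagram 1) (by rw [h2, card_rowDiagram]) h2.le] at h4
  have hc := h4.card_eq
  rw [card_dg (by decide), card_rowDiagram] at hc
  obtain ⟨l, hl, rfl⟩ := exists_mem_partitionLists (n := 8) (μ := β) (by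
    simp at hc
    omega)
  have h5 := (horizontalStrip_dg_iff (sortedGE_of_mem hl) (by decide)).1
    (lr_rowDiagram_iff.1 h4).1
  have h6 : l ∈ (partitionLists 8).filter fun l => isHorizontalStrip l [3, 3, 3] :=
    List.mem_filter.2 ⟨hl, h5⟩
  rw [show ((partitionLists 8).filter fun l => isHorizontalStrip l [3, 3, 3]) = [[3, 3, 2]] by
    decide, List.mem_singleton] at h6
  subst h6
  exact not_pairOccurs_four_four (occurs_pair_iff.1 h3)

theorem not_full_pair {a b : ℕ} {m : List ℕ} (hm : m.SortedGE) (hs : m.sum = a + b)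
    (h : ¬ PairOccurs a b (dg m)) : ¬ Full {a, b} := fun hf =>
  h (occurs_pair_iff.1 (hf (dg m) (by
    rw [card_dg hm, hs, Multiset.insert_eq_cons, Multiset.sum_cons, Multiset.sum_singleton])))

/-- The partitions for which some irreducible representation is missing. -/
def exceptions : Set (Multiset ℕ) := {{3, 1}, {4, 1}, {3, 3}, {4, 4}, {5, 3}, {4, 4, 1}}

theorem not_full_of_mem_exceptions {S : Multiset ℕ} (h : S ∈ exceptions) : ¬ Full S := by
  simp only [exceptions, Set.mem_insert_iff, Set.mem_singleton_iff] at h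
  rcases h with rfl | rfl | rfl | rfl | rfl | rfl
  · exact not_full_pair (by decide) rfl not_pairOccurs_three_one
  · exact not_full_pair (by decide) rfl not_pairOccurs_four_one
  · exact not_full_pair (by decide) rfl not_pairOccurs_three_three
  · exact not_full_pair (by decide) rfl not_pairOccurs_four_four
  · exact not_full_pair (by decide) rfl not_pairOccurs_five_three
  · rw [show ({4, 4, 1} : Multiset ℕ) = {1, 4, 4} by decide]
    exact not_full_four_four_one

/-- If `∏ g_k` is not full, neither is any product of two or three of the factors. So all pairs of
parts are exceptional, which leaves only few possibilities for the three largest parts. -/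
theorem full_of_notMem_exceptions {S : Multiset ℕ} (h0 : ∀ x ∈ S, 0 < x) (h2 : 2 ≤ S.card)
    (h : S ∉ exceptions) : Full S := by
  simp only [exceptions, Set.mem_insert_iff, Set.mem_singleton_iff, not_or] at h
  obtain ⟨h31, h41, h33, h44, h53, h441⟩ := h
  by_contra hS
  obtain ⟨l, hl, rfl⟩ : ∃ l : List ℕ, l.Pairwise (· ≥ ·) ∧ (l : Multiset ℕ) = S :=
    ⟨S.sort (· ≥ ·), Multiset.pairwise_sort S _, Multiset.sort_eq S _⟩
  -- Two parts of a product with a missing Schur function form an exceptional pair.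
  have pair : ∀ {a b : ℕ}, [a, b].Sublist l → ExceptionalPair a b := by
    intro a b hab
    by_contra hne
    have h3 : b ≤ a := by
      have := hl.sublist hab
      simpa using this
    have h4 := h0 b (hab.subset (by simp))
    have h5 : Full {a, b} := full_pair h4 h3 hne
    refine hS (h5.mono ?_ (Multiset.coe_le.2 hab.subperm))
    rw [Multiset.insert_eq_cons, Multiset.sum_cons, Multiset.sum_singleton]
    omega
  have triple : ∀ {T : Multiset ℕ} {t : List ℕ}, Full T → (t : Multiset ℕ) = T →
      2 ≤ T.sum → ¬ t.Sublist l := fun hT ht h3 hsub =>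
    hS (hT.mono h3 (ht ▸ Multiset.coe_le.2 hsub.subperm))
  match l, hl, h2 with
  | [a, b], _, _ =>
    rcases pair (a := a) (b := b) (List.Sublist.refl _) with
      ⟨rfl, rfl⟩ | ⟨rfl, rfl⟩ | ⟨rfl, rfl⟩ | ⟨rfl, rfl⟩ | ⟨rfl, rfl⟩
    · exact h31 rfl
    · exact h41 rfl
    · exact h33 rfl
    · exact h44 rfl
    · exact h53 rfl
  | a :: b :: c :: r, hl, _ =>
    have hsub : [a, b, c].Sublist (a :: b :: c :: r) := by simp
    have hab := pair (a := a) (b := b) (by simp)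
    have hac := pair (a := a) (b := c) (List.Sublist.trans (by simp) hsub)
    have hbc := pair (a := b) (b := c) (List.Sublist.trans (by simp) hsub)
    have hcases : a = 3 ∧ b = 3 ∧ c = 1 ∨ a = 3 ∧ b = 3 ∧ c = 3 ∨ a = 5 ∧ b = 3 ∧ c = 3 ∨
        a = 4 ∧ b = 4 ∧ c = 4 ∨ a = 4 ∧ b = 4 ∧ c = 1 := by
      simp only [ExceptionalPair] at hab hac hbc
      omega
    rcases hcases with ⟨rfl, rfl, rfl⟩ | ⟨rfl, rfl, rfl⟩ | ⟨rfl, rfl, rfl⟩ | ⟨rfl, rfl, rfl⟩ |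
      ⟨rfl, rfl, rfl⟩
    · exact triple full_one_three_three (by decide) (by decide) hsub
    · exact triple full_three_three_three (by decide) (by decide) hsub
    · exact triple full_three_three_five (by decide) (by decide) hsub
    · exact triple full_four_four_four (by decide) (by decide) hsub
    · cases r with
      | nil => exact h441 rfl
      | cons d r =>
        -- A part following a part `1` would form a pair that is not exceptional.
        have hd : ExceptionalPair 1 d := pair (List.Sublist.trans (l₂ := [1, d]) (by simp)
          (((List.sublist_append_left [1, d] r).trans (List.sublist_cons_self 4 _)).trans
            (List.sublist_cons_self 4 _)))
        simp only [ExceptionalPair] at hd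
        omega

theorem full_iff {S : Multiset ℕ} (h0 : ∀ x ∈ S, 0 < x) (h2 : 2 ≤ S.card) :
    Full S ↔ S ∉ exceptions :=
  ⟨fun h h' => not_full_of_mem_exceptions h' h, full_of_notMem_exceptions h0 h2⟩

end FrobChar

end

theorem theorem3p9 (n : ℕ) (lam : n.Partition) (hlam : 2 ≤ lam.parts.card) :
    (∃ (W : Type u) (_ : AddCommGroup W) (_ : Module ℂ W)
        (ρ : Representation ℂ (Equiv.Perm (Fin n)) W),
      FiniteDimensional ℂ W ∧
        FrobChar.frobeniusCharacteristic ρ = (lam.parts.map FrobChar.g).prod) ∧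
    ∀ (W : Type u) [AddCommGroup W] [Module ℂ W] [FiniteDimensional ℂ W]
        (ρ : Representation ℂ (Equiv.Perm (Fin n)) W),
      FrobChar.frobeniusCharacteristic ρ = (lam.parts.map FrobChar.g).prod →
        (FrobChar.ContainsEveryIrreducible.{u, v} ρ ↔
          lam.parts ∉ ({{3, 1}, {4, 1}, {3, 3}, {4, 4}, {5, 3}, {4, 4, 1}} :
            Set (Multiset ℕ))) := by
  have hpos := FrobChar.schurPositive_prod_g lam.parts
  rw [lam.parts_sum] at hpos
  refine ⟨hpos.exists_representation, fun W _ _ _ ρ hρ => ?_⟩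
  rw [FrobChar.containsEveryIrreducible_iff, hρ]
  refine Iff.trans ?_ (FrobChar.full_iff (fun _ hx => lam.parts_pos hx) hlam)
  simp only [FrobChar.Full, YoungDiagram.mem_sized, lam.parts_sum, FrobChar.Occurs]
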